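/- Let $n$ be a dimension and $0<h\le 1$. For $u\in L^2(\mathbb R^n)$ let $$Tu(x,\xi)=c\,h^{-3n/4}\int_{\mathbb R^n}e^{\frac ih\left(\langle x-y,\xi\rangle+\frac i2|x-y|^2\right)}u(y)\,dy,\qquad c=2^{-n/2}\pi^{-3n/4},$$ be the FBI transform. It is an isometry from $L^2(\mathbb R^n)$ into $L^2(T^*\mathbb R^n)$, $T^*\mathbb R^n=\mathbb R^n_x\times\mathbb R^n_\xi$, and its range is $$\mathscr H=\{w\in L^2(T^*\mathbb R^n): (hD_{x_j}-\xi_j-ihD_{\xi_j})w=0,\ j=1,\dots,n\},\qquad D=-i\partial,$$ where the equations hold in the sense of distributions. Let $\Pi_0$ be the orthogonal projector of $L^2(T^*\mathbb R^n)$ onto $\mathscr H$. Let $p\in S(1)$, that is, $p\in C^\infty(T^*\mathbb R^n;\mathbb C)$ has all its derivatives, of every order, bounded, and let $P=p(x,hD)$ be the operator $$Pu(x)=\frac1{(2\pi h)^n}\int_{\mathbb R^n}\int_{\mathbb R^n}p(x,\xi)\,e^{\frac ih\langle x-y,\xi\rangle}u(y)\,dy\,d\xi ,$$ defined on Schwartz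 functions $u$; it extends to a bounded operator on $L^2(\mathbb R^n)$. Write $p$ also for multiplication by $p$ on $L^2(T^*\mathbb R^n)$. Then there is a constant $C$, depending only on $n$ and on bounds for the derivatives of $p$ (in particular not on $h$), such that for all $0<h\le1$: 1. $\|TPT^*w-\Pi_0\,p\,\Pi_0 w\|\le C h\|w\|$ for all $w\in\mathscr H$; that is, $TPT^*=\Pi_0\,p\,\Pi_0+\mathcal O(h)_{\mathscr H\to\mathscr H}$. 2. $|\langle TPu,Tv\rangle-\langle pTu,Tv\rangle|\le C h\|u\|\|v\|$ for all $u,v\in L^2(\mathbb R^n)$, with inner products in $L^2(T^*\mathbb R^n)$. 3. $\|TPu-pTu\|_{L^2(T^*\mathbb R^n)}\le C h^{1/2}\|u\|$ for all $u\in L^2(\mathbb R^n)$; that is, $TP=pT+\mathcal O(h^{1/2})_{L^2(\mathbb R^n)\to L^2(T^*\mathbb R^n)}$. -/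

import Mathlib

open MeasureTheory
open scoped ContDiff SchwartzMap ENNReal

noncomputable section

/-- The phase space `T*ℝⁿ = ℝⁿ × ℝⁿ`, with points `α = (x, ξ)` and Lebesgue measure `dx dξ`. -/
abbrev PhaseSpace (n : ℕ) : Type := EuclideanSpace ℝ (Fin n) × EuclideanSpace ℝ (Fin n)

/-- `L²(ℝⁿ)`, complex valued. -/
abbrev L2Config (n : ℕ) : Type :=
  Lp ℂ 2 (volume : Measure (EuclideanSpace ℝ (Fin n)))

/-- `L²(T*ℝⁿ)`, complex valued. -/
abbrev L2Phase (n : ℕ) : Type := Lp ℂ 2 (volume : Measure (PhaseSpace n))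

/-- The constant `c = 2^{-n/2} π^{-3n/4}` that normalises the FBI transform. -/
def fbiConst (n : ℕ) : ℝ := (2 : ℝ) ^ (-((n : ℝ) / 2)) * Real.pi ^ (-(3 * (n : ℝ) / 4))

/-- The FBI transform as a function on phase space:
`Tu(x, ξ) = c h^{-3n/4} ∫ exp((i/h)(⟨x - y, ξ⟩ + (i/2)(x - y)²)) u(y) dy`.
The integral converges absolutely for every `u` in `L²(ℝⁿ)` and `h > 0`. -/
def fbiFun {n : ℕ} (h : ℝ) (u : EuclideanSpace ℝ (Fin n) → ℂ) (α : PhaseSpace n) : ℂ :=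
  ((fbiConst n * h ^ (-(3 * (n : ℝ) / 4)) : ℝ) : ℂ) *
    ∫ y : EuclideanSpace ℝ (Fin n),
      Complex.exp (Complex.I / (h : ℂ) *
        (((inner ℝ (α.1 - y) α.2 : ℝ) : ℂ) +
          Complex.I / 2 * ((‖α.1 - y‖ ^ 2 : ℝ) : ℂ))) * u y

/-- `T` is the FBI transform on `L²`: for every `u`, `T u` is the class of `fbiFun h u`. -/
def IsFBITransform {n : ℕ} (h : ℝ) (T : L2Config n →ₗᵢ[ℂ] L2Phase n) : Prop :=
  ∀ u : L2Config n, ⇑(T u) =ᵐ[volume] fbiFun h ⇑u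

/-- The formal transpose of `Z_j = h D_{x_j} - ξ_j - i h D_{ξ_j}`, where `D = -i ∂`:
`Z_jᵗ φ = - h D_{x_j} φ - ξ_j φ + i h D_{ξ_j} φ = i h ∂_{x_j} φ - ξ_j φ + h ∂_{ξ_j} φ`. -/
def transposeZ {n : ℕ} (h : ℝ) (j : Fin n) (φ : PhaseSpace n → ℂ) (α : PhaseSpace n) : ℂ :=
  Complex.I * (h : ℂ) * fderiv ℝ φ α (EuclideanSpace.single j (1 : ℝ), 0)
    - ((α.2 j : ℝ) : ℂ) * φ α
    + (h : ℂ) * fderiv ℝ φ α (0, EuclideanSpace.single j (1 : ℝ))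

theorem memLp_transposeZ {n : ℕ} (h : ℝ) (j : Fin n) {φ : PhaseSpace n → ℂ}
    (hφ : ContDiff ℝ ∞ φ) (hc : HasCompactSupport φ) :
    MemLp (transposeZ h j φ) 2 (volume : Measure (PhaseSpace n)) := by
  have hd : Continuous (fderiv ℝ φ) := hφ.continuous_fderiv (by simp)
  have hφc : Continuous φ := hφ.continuous
  have hcont : Continuous (transposeZ h j φ) := by
    unfold transposeZ
    fun_prop
  refine hcont.memLp_of_hasCompactSupport ?_
  refine HasCompactSupport.of_support_subset_isCompact hc.isCompact ?_
  intro α hα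
  by_contra hn
  apply hα
  have h1 : φ α = 0 := image_eq_zero_of_notMem_tsupport hn
  have h2 : fderiv ℝ φ α = 0 :=
    image_eq_zero_of_notMem_tsupport (fun hm => hn (tsupport_fderiv_subset ℝ hm))
  simp [transposeZ, h1, h2]

/-- The space `ℋ = {u ∈ L²(T*ℝⁿ) : Z_j u = 0, j = 1, …, n}`, with `Z_j u = 0` in the sense of
distributions. -/
def fbiSpace (n : ℕ) (h : ℝ) : Submodule ℂ (L2Phase n) where
  carrier := {u | ∀ (j : Fin n) (φ : PhaseSpace n → ℂ), ContDiff ℝ ∞ φ → HasCompactSupport φ →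
    ∫ α, u α * transposeZ h j φ α = 0}
  zero_mem' := by
    intro j φ _ _
    rw [integral_congr_ae (g := fun _ => (0 : ℂ))]
    · simp
    · filter_upwards [Lp.coeFn_zero ℂ 2 (volume : Measure (PhaseSpace n))] with α hα
      rw [hα, Pi.zero_apply, zero_mul]
  add_mem' := by
    intro u v hu hv j φ hφ hc
    have hZ := memLp_transposeZ h j hφ hc
    have e : ∫ α, (u + v : L2Phase n) α * transposeZ h j φ α
        = ∫ α, (u α * transposeZ h j φ α + v α * transposeZ h j φ α) := by
      refine integral_congr_ae ?_
      filter_upwards [Lp.coeFn_add u v] with α hα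
      rw [hα, Pi.add_apply, add_mul]
    have iu : Integrable (fun α => u α * transposeZ h j φ α) :=
      (Lp.memLp u).integrable_mul hZ
    have iv : Integrable (fun α => v α * transposeZ h j φ α) :=
      (Lp.memLp v).integrable_mul hZ
    rw [e, integral_add iu iv, hu j φ hφ hc, hv j φ hφ hc, add_zero]
  smul_mem' := by
    intro c u hu j φ hφ hc
    have e : ∫ α, (c • u : L2Phase n) α * transposeZ h j φ α
        = ∫ α, c * (u α * transposeZ h j φ α) := by
      refine integral_congr_ae ?_
      filter_upwards [Lp.coeFn_smul c u] with α hα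
      rw [hα, Pi.smul_apply, smul_eq_mul, mul_assoc]
    rw [e, integral_const_mul, hu j φ hφ hc, mul_zero]

theorem isClosed_fbiSpace (n : ℕ) (h : ℝ) : IsClosed (fbiSpace n h : Set (L2Phase n)) := by
  have e : (fbiSpace n h : Set (L2Phase n)) =
      ⋂ (j : Fin n) (φ : PhaseSpace n → ℂ) (hφ : ContDiff ℝ ∞ φ) (hc : HasCompactSupport φ),
        {u | inner ℂ ((memLp_transposeZ h j hφ hc).star.toLp) u = 0} := by
    ext u
    simp only [Set.mem_iInter, Set.mem_ofPred_eq]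
    refine forall_congr' fun j => forall_congr' fun φ => forall_congr' fun hφ =>
      forall_congr' fun hc => ?_
    have e2 : inner ℂ ((memLp_transposeZ h j hφ hc).star.toLp) u
        = ∫ α, u α * transposeZ h j φ α := by
      rw [L2.inner_def]
      refine integral_congr_ae ?_
      filter_upwards [(memLp_transposeZ h j hφ hc).star.coeFn_toLp] with α hα
      rw [hα]
      simp
    rw [e2]
  rw [e]
  refine isClosed_iInter fun j => isClosed_iInter fun φ => isClosed_iInter fun hφ =>
    isClosed_iInter fun hc => ?_
  exact isClosed_eq (by fun_prop) continuous_const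

instance (n : ℕ) (h : ℝ) : (fbiSpace n h).HasOrthogonalProjection :=
  haveI : CompleteSpace (fbiSpace n h) :=
    completeSpace_coe_iff_isComplete.mpr (isClosed_fbiSpace n h).isComplete
  inferInstance

/-- `Π₀`, the orthogonal projector of `L²(T*ℝⁿ)` onto `ℋ`, as an operator on `L²(T*ℝⁿ)`. -/
def bergmanProj (n : ℕ) (h : ℝ) : L2Phase n →L[ℂ] L2Phase n := (fbiSpace n h).starProjection

/-- `p ∈ S(1)` with given bounds: `p` is smooth on `T*ℝⁿ` and its `k`-th derivative is bounded in
norm by `B k` on all of `T*ℝⁿ`. -/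
structure IsSymbolBoundedBy {n : ℕ} (B : ℕ → ℝ) (p : PhaseSpace n → ℂ) : Prop where
  smooth : ContDiff ℝ ∞ p
  bound : ∀ (k : ℕ) (α : PhaseSpace n), ‖iteratedFDeriv ℝ k p α‖ ≤ B k

theorem IsSymbolBoundedBy.memLp_top {n : ℕ} {B : ℕ → ℝ} {p : PhaseSpace n → ℂ}
    (hp : IsSymbolBoundedBy B p) : MemLp p ∞ (volume : Measure (PhaseSpace n)) :=
  memLp_top_of_bound hp.smooth.continuous.aestronglyMeasurable (B 0)
    (Filter.Eventually.of_forall fun α => by simpa using hp.bound 0 α)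

/-- The operator `M_p` of multiplication by a bounded function `p` on `L²(T*ℝⁿ)`. -/
def mulOp {n : ℕ} (p : PhaseSpace n → ℂ) (hp : MemLp p ∞ (volume : Measure (PhaseSpace n))) :
    L2Phase n →L[ℂ] L2Phase n :=
  (ContinuousLinearMap.mul ℂ ℂ).holderL volume ∞ 2 2 hp.toLp

/-- The standard quantization on functions:
`p(x, hD) u (x) = (2πh)^{-n} ∫ (∫ p(x, ξ) exp((i/h)⟨x - y, ξ⟩) u(y) dy) dξ`. -/
def quantFun {n : ℕ} (p : PhaseSpace n → ℂ) (h : ℝ) (u : EuclideanSpace ℝ (Fin n) → ℂ)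
    (x : EuclideanSpace ℝ (Fin n)) : ℂ :=
  ((((2 * Real.pi * h) ^ n)⁻¹ : ℝ) : ℂ) *
    ∫ ξ : EuclideanSpace ℝ (Fin n), ∫ y : EuclideanSpace ℝ (Fin n),
      p (x, ξ) * Complex.exp (Complex.I / (h : ℂ) * ((inner ℝ (x - y) ξ : ℝ) : ℂ)) * u y

/-- `P = p(x, hD)` on `L²(ℝⁿ)`: the bounded operator that is given by the oscillatory integral on
the (dense) space of Schwartz functions. -/
def IsQuantization {n : ℕ} (p : PhaseSpace n → ℂ) (h : ℝ) (P : L2Config n →L[ℂ] L2Config n) :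
    Prop :=
  ∀ u : 𝓢(EuclideanSpace ℝ (Fin n), ℂ), ⇑(P (u.toLp 2)) =ᵐ[volume] quantFun p h ⇑u

/-- The Toeplitz operator `Π₀ M_p Π₀`. -/
def toeplitz {n : ℕ} (h : ℝ) (p : PhaseSpace n → ℂ)
    (hp : MemLp p ∞ (volume : Measure (PhaseSpace n))) : L2Phase n →L[ℂ] L2Phase n :=
  bergmanProj n h ∘L mulOp p hp ∘L bergmanProj n h

/-- The operator `T P T*` on `L²(T*ℝⁿ)`. -/
def conjByFBI {n : ℕ} (T : L2Config n →ₗᵢ[ℂ] L2Phase n) (P : L2Config n →L[ℂ] L2Config n) :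
    L2Phase n →L[ℂ] L2Phase n :=
  T.toContinuousLinearMap ∘L P ∘L ContinuousLinearMap.adjoint T.toContinuousLinearMap

end

/-! Let e_α be the normalised Gaussian wave packet at α = (x, ξ), so that Tu(α) = ⟨e_α, u⟩. For
fixed x, Tu(x, ·) is up to a phase the Fourier transform of u times a Gaussian window. Plancherel in
ξ, followed by integration in x, gives the isometry, and density extends it to L².

The range lies in ℋ because each conj(e_α(y)), as a function of α, solves the equations Z_j = 0. For
the converse, TT* is the integral operator with kernel ⟨e_α, e_β⟩, a Gaussian times a phase, and the
claim is that TT*w = w on ℋ. Replace the Gaussian rate 1/(4h) of this kernel by a variable rate μ.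
Testing Z_j w = 0 against a linear factor times the Gaussian shows that (μ + 1/(4h))^n times the
Gaussian integral of w is constant in μ (`integral_mem_fbiSpace_mul_quadExp_const`). At μ = 1/(4h)
it is π^n TT*w, and as μ → ∞ it tends weakly to π^n w. Hence TT* is the orthogonal projector Π₀.

The quantization is controlled through its wave packet matrix. Since u = ∫ Tu(β) e_β dβ, the form
⟨v, a(x,hD)u⟩ has kernel ⟨e_α, a(x,hD)e_β⟩ on the FBI side. Integration by parts shows that this
kernel decays like h^{-n}(1 + |α-β|/√h)^{-(2n+1)}, and the Schur test then gives the uniform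
Calderón–Vaillancourt bound `exists_norm_quantForm_le`.

The comparison with Toeplitz operators is exact before it is estimated: ⟨Tv, pTu⟩ is the average
over σ of ⟨v, p(· + √h σ)(x,hD)u⟩ against a complex Gaussian weight of integral one
(`inner_mulOp_eq_integral_quantForm`). This weight is even, so first-order terms cancel and the
difference is half the average of quantized second differences of p with step √h σ. These symbols
and their derivatives are O(h|σ|²), and the Calderón–Vaillancourt bound turns this into O(h) for the
forms.

That form estimate is claim 2. Taking v = Pu - T*pTu in it bounds ‖TPu - Π₀pTu‖ by O(h)‖u‖, which is
claim 1. Claim 3 also needs (1 - Π₀)pΠ₀ = O(√h) (`norm_mulOp_sub_proj_le`): there p(α) - p(β) is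
Lipschitz while the kernel of Π₀ has Gaussian width √h. -/

/-! ### Exponentials with Gaussian decay are Schwartz functions. -/

section SchwartzExp

variable {V : Type*} [NormedAddCommGroup V] [NormedSpace ℝ V]

theorem iteratedDeriv_cexp (n : ℕ) : iteratedDeriv n Complex.exp = Complex.exp := by
  rw [iteratedDeriv_eq_iterate, Complex.iter_deriv_exp]

theorem norm_iteratedFDeriv_cexp_real (n : ℕ) (z : ℂ) :
    ‖iteratedFDeriv ℝ n Complex.exp z‖ ≤ ‖Complex.exp z‖ := by
  have h : iteratedFDeriv ℝ n Complex.exp z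
      = (iteratedFDeriv ℂ n Complex.exp z).restrictScalars ℝ := by
    exact (Complex.contDiff_exp (n := n)).contDiffAt.restrictScalars_iteratedFDeriv.symm
  rw [h, ContinuousMultilinearMap.norm_restrictScalars, norm_iteratedFDeriv_eq_norm_iteratedDeriv,
    iteratedDeriv_cexp]

/-- Derivatives of exp ∘ Q are exp Q times polynomially bounded factors, which the Gaussian decay of
|exp Q| absorbs. This is the source of all Schwartz Gaussians below. -/
theorem exists_schwartzMap_cexp {Q : V → ℂ} (hQ : Q.HasTemperateGrowth) {ε C : ℝ} (hε : 0 < ε)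
    (hre : ∀ x, (Q x).re ≤ C - ε * ‖x‖ ^ 2) :
    ∃ f : 𝓢(V, ℂ), ∀ x, f x = Complex.exp (Q x) := by
  have hsm : ContDiff ℝ ∞ (fun x => Complex.exp (Q x)) := hQ.1.cexp
  refine ⟨⟨fun x => Complex.exp (Q x), hsm, fun k n => ?_⟩, fun x => rfl⟩
  obtain ⟨m, A, hA, hb⟩ := hQ.norm_iteratedFDeriv_le_uniform n
  -- With A' ≥ 1 the bound D = A'(1+‖x‖)^m is at least 1, hence D ≤ D^i, which is the shape that
  -- `norm_iteratedFDeriv_comp_le` asks for.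
  set A' := max A 1
  have key : ∀ x, ‖iteratedFDeriv ℝ n (fun x => Complex.exp (Q x)) x‖
      ≤ n.factorial * ‖Complex.exp (Q x)‖ * (A' * (1 + ‖x‖) ^ m) ^ n := by
    intro x
    have h1 : 1 ≤ (1 + ‖x‖) ^ m := one_le_pow₀ (by linarith [norm_nonneg x])
    refine norm_iteratedFDeriv_comp_le (g := Complex.exp) (f := Q) (N := ∞)
      Complex.contDiff_exp hQ.1 (by exact_mod_cast le_top) x
      (fun i _ => norm_iteratedFDeriv_cexp_real i _) (fun i hi hin => ?_)
    have h2 : 1 ≤ A' * (1 + ‖x‖) ^ m :=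
      one_le_mul_of_one_le_of_one_le (le_max_right _ _) h1
    calc _ ≤ A * (1 + ‖x‖) ^ m := hb i hin x
      _ ≤ A' * (1 + ‖x‖) ^ m := by gcongr; exact le_max_left _ _
      _ ≤ _ := le_self_pow₀ h2 (by omega)
  have hbd : ∃ M : ℝ, ∀ r : ℝ, 0 ≤ r → (1 + r) ^ (k + m * n) * Real.exp (-ε * r ^ 2) ≤ M := by
    have hlim : Filter.Tendsto (fun r : ℝ => (1 + r) ^ (k + m * n) * Real.exp (-ε * (1 + r)))
        Filter.atTop (nhds 0) := by
      have h0 := Real.tendsto_pow_mul_exp_neg_atTop_nhds_zero (k + m * n)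
      have h1 : Filter.Tendsto (fun r : ℝ => ε * (1 + r)) Filter.atTop Filter.atTop :=
        (Filter.tendsto_atTop_add_const_left _ _ Filter.tendsto_id).const_mul_atTop hε
      have h2 := (h0.comp h1).const_mul ((ε ^ (k + m * n))⁻¹)
      rw [mul_zero] at h2
      refine h2.congr fun r => ?_
      simp only [Function.comp, mul_pow]
      have : ε ^ (k + m * n) ≠ 0 := by positivity
      field_simp
    have hlim2 := hlim.mul_const (Real.exp (2 * ε))
    obtain ⟨R, hR⟩ := Filter.eventually_atTop.1 (hlim2.eventually_le_const (show (0:ℝ) * Real.exp (2 * ε) < 1 by simp))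
    obtain ⟨M, hM⟩ := (isCompact_Icc (a := (0:ℝ)) (b := max R 0)).bddAbove_image
      (f := fun r : ℝ => (1 + r) ^ (k + m * n) * Real.exp (-ε * r ^ 2)) (by fun_prop)
    refine ⟨max M 1, fun r hr => ?_⟩
    by_cases hrR : r ≤ max R 0
    · exact (hM ⟨r, ⟨hr, hrR⟩, rfl⟩).trans (le_max_left _ _)
    · push Not at hrR
      refine le_trans ?_ ((hR r ((le_max_left _ _).trans hrR.le)).trans (le_max_right _ _))
      rw [mul_assoc, ← Real.exp_add]
      gcongr
      -- Because r² ≥ r - 1, the Gaussian is at most exp(2ε) exp(-ε(1+r)), whose product with any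
      -- power of 1 + r tends to zero.
      nlinarith [sq_nonneg (r - 1), mul_nonneg hε.le (sq_nonneg (r - 1)), mul_nonneg hε.le hr]
  obtain ⟨M, hM⟩ := hbd
  refine ⟨n.factorial * Real.exp C * A' ^ n * M, fun x => ?_⟩
  have hx := norm_nonneg x
  have hA' : 0 ≤ A' := le_trans zero_le_one (le_max_right _ _)
  calc ‖x‖ ^ k * ‖iteratedFDeriv ℝ n (fun x => Complex.exp (Q x)) x‖
      ≤ (1 + ‖x‖) ^ k * (n.factorial * (Real.exp C * Real.exp (-ε * ‖x‖ ^ 2)) *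
          (A' * (1 + ‖x‖) ^ m) ^ n) := by
        refine mul_le_mul (pow_le_pow_left₀ hx (by linarith) k) ((key x).trans ?_)
          (norm_nonneg _) (by positivity)
        gcongr
        rw [Complex.norm_exp, ← Real.exp_add]
        exact Real.exp_le_exp.2 (by linarith [hre x])
    _ = n.factorial * Real.exp C * A' ^ n *
          ((1 + ‖x‖) ^ (k + m * n) * Real.exp (-ε * ‖x‖ ^ 2)) := by
        rw [mul_pow, ← pow_mul, pow_add]; ring
    _ ≤ _ := by gcongr; exact hM _ hx

end SchwartzExp

instance instIsAddHaarMeasurePhaseSpace (n : ℕ) :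
    (volume : Measure (PhaseSpace n)).IsAddHaarMeasure :=
  inferInstanceAs (Measure.prod volume volume).IsAddHaarMeasure

/-! ### Wave packets and the isometry property on Schwartz functions. -/

section WavePacket

variable {n : ℕ}

/-- The normalising constant `c h^{-3n/4}` of the FBI transform. -/
noncomputable def fbiNorm (n : ℕ) (h : ℝ) : ℝ := fbiConst n * h ^ (-(3 * (n : ℝ) / 4))

theorem fbiNorm_pos (n : ℕ) {h : ℝ} (hh : 0 < h) : 0 < fbiNorm n h := by
  have := Real.pi_pos
  unfold fbiNorm fbiConst
  positivity

/-- The factor (2πh)^n comes from Plancherel in ξ and (πh)^{n/2} from the Gaussian integral in x;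
the normalising constant is the one that makes T an isometry. -/
theorem fbiNorm_sq (n : ℕ) {h : ℝ} (hh : 0 < h) :
    fbiNorm n h ^ 2 * ((2 * Real.pi * h) ^ n * (Real.pi * h) ^ ((n : ℝ) / 2)) = 1 := by
  have hp := Real.pi_pos
  unfold fbiNorm fbiConst
  rw [← Real.rpow_natCast (2 * Real.pi * h) n, Real.mul_rpow (by positivity) hh.le,
    Real.mul_rpow (by norm_num) hp.le, Real.mul_rpow hp.le hh.le, mul_pow, mul_pow,
    ← Real.rpow_mul_natCast (by norm_num), ← Real.rpow_mul_natCast hp.le,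
    ← Real.rpow_mul_natCast hh.le]
  have e : ∀ x : ℝ, 0 < x → ∀ a b c : ℝ, a + b + c = 0 → x ^ a * x ^ b * x ^ c = 1 := by
    intro x hx a b c habc
    rw [← Real.rpow_add hx, ← Real.rpow_add hx, habc, Real.rpow_zero]
  have e2 := e 2 (by norm_num) (-((n : ℝ) / 2) * (2 : ℕ)) n 0 (by push_cast; ring)
  have e3 := e Real.pi hp (-(3 * (n : ℝ) / 4) * (2 : ℕ)) n (n / 2) (by push_cast; ring)
  have e4 := e h hh (-(3 * (n : ℝ) / 4) * (2 : ℕ)) n (n / 2) (by push_cast; ring)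
  rw [Real.rpow_zero, mul_one] at e2
  calc _ = (2 ^ (-((n : ℝ) / 2) * (2 : ℕ)) * 2 ^ (n : ℝ)) *
        (Real.pi ^ (-(3 * (n : ℝ) / 4) * (2 : ℕ)) * Real.pi ^ (n : ℝ) * Real.pi ^ ((n : ℝ) / 2)) *
        (h ^ (-(3 * (n : ℝ) / 4) * (2 : ℕ)) * h ^ (n : ℝ) * h ^ ((n : ℝ) / 2)) := by ring
    _ = 1 := by rw [e2, e3, e4]; norm_num

/-- The Gaussian wave packet centred at the phase space point `α`. -/
noncomputable def wavePacket (h : ℝ) (α : PhaseSpace n) (y : EuclideanSpace ℝ (Fin n)) : ℂ :=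
  (fbiNorm n h : ℂ) * Complex.exp (-(Complex.I / h) * (inner ℝ (α.1 - y) α.2 : ℝ)
        - (‖α.1 - y‖ ^ 2 : ℝ) / (2 * h))

theorem continuous_wavePacket_uncurry (h : ℝ) :
    Continuous fun q : PhaseSpace n × EuclideanSpace ℝ (Fin n) => wavePacket h q.1 q.2 := by
  unfold wavePacket
  fun_prop

theorem norm_wavePacket {h : ℝ} (hh : 0 < h) (α : PhaseSpace n) (y : EuclideanSpace ℝ (Fin n)) :
    ‖wavePacket h α y‖ = fbiNorm n h * Real.exp (-(1 / (2 * h)) * ‖α.1 - y‖ ^ 2) := by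
  rw [wavePacket, norm_mul, Complex.norm_real, Real.norm_of_nonneg (fbiNorm_pos n hh).le,
    Complex.norm_exp]
  congr 2
  rw [show (-(Complex.I / h) * (inner ℝ (α.1 - y) α.2 : ℝ) - (‖α.1 - y‖ ^ 2 : ℝ) / (2 * h) : ℂ)
    = ((-(1 / (2 * h)) * ‖α.1 - y‖ ^ 2 : ℝ) : ℂ)
      + ((-(inner ℝ (α.1 - y) α.2) / h : ℝ) : ℂ) * Complex.I by push_cast; ring]
  simp [-Complex.ofReal_mul, -Complex.ofReal_div, -Complex.ofReal_neg]

theorem fbiFun_eq (h : ℝ) (u : EuclideanSpace ℝ (Fin n) → ℂ) (α : PhaseSpace n) :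
    fbiFun h u α = ∫ y, starRingEnd ℂ (wavePacket h α y) * u y := by
  rw [fbiFun, ← integral_const_mul]
  refine integral_congr_ae (.of_forall fun y => ?_)
  simp only [wavePacket, map_mul, ← Complex.exp_conj, Complex.conj_ofReal, map_sub, map_neg,
    map_div₀, Complex.conj_I, map_ofNat]
  rw [← mul_assoc]
  congr 3
  ring_nf
  rw [Complex.I_sq]
  ring

theorem exists_schwartz_wavePacket {h : ℝ} (hh : 0 < h) (α : PhaseSpace n) :
    ∃ f : 𝓢(EuclideanSpace ℝ (Fin n), ℂ), ∀ y, f y = wavePacket h α y := by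
  obtain ⟨f, hf⟩ := exists_schwartzMap_cexp (V := EuclideanSpace ℝ (Fin n))
    (Q := fun y => -(Complex.I / h) * (inner ℝ (α.1 - y) α.2 : ℝ)
        - ((2 * h)⁻¹ : ℂ) * (‖α.1 - y‖ ^ 2 : ℝ)) (ε := 1 / (4 * h)) (C := ‖α.1‖ ^ 2 / (2 * h))
    (by
      have h1 : (fun y : EuclideanSpace ℝ (Fin n) => α.1 - y).HasTemperateGrowth := by fun_prop
      have h2 := (Function.hasTemperateGrowth_norm_sq (EuclideanSpace ℝ (Fin n))).comp h1
      have h3 := (Function.hasTemperateGrowth_inner_left α.2).comp h1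
      have h4 := Function.Complex.hasTemperateGrowth_ofReal.comp h2
      have h5 := Function.Complex.hasTemperateGrowth_ofReal.comp h3
      simp only [Function.comp_def] at h4 h5
      fun_prop) (by positivity) (by
      intro y
      have e : (-(Complex.I / h) * (inner ℝ (α.1 - y) α.2 : ℝ)
        - ((2 * h)⁻¹ : ℂ) * (‖α.1 - y‖ ^ 2 : ℝ)).re = -((2 * h)⁻¹ * ‖α.1 - y‖ ^ 2) := by
        rw [Complex.sub_re, show (((2 * h)⁻¹ : ℂ) * (‖α.1 - y‖ ^ 2 : ℝ)) =
          (((2 * h)⁻¹ * ‖α.1 - y‖ ^ 2 : ℝ) : ℂ) by push_cast; ring, Complex.ofReal_re,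
          show (-(Complex.I / h) * (inner ℝ (α.1 - y) α.2 : ℝ) : ℂ)
          = ((-(inner ℝ (α.1 - y) α.2) / h : ℝ) : ℂ) * Complex.I by push_cast; ring]
        simp
      rw [e]
      have h6 : ‖y‖ ^ 2 ≤ 2 * ‖α.1 - y‖ ^ 2 + 2 * ‖α.1‖ ^ 2 := by
        have : ‖y‖ ≤ ‖α.1‖ + ‖α.1 - y‖ := by
          calc ‖y‖ = ‖α.1 - (α.1 - y)‖ := by congr 1; abel
            _ ≤ _ := norm_sub_le _ _
        nlinarith [norm_nonneg y, sq_nonneg (‖α.1 - y‖ - ‖α.1‖)]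
      rw [← sub_nonneg]
      have : ‖α.1‖ ^ 2 / (2 * h) - 1 / (4 * h) * ‖y‖ ^ 2 - -((2 * h)⁻¹ * ‖α.1 - y‖ ^ 2)
        = (2 * ‖α.1 - y‖ ^ 2 + 2 * ‖α.1‖ ^ 2 - ‖y‖ ^ 2) / (4 * h) := by field_simp; ring
      rw [this]
      exact div_nonneg (by linarith) (by positivity))
  refine ⟨(fbiNorm n h : ℂ) • f, fun y => ?_⟩
  rw [smul_apply, hf, smul_eq_mul, wavePacket]
  congr 2
  ring

theorem exists_schwartz_gaussian {h : ℝ} (hh : 0 < h) (x : EuclideanSpace ℝ (Fin n)) :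
    ∃ f : 𝓢(EuclideanSpace ℝ (Fin n), ℂ), ∀ y,
      f y = (Real.exp (-(1 / (2 * h)) * ‖x - y‖ ^ 2) : ℂ) := by
  obtain ⟨f, hf⟩ := exists_schwartz_wavePacket hh ((x, 0) : PhaseSpace n)
  refine ⟨((fbiNorm n h)⁻¹ : ℂ) • f, fun y => ?_⟩
  have := (fbiNorm_pos n hh).ne'
  rw [smul_apply, hf, smul_eq_mul, wavePacket, inv_mul_cancel_left₀ (by exact_mod_cast this)]
  push_cast
  congr 1
  simp
  ring

/-- The function `u` multiplied by a Gaussian window centred at `x`. -/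
noncomputable def windowed (h : ℝ) (u : 𝓢(EuclideanSpace ℝ (Fin n), ℂ))
    (x : EuclideanSpace ℝ (Fin n)) : 𝓢(EuclideanSpace ℝ (Fin n), ℂ) :=
  SchwartzMap.smulLeftCLM ℂ
    (fun y => (Real.exp (-(1 / (2 * h)) * ‖x - y‖ ^ 2) : ℂ)) u

theorem windowed_apply {h : ℝ} (hh : 0 < h) (u : 𝓢(EuclideanSpace ℝ (Fin n), ℂ))
    (x y : EuclideanSpace ℝ (Fin n)) :
    windowed h u x y = (Real.exp (-(1 / (2 * h)) * ‖x - y‖ ^ 2) : ℂ) * u y := by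
  obtain ⟨f, hf⟩ := exists_schwartz_gaussian hh x
  have hg : (fun y => (Real.exp (-(1 / (2 * h)) * ‖x - y‖ ^ 2) : ℂ)).HasTemperateGrowth := by
    simpa [funext hf] using f.hasTemperateGrowth
  rw [windowed, SchwartzMap.smulLeftCLM_apply_apply hg, smul_eq_mul]

/-- For fixed x the phase factors as exp(i⟨x,ξ⟩/h) exp(-i⟨y,ξ⟩/h), so the dependence on ξ is a
rescaled Fourier transform. Plancherel becomes available one x at a time. -/
theorem fbiFun_eq_fourier {h : ℝ} (hh : 0 < h) (u : 𝓢(EuclideanSpace ℝ (Fin n), ℂ))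
    (x ξ : EuclideanSpace ℝ (Fin n)) :
    fbiFun h u (x, ξ) = (fbiNorm n h : ℂ) * Complex.exp (Complex.I / h * (inner ℝ x ξ : ℝ)) *
      FourierTransform.fourier (windowed h u x) ((2 * Real.pi * h)⁻¹ • ξ) := by
  rw [SchwartzMap.fourier_coe, Real.fourier_eq', fbiFun_eq, ← integral_const_mul]
  refine integral_congr_ae (.of_forall fun y => ?_)
  simp only [wavePacket, map_mul, ← Complex.exp_conj, Complex.conj_ofReal, map_sub, map_neg,
    map_div₀, Complex.conj_I, map_ofNat, windowed_apply hh, smul_eq_mul, Complex.ofReal_exp]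
  have e : Complex.exp (-(-Complex.I / h) * (inner ℝ (x - y) ξ : ℝ) - (‖x - y‖ ^ 2 : ℝ) / (2 * h))
      = Complex.exp (Complex.I / h * (inner ℝ x ξ : ℝ)) *
        Complex.exp ((-2 * Real.pi * inner ℝ y ((2 * Real.pi * h)⁻¹ • ξ) : ℝ) * Complex.I) *
        Complex.exp ((-(1 / (2 * h)) * ‖x - y‖ ^ 2 : ℝ)) := by
    rw [← Complex.exp_add, ← Complex.exp_add, inner_sub_left, real_inner_smul_right]
    congr 1
    push_cast
    have := Real.pi_ne_zero
    have : (h : ℂ) ≠ 0 := by exact_mod_cast hh.ne'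
    field_simp
    ring
  rw [e]
  ring

theorem norm_fbiFun_eq {h : ℝ} (hh : 0 < h) (u : 𝓢(EuclideanSpace ℝ (Fin n), ℂ))
    (x ξ : EuclideanSpace ℝ (Fin n)) :
    ‖fbiFun h u (x, ξ)‖ = fbiNorm n h *
      ‖FourierTransform.fourier (windowed h u x) ((2 * Real.pi * h)⁻¹ • ξ)‖ := by
  rw [fbiFun_eq_fourier hh, norm_mul, norm_mul, Complex.norm_real,
    Real.norm_of_nonneg (fbiNorm_pos n hh).le,
    show Complex.I / h * (inner ℝ x ξ : ℝ) = ((inner ℝ x ξ / h : ℝ) : ℂ) * Complex.I by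
      push_cast; ring, Complex.norm_exp_ofReal_mul_I, mul_one]

theorem aestronglyMeasurable_fbiFun (h : ℝ) {u : EuclideanSpace ℝ (Fin n) → ℂ}
    (hu : AEStronglyMeasurable u volume) : AEStronglyMeasurable (fbiFun h u) volume := by
  rw [funext (fbiFun_eq h u)]
  refine AEStronglyMeasurable.integral_prod_right' (f := fun q : PhaseSpace n × _ =>
    starRingEnd ℂ (wavePacket h q.1 q.2) * u q.2) ?_
  refine AEStronglyMeasurable.mul ?_ hu.comp_snd
  exact (Complex.continuous_conj.comp (continuous_wavePacket_uncurry h)).aestronglyMeasurable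

theorem integral_comp_inv_planck_smul {h : ℝ} (hh : 0 < h) {F : Type*} [NormedAddCommGroup F]
    [NormedSpace ℝ F] (f : EuclideanSpace ℝ (Fin n) → F) :
    ∫ ξ, f ((2 * Real.pi * h)⁻¹ • ξ) = (2 * Real.pi * h) ^ n • ∫ ξ, f ξ := by
  have := Real.pi_pos
  rw [Measure.integral_comp_smul, finrank_euclideanSpace_fin, inv_pow, inv_inv,
    abs_of_pos (by positivity)]

theorem integral_norm_sq_fbiFun_right {h : ℝ} (hh : 0 < h)
    (u : 𝓢(EuclideanSpace ℝ (Fin n), ℂ)) (x : EuclideanSpace ℝ (Fin n)) :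
    ∫ ξ, ‖fbiFun h u (x, ξ)‖ ^ 2 = fbiNorm n h ^ 2 * (2 * Real.pi * h) ^ n *
      ∫ y, ‖u y‖ ^ 2 * Real.exp (-(1 / h) * ‖x - y‖ ^ 2) := by
  simp only [norm_fbiFun_eq hh, mul_pow (fbiNorm n h)]
  rw [integral_const_mul, integral_comp_inv_planck_smul hh
    (fun η => ‖FourierTransform.fourier (windowed h u x) η‖ ^ 2),
    SchwartzMap.integral_norm_sq_fourier (windowed h u x), smul_eq_mul,
    mul_assoc (fbiNorm n h ^ 2)]
  congr 2
  refine integral_congr_ae (.of_forall fun y => ?_)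
  simp only [windowed_apply hh, norm_mul, Complex.norm_real, Real.norm_eq_abs, Real.abs_exp,
    mul_pow, ← Real.exp_nat_mul]
  rw [mul_comm]
  congr 2
  push_cast
  field_simp

theorem integrable_exp_neg_mul_sq_norm {b : ℝ} (hb : 0 < b) :
    Integrable fun y : EuclideanSpace ℝ (Fin n) => Real.exp (-b * ‖y‖ ^ 2) := by
  obtain ⟨f, hf⟩ := exists_schwartz_gaussian (n := n) (h := 1 / (2 * b)) (by positivity) 0
  refine f.integrable.norm.congr (.of_forall fun y => ?_)
  simp only [hf, zero_sub, norm_neg, Complex.norm_real, Real.norm_eq_abs, Real.abs_exp]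
  congr 2
  field_simp

/-- After Plancherel in ξ there remains the convolution of |u|² with a Gaussian in x, whose integral
is the product of the two integrals; `fbiNorm_sq` cancels the constants. -/
theorem integrable_norm_sq_fbiFun {h : ℝ} (hh : 0 < h) (u : 𝓢(EuclideanSpace ℝ (Fin n), ℂ)) :
    Integrable (fun α : PhaseSpace n => ‖fbiFun h u α‖ ^ 2) ∧
      ∫ α : PhaseSpace n, ‖fbiFun h u α‖ ^ 2 = ∫ y, ‖u y‖ ^ 2 := by
  have hu2 : Integrable (fun y => ‖u y‖ ^ 2) :=
    (memLp_two_iff_integrable_sq_norm u.continuous.aestronglyMeasurable).1 (u.memLp 2)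
  have hg := integrable_exp_neg_mul_sq_norm (n := n) (b := 1 / h) (by positivity)
  have hmeas : AEStronglyMeasurable (fun α : PhaseSpace n => ‖fbiFun h u α‖ ^ 2) volume :=
    (aestronglyMeasurable_fbiFun h u.continuous.aestronglyMeasurable).norm.pow 2
  have hconv : Integrable (fun x => ∫ y, ‖u y‖ ^ 2 * Real.exp (-(1 / h) * ‖x - y‖ ^ 2)) :=
    (hu2.convolution_integrand (ContinuousLinearMap.mul ℝ ℝ) hg).integral_prod_left
  have hint : Integrable (fun α : PhaseSpace n => ‖fbiFun h u α‖ ^ 2) := by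
    rw [Measure.volume_eq_prod] at hmeas ⊢
    refine (integrable_prod_iff hmeas).2 ⟨.of_forall fun x => ?_, ?_⟩
    · have h1 : Integrable (fun ξ => ‖FourierTransform.fourier (windowed h u x) ξ‖ ^ 2) :=
        (memLp_two_iff_integrable_sq_norm
          (FourierTransform.fourier (windowed h u x)).continuous.aestronglyMeasurable).1
          ((FourierTransform.fourier (windowed h u x)).memLp 2)
      have := Real.pi_pos
      simp only [norm_fbiFun_eq hh, mul_pow]
      exact (h1.comp_smul (R := (2 * Real.pi * h)⁻¹) (by positivity)).const_mul _
    · simp only [norm_pow, norm_norm, integral_norm_sq_fbiFun_right hh]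
      exact hconv.const_mul _
  refine ⟨hint, ?_⟩
  rw [Measure.volume_eq_prod, integral_prod _ (by rwa [← Measure.volume_eq_prod])]
  simp only [integral_norm_sq_fbiFun_right hh]
  rw [integral_const_mul]
  have h2 := integral_convolution (ContinuousLinearMap.mul ℝ ℝ) hu2 hg
  simp only [convolution, ContinuousLinearMap.mul_apply'] at h2
  rw [h2, GaussianFourier.integral_rexp_neg_mul_sq_norm (by positivity),
    finrank_euclideanSpace_fin, div_div_eq_mul_div, div_one, mul_left_comm, mul_assoc,
    fbiNorm_sq n hh, mul_one]

theorem memLp_fbiFun {h : ℝ} (hh : 0 < h) (u : 𝓢(EuclideanSpace ℝ (Fin n), ℂ)) :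
    MemLp (fbiFun h u) 2 (volume : Measure (PhaseSpace n)) :=
  (memLp_two_iff_integrable_sq_norm
    (aestronglyMeasurable_fbiFun h u.continuous.aestronglyMeasurable)).2
    (integrable_norm_sq_fbiFun hh u).1

end WavePacket

/-! ### Extension of the FBI transform to L². -/

section FBITransform

variable {n : ℕ}

/-- The Gaussian wave packet as a Schwartz function. -/
noncomputable def wavePacketS {h : ℝ} (hh : 0 < h) (α : PhaseSpace n) :
    𝓢(EuclideanSpace ℝ (Fin n), ℂ) := (exists_schwartz_wavePacket hh α).choose

@[simp]
theorem wavePacketS_apply {h : ℝ} (hh : 0 < h) (α : PhaseSpace n)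
    (y : EuclideanSpace ℝ (Fin n)) : wavePacketS hh α y = wavePacket h α y :=
  (exists_schwartz_wavePacket hh α).choose_spec y

theorem fbiFun_eq_inner {h : ℝ} (hh : 0 < h) (u : L2Config n) (α : PhaseSpace n) :
    fbiFun h u α = inner ℂ ((wavePacketS hh α).toLp 2) u := by
  rw [fbiFun_eq, L2.inner_def]
  refine integral_congr_ae ?_
  filter_upwards [(wavePacketS hh α).coeFn_toLp 2 volume] with y hy
  rw [hy, wavePacketS_apply, RCLike.inner_apply, mul_comm]

theorem fbiFun_congr_ae (h : ℝ) {u v : EuclideanSpace ℝ (Fin n) → ℂ} (huv : u =ᵐ[volume] v) :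
    fbiFun h u = fbiFun h v := by
  funext α
  rw [fbiFun_eq, fbiFun_eq]
  refine integral_congr_ae ?_
  filter_upwards [huv] with y hy
  rw [hy]

theorem fbiFun_add {h : ℝ} (hh : 0 < h) (u v : 𝓢(EuclideanSpace ℝ (Fin n), ℂ)) :
    fbiFun h (u + v : 𝓢(EuclideanSpace ℝ (Fin n), ℂ)) = fbiFun h u + fbiFun h v := by
  funext α
  have key : ∀ w : 𝓢(EuclideanSpace ℝ (Fin n), ℂ), fbiFun h w α =
      inner ℂ ((wavePacketS hh α).toLp 2) (w.toLp 2) := fun w => by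
    rw [← fbiFun_eq_inner, fbiFun_congr_ae h (w.coeFn_toLp 2 volume)]
  rw [Pi.add_apply, key, key, key, ← inner_add_right]
  rfl

theorem fbiFun_smul (h : ℝ) (c : ℂ) (u : EuclideanSpace ℝ (Fin n) → ℂ) :
    fbiFun h (c • u) = c • fbiFun h u := by
  funext α
  rw [Pi.smul_apply, fbiFun_eq, fbiFun_eq, smul_eq_mul, ← integral_const_mul]
  simp only [Pi.smul_apply, smul_eq_mul]
  congr 1
  funext y
  ring

/-- The FBI transform on Schwartz functions, with values in `L²(T*ℝⁿ)`. -/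
noncomputable def fbiSchwartz {h : ℝ} (hh : 0 < h) :
    𝓢(EuclideanSpace ℝ (Fin n), ℂ) →ₗ[ℂ] L2Phase n where
  toFun u := (memLp_fbiFun hh u).toLp
  map_add' u v := by
    rw [← MemLp.toLp_add]
    congr 1
    exact fbiFun_add hh u v
  map_smul' c u := by
    rw [RingHom.id_apply, ← MemLp.toLp_const_smul]
    congr 1
    exact fbiFun_smul h c u

theorem norm_sq_Lp_two {X : Type*} [MeasurableSpace X] {μ : Measure X} (f : Lp ℂ 2 μ) :
    ‖f‖ ^ 2 = ∫ x, ‖f x‖ ^ 2 ∂μ := by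
  have h1 : ((‖f‖ ^ 2 : ℝ) : ℂ) = ∫ x, ((‖f x‖ ^ 2 : ℝ) : ℂ) ∂μ := by
    have := inner_self_eq_norm_sq_to_K (𝕜 := ℂ) f
    rw [L2.inner_def] at this
    push_cast
    rw [← Complex.coe_algebraMap, ← this]
    refine integral_congr_ae (.of_forall fun x => ?_)
    simp only [inner_self_eq_norm_sq_to_K]
  rw [integral_complex_ofReal] at h1
  exact_mod_cast h1

theorem norm_fbiSchwartz {h : ℝ} (hh : 0 < h) (u : 𝓢(EuclideanSpace ℝ (Fin n), ℂ)) :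
    ‖fbiSchwartz hh u‖ = ‖u.toLp 2‖ := by
  have h1 : ‖fbiSchwartz hh u‖ ^ 2 = ‖u.toLp 2‖ ^ 2 := by
    rw [norm_sq_Lp_two, norm_sq_Lp_two]
    have e1 : ∫ α, ‖fbiSchwartz hh u α‖ ^ 2 = ∫ α, ‖fbiFun h u α‖ ^ 2 := by
      refine integral_congr_ae ?_
      filter_upwards [(memLp_fbiFun hh u).coeFn_toLp] with α hα
      change ‖((memLp_fbiFun hh u).toLp (fbiFun h u) : L2Phase n) α‖ ^ 2 = _
      rw [hα]
    have e2 : ∫ y, ‖u.toLp 2 volume y‖ ^ 2 = ∫ y, ‖u y‖ ^ 2 := by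
      refine integral_congr_ae ?_
      filter_upwards [u.coeFn_toLp 2 volume] with y hy
      rw [hy]
    rw [e1, e2, (integrable_norm_sq_fbiFun hh u).2]
  exact (sq_eq_sq₀ (norm_nonneg _) (norm_nonneg _)).1 h1

/-- The FBI transform as an isometry of `L²(ℝⁿ)` into `L²(T*ℝⁿ)`. -/
noncomputable def fbiTransform {h : ℝ} (hh : 0 < h) : L2Config n →ₗᵢ[ℂ] L2Phase n where
  toLinearMap := ((fbiSchwartz hh).extendOfNorm
    (SchwartzMap.toLpCLM ℂ ℂ 2 (volume : Measure (EuclideanSpace ℝ (Fin n)))).toLinearMap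
      ).toLinearMap
  norm_map' := by
    have hd := SchwartzMap.denseRange_toLpCLM (E := EuclideanSpace ℝ (Fin n)) (F := ℂ) (p := 2)
      (μ := volume) ENNReal.ofNat_ne_top
    intro u
    refine hd.induction_on u (isClosed_eq ?_ continuous_norm) fun v => ?_
    · exact (ContinuousLinearMap.continuous _).norm
    · refine Eq.trans (congrArg norm (LinearMap.extendOfNorm_eq (e := (SchwartzMap.toLpCLM ℂ ℂ 2
        (volume : Measure (EuclideanSpace ℝ (Fin n)))).toLinearMap) hd
        ⟨1, fun w => by rw [one_mul]; exact (norm_fbiSchwartz hh w).le⟩ v)) ?_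
      exact norm_fbiSchwartz hh v

theorem fbiTransform_toLp {h : ℝ} (hh : 0 < h) (u : 𝓢(EuclideanSpace ℝ (Fin n), ℂ)) :
    fbiTransform hh (u.toLp 2) = fbiSchwartz hh u :=
  LinearMap.extendOfNorm_eq (e := (SchwartzMap.toLpCLM ℂ ℂ 2
        (volume : Measure (EuclideanSpace ℝ (Fin n)))).toLinearMap)
        (SchwartzMap.denseRange_toLpCLM ENNReal.ofNat_ne_top)
        ⟨1, fun w => by rw [one_mul]; exact (norm_fbiSchwartz hh w).le⟩ u

theorem fbiTransform_toLp_ae {h : ℝ} (hh : 0 < h) (u : 𝓢(EuclideanSpace ℝ (Fin n), ℂ)) :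
    fbiTransform hh (u.toLp 2) =ᵐ[volume] fbiFun h u := by
  rw [fbiTransform_toLp]
  exact (memLp_fbiFun hh u).coeFn_toLp

/-- Both sides are limits along a Schwartz sequence: u ↦ Tu(α) is L²-continuous at each α, being an
inner product with a wave packet, while L² convergence of the images gives almost everywhere
convergence of a subsequence. -/
theorem isFBITransform_fbiTransform {h : ℝ} (hh : 0 < h) :
    IsFBITransform h (fbiTransform (n := n) hh) := by
  intro u
  have hd := SchwartzMap.denseRange_toLpCLM (E := EuclideanSpace ℝ (Fin n)) (F := ℂ) (p := 2)
      (μ := volume) ENNReal.ofNat_ne_top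
  obtain ⟨a, ha, hau⟩ := mem_closure_iff_seq_limit.1 (hd u)
  choose b hb using ha
  obtain ⟨ns, hns, hae⟩ := (tendstoInMeasure_of_tendsto_Lp
    (((fbiTransform hh).continuous.tendsto u).comp hau)).exists_seq_tendsto_ae
  have hall : ∀ᵐ α : PhaseSpace n, ∀ k, fbiTransform hh (a k) α = fbiFun h (b k) α := by
    rw [ae_all_iff]
    intro k
    rw [← hb k]
    exact fbiTransform_toLp_ae hh (b k)
  filter_upwards [hae, hall] with α h1 h2
  refine tendsto_nhds_unique h1 ?_
  have h3 : Filter.Tendsto (fun k => fbiFun h (a k) α) Filter.atTop (nhds (fbiFun h u α)) := by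
    simp only [fbiFun_eq_inner hh]
    exact ((innerSL ℂ ((wavePacketS hh α).toLp 2)).continuous.tendsto u).comp hau
  refine (h3.comp hns.tendsto_atTop).congr fun k => ?_
  simp only [Function.comp]
  rw [h2, ← hb (ns k)]
  exact congrFun (fbiFun_congr_ae h ((b (ns k)).coeFn_toLp 2 volume)) α

end FBITransform

/-! ### The range of T lies in ℋ. -/

section RangeSubset

variable {n : ℕ}

/-- The exponential of a quadratic form in the difference of two phase space points. -/
noncomputable def quadExp (a b c : ℂ) (α β : PhaseSpace n) : ℂ :=
  Complex.exp (a * (inner ℝ (α.1 - β.1) (α.2 + β.2) : ℝ) - b * (‖α.1 - β.1‖ ^ 2 : ℝ)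
    - c * (‖α.2 - β.2‖ ^ 2 : ℝ))

theorem contDiff_quadExp (a b c : ℂ) (α : PhaseSpace n) : ContDiff ℝ ∞ (quadExp a b c α) := by
  have h1 : ContDiff ℝ ∞ fun β : PhaseSpace n => inner ℝ (α.1 - β.1) (α.2 + β.2) :=
    (contDiff_const.sub contDiff_fst).inner ℝ (contDiff_const.add contDiff_snd)
  have h2 : ContDiff ℝ ∞ fun β : PhaseSpace n => ‖α.1 - β.1‖ ^ 2 :=
    (contDiff_const.sub contDiff_fst).norm_sq ℝ
  have h3 : ContDiff ℝ ∞ fun β : PhaseSpace n => ‖α.2 - β.2‖ ^ 2 :=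
    (contDiff_const.sub contDiff_snd).norm_sq ℝ
  have h1' := Complex.ofRealCLM.contDiff.comp h1
  have h2' := Complex.ofRealCLM.contDiff.comp h2
  have h3' := Complex.ofRealCLM.contDiff.comp h3
  exact (((contDiff_const (c := a)).mul h1').sub ((contDiff_const (c := b)).mul h2')
    |>.sub ((contDiff_const (c := c)).mul h3')).cexp

theorem fderiv_quadExp_apply (a b c : ℂ) (α β v : PhaseSpace n) :
    fderiv ℝ (quadExp a b c α) β v =
      (a * ((inner ℝ (α.1 - β.1) v.2 - inner ℝ v.1 (α.2 + β.2) : ℝ) : ℂ)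
        + 2 * b * (inner ℝ (α.1 - β.1) v.1 : ℝ) + 2 * c * (inner ℝ (α.2 - β.2) v.2 : ℝ))
        * quadExp a b c α β := by
  have d1 : HasFDerivAt (fun β : PhaseSpace n => α.1 - β.1)
      (-(ContinuousLinearMap.fst ℝ _ _)) β := (hasFDerivAt_fst (𝕜 := ℝ) (p := β)).const_sub α.1
  have d2 : HasFDerivAt (fun β : PhaseSpace n => α.2 + β.2)
      (ContinuousLinearMap.snd ℝ _ _) β := (hasFDerivAt_snd (𝕜 := ℝ) (p := β)).const_add α.2
  have d3 : HasFDerivAt (fun β : PhaseSpace n => α.2 - β.2)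
      (-(ContinuousLinearMap.snd ℝ _ _)) β := (hasFDerivAt_snd (𝕜 := ℝ) (p := β)).const_sub α.2
  have e1 := Complex.ofRealCLM.hasFDerivAt.comp β (d1.inner ℝ d2)
  have e2 := Complex.ofRealCLM.hasFDerivAt.comp β d1.norm_sq
  have e3 := Complex.ofRealCLM.hasFDerivAt.comp β d3.norm_sq
  have := (((e1.const_mul a).sub (e2.const_mul b)).sub (e3.const_mul c)).cexp
  have h : HasFDerivAt (quadExp a b c α) _ β := this
  rw [h.fderiv]
  simp [quadExp, inner_sub_left, inner_add_right]
  ring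

theorem fderiv_quadExp_fst (a b c : ℂ) (α β : PhaseSpace n) (j : Fin n) :
    fderiv ℝ (quadExp a b c α) β (EuclideanSpace.single j (1 : ℝ), 0) =
      (-a * (α.2 j + β.2 j : ℝ) + 2 * b * (α.1 j - β.1 j : ℝ)) * quadExp a b c α β := by
  rw [fderiv_quadExp_apply]
  congr 1
  simp [EuclideanSpace.inner_single_left, EuclideanSpace.inner_single_right]
  ring

theorem fderiv_quadExp_snd (a b c : ℂ) (α β : PhaseSpace n) (j : Fin n) :
    fderiv ℝ (quadExp a b c α) β (0, EuclideanSpace.single j (1 : ℝ)) =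
      (a * (α.1 j - β.1 j : ℝ) + 2 * c * (α.2 j - β.2 j : ℝ)) * quadExp a b c α β := by
  rw [fderiv_quadExp_apply]
  simp [EuclideanSpace.inner_single_right]

/-- The family `quadExp` covers the wave packets (centre (y, 0), c = 0) as well as the projector
kernel, so its derivatives are computed only once. -/
theorem conj_wavePacket (h : ℝ) (α : PhaseSpace n) (y : EuclideanSpace ℝ (Fin n)) :
    starRingEnd ℂ (wavePacket h α y) =
      fbiNorm n h * quadExp (-Complex.I / h) (1 / (2 * h)) 0 ((y, 0) : PhaseSpace n) α := by
  simp only [wavePacket, quadExp, map_mul, ← Complex.exp_conj, Complex.conj_ofReal, map_sub,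
    map_neg, map_div₀, Complex.conj_I, map_ofNat, zero_add, norm_sub_rev y α.1]
  rw [show y - α.1 = -(α.1 - y) by abel, inner_neg_left]
  congr 2
  push_cast
  ring

theorem continuous_fderiv_apply_const {f : PhaseSpace n → ℂ} (hf : ContDiff ℝ ∞ f)
    (v : PhaseSpace n) : Continuous fun β => fderiv ℝ f β v :=
  (hf.continuous_fderiv (by simp)).clm_apply continuous_const

theorem hasCompactSupport_fderiv_apply {f : PhaseSpace n → ℂ} (hf : HasCompactSupport f)
    (v : PhaseSpace n) : HasCompactSupport fun β => fderiv ℝ f β v :=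
  (hf.fderiv (𝕜 := ℝ)).comp_left (g := fun L : PhaseSpace n →L[ℝ] ℂ => L v) (by simp)

theorem integral_mul_fderiv_of_hasCompactSupport {f φ : PhaseSpace n → ℂ} (hf : ContDiff ℝ ∞ f)
    (hφ : ContDiff ℝ ∞ φ) (hc : HasCompactSupport φ) (v : PhaseSpace n) :
    ∫ β, f β * fderiv ℝ φ β v = -∫ β, fderiv ℝ f β v * φ β := by
  refine integral_mul_fderiv_eq_neg_fderiv_mul_of_integrable ?_ ?_ ?_ ?_ ?_
  · exact ((continuous_fderiv_apply_const hf v).mul hφ.continuous).integrable_of_hasCompactSupport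
      hc.mul_left
  · exact (hf.continuous.mul (continuous_fderiv_apply_const hφ v)).integrable_of_hasCompactSupport
      (hasCompactSupport_fderiv_apply hc v).mul_left
  · exact (hf.continuous.mul hφ.continuous).integrable_of_hasCompactSupport hc.mul_left
  · exact fun x _ => hf.contDiffAt.differentiableAt (by simp)
  · exact fun x _ => hφ.contDiffAt.differentiableAt (by simp)

theorem continuous_transposeZ (h : ℝ) (j : Fin n) {φ : PhaseSpace n → ℂ}
    (hφ : ContDiff ℝ ∞ φ) : Continuous (transposeZ h j φ) := by
  have hd : Continuous (fderiv ℝ φ) := hφ.continuous_fderiv (by simp)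
  have hφc : Continuous φ := hφ.continuous
  unfold transposeZ
  fun_prop

/-- Integration by parts moves the operator from φ onto f; the hypothesis `hZ` is -Z_j f = 0. -/
theorem integral_mul_transposeZ {h : ℝ} {j : Fin n} {f φ : PhaseSpace n → ℂ}
    (hf : ContDiff ℝ ∞ f) (hφ : ContDiff ℝ ∞ φ) (hc : HasCompactSupport φ)
    (hZ : ∀ α, Complex.I * h * fderiv ℝ f α (EuclideanSpace.single j (1 : ℝ), 0)
      + (α.2 j : ℝ) * f α + h * fderiv ℝ f α (0, EuclideanSpace.single j (1 : ℝ)) = 0) :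
    ∫ α, f α * transposeZ h j φ α = 0 := by
  have hcont : Continuous fun α : PhaseSpace n => ((α.2 j : ℝ) : ℂ) := by fun_prop
  set v : PhaseSpace n := (EuclideanSpace.single j (1 : ℝ), 0)
  set w : PhaseSpace n := (0, EuclideanSpace.single j (1 : ℝ))
  have i1 : Integrable fun α => f α * fderiv ℝ φ α v :=
    (hf.continuous.mul (continuous_fderiv_apply_const hφ v)).integrable_of_hasCompactSupport
      (hasCompactSupport_fderiv_apply hc v).mul_left
  have i2 : Integrable fun α => f α * fderiv ℝ φ α w :=
    (hf.continuous.mul (continuous_fderiv_apply_const hφ w)).integrable_of_hasCompactSupport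
      (hasCompactSupport_fderiv_apply hc w).mul_left
  have i3 : Integrable fun α => ((α.2 j : ℝ) : ℂ) * f α * φ α :=
    ((hcont.mul hf.continuous).mul hφ.continuous).integrable_of_hasCompactSupport hc.mul_left
  have i4 : Integrable fun α => fderiv ℝ f α v * φ α :=
    ((continuous_fderiv_apply_const hf v).mul hφ.continuous).integrable_of_hasCompactSupport
      hc.mul_left
  have i5 : Integrable fun α => fderiv ℝ f α w * φ α :=
    ((continuous_fderiv_apply_const hf w).mul hφ.continuous).integrable_of_hasCompactSupport
      hc.mul_left
  have e1 : ∫ α, f α * transposeZ h j φ α = Complex.I * h * (∫ α, f α * fderiv ℝ φ α v)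
      - (∫ α, ((α.2 j : ℝ) : ℂ) * f α * φ α) + h * ∫ α, f α * fderiv ℝ φ α w := by
    have i6 : Integrable fun α => Complex.I * h * (f α * fderiv ℝ φ α v)
        - ((α.2 j : ℝ) : ℂ) * f α * φ α := (i1.const_mul _).sub i3
    rw [← integral_const_mul, ← integral_const_mul, ← integral_sub (i1.const_mul _) i3,
      ← integral_add i6 (i2.const_mul _)]
    refine integral_congr_ae (.of_forall fun α => ?_)
    simp only [transposeZ]
    ring
  rw [e1, integral_mul_fderiv_of_hasCompactSupport hf hφ hc,
    integral_mul_fderiv_of_hasCompactSupport hf hφ hc]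
  have e2 : ∫ α, (Complex.I * h * (fderiv ℝ f α v * φ α) + ((α.2 j : ℝ) : ℂ) * f α * φ α
      + h * (fderiv ℝ f α w * φ α)) = 0 := by
    rw [← integral_zero (PhaseSpace n) ℂ]
    refine integral_congr_ae (.of_forall fun α => ?_)
    have := hZ α
    simp only
    linear_combination φ α * this
  have i6 : Integrable fun α => Complex.I * h * (fderiv ℝ f α v * φ α)
      + ((α.2 j : ℝ) : ℂ) * f α * φ α := (i4.const_mul _).add i3
  rw [integral_add i6 (i5.const_mul _), integral_add (i4.const_mul _) i3,
    integral_const_mul, integral_const_mul] at e2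
  linear_combination -e2

theorem integral_conj_wavePacket_mul_transposeZ {h : ℝ} (hh : 0 < h) {j : Fin n}
    {φ : PhaseSpace n → ℂ} (hφ : ContDiff ℝ ∞ φ) (hc : HasCompactSupport φ)
    (y : EuclideanSpace ℝ (Fin n)) :
    ∫ α, starRingEnd ℂ (wavePacket h α y) * transposeZ h j φ α = 0 := by
  simp only [conj_wavePacket, mul_assoc]
  rw [integral_const_mul, integral_mul_transposeZ (contDiff_quadExp _ _ _ _) hφ hc, mul_zero]
  intro α
  rw [fderiv_quadExp_fst, fderiv_quadExp_snd]
  have : (h : ℂ) ≠ 0 := by exact_mod_cast hh.ne'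
  generalize quadExp (-Complex.I / h) (1 / (2 * h)) 0 ((y, 0) : PhaseSpace n) α = q
  simp only [PiLp.zero_apply]
  push_cast
  field_simp
  linear_combination ((α.2.ofLp j : ℂ) * q) * Complex.I_sq

theorem norm_wavePacket_le {h : ℝ} (hh : 0 < h) (α : PhaseSpace n)
    (y : EuclideanSpace ℝ (Fin n)) : ‖wavePacket h α y‖ ≤ fbiNorm n h := by
  rw [norm_wavePacket hh]
  refine mul_le_of_le_one_right (fbiNorm_pos n hh).le (Real.exp_le_one_iff.2 ?_)
  have : 0 ≤ 1 / (2 * h) * ‖α.1 - y‖ ^ 2 := by positivity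
  linarith

theorem hasCompactSupport_transposeZ (h : ℝ) (j : Fin n) {φ : PhaseSpace n → ℂ}
    (hc : HasCompactSupport φ) : HasCompactSupport (transposeZ h j φ) := by
  have h1 := (hasCompactSupport_fderiv_apply hc (EuclideanSpace.single j (1 : ℝ), 0)).mul_left
    (f := fun _ => Complex.I * h)
  have h2 := hc.mul_left (f := fun α : PhaseSpace n => ((α.2 j : ℝ) : ℂ))
  have h3 := (hasCompactSupport_fderiv_apply hc (0, EuclideanSpace.single j (1 : ℝ))).mul_left
    (f := fun _ => (h : ℂ))
  exact (h1.sub h2).add h3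

/-- ℋ is closed, so Schwartz functions suffice. For them Fubini reduces the claim to a single y,
where conj(e_α(y)) is a classical solution in α. -/
theorem fbiTransform_mem_fbiSpace {h : ℝ} (hh : 0 < h) (u : L2Config n) :
    fbiTransform hh u ∈ fbiSpace n h := by
  refine (SchwartzMap.denseRange_toLpCLM (E := EuclideanSpace ℝ (Fin n)) (F := ℂ) (p := 2)
      (μ := volume) ENNReal.ofNat_ne_top).induction_on
      (p := fun u => fbiTransform hh u ∈ fbiSpace n h) u
      ((isClosed_fbiSpace n h).preimage (fbiTransform hh).continuous) fun v j φ hφ hc => ?_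
  have e1 : ∫ α, fbiTransform hh (v.toLp 2 volume) α * transposeZ h j φ α
      = ∫ α, ∫ y, starRingEnd ℂ (wavePacket h α y) * v y * transposeZ h j φ α := by
    refine integral_congr_ae ?_
    filter_upwards [fbiTransform_toLp_ae hh v] with α hα
    rw [hα, fbiFun_eq, integral_mul_const]
  refine e1.trans ?_
  rw [integral_integral_swap]
  · rw [← integral_zero (EuclideanSpace ℝ (Fin n)) ℂ]
    refine integral_congr_ae (.of_forall fun y => ?_)
    simp only [mul_right_comm _ (v y)]
    rw [integral_mul_const, integral_conj_wavePacket_mul_transposeZ hh hφ hc, zero_mul]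
  · have h1 : Integrable (transposeZ h j φ) :=
      (continuous_transposeZ h j hφ).integrable_of_hasCompactSupport
        (hasCompactSupport_transposeZ h j hc)
    have h2 := (h1.mul_prod (v.integrable (μ := volume))).bdd_mul
      (f := fun q : PhaseSpace n × EuclideanSpace ℝ (Fin n) =>
        starRingEnd ℂ (wavePacket h q.1 q.2)) (c := fbiNorm n h)
      (Complex.continuous_conj.comp (continuous_wavePacket_uncurry h)).aestronglyMeasurable
      (.of_forall fun q => by rw [RCLike.norm_conj]; exact norm_wavePacket_le hh _ _)
    refine h2.congr (.of_forall fun q => ?_)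
    simp only [Function.uncurry]
    ring

end RangeSubset

/-! ### The integral kernel of TT*. -/

section BergmanKernel

variable {n : ℕ}

/-- The integral kernel of the orthogonal projector onto the range of the FBI transform. -/
noncomputable def bergmanKernel (h : ℝ) (α β : PhaseSpace n) : ℂ :=
  (((2 * Real.pi * h) ^ n)⁻¹ : ℝ) *
    quadExp (Complex.I / (2 * h)) (1 / (4 * h)) (1 / (4 * h)) α β

/-- The Gaussian integral with a complex linear term; it computes the overlap of two packets, the
Fourier transform of a packet and the mass of the averaging weight. -/
theorem integral_cexp_neg_mul_sq_norm_add_inner {b : ℝ} (hb : 0 < b) (c : ℂ)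
    (w : EuclideanSpace ℝ (Fin n)) :
    ∫ v : EuclideanSpace ℝ (Fin n), Complex.exp (-b * ‖v‖ ^ 2 + c * (inner ℝ w v : ℝ)) =
      (((Real.pi / b) ^ ((n : ℝ) / 2) : ℝ) : ℂ) * Complex.exp (c ^ 2 * ‖w‖ ^ 2 / (4 * b)) := by
  have hpi := Real.pi_pos
  have := GaussianFourier.integral_cexp_neg_mul_sq_norm_add (b := (b : ℂ)) (by simpa using hb) c w
  rw [this, finrank_euclideanSpace_fin, Complex.ofReal_cpow (by positivity)]
  push_cast
  rfl

theorem fbiFun_wavePacket {h : ℝ} (hh : 0 < h) (α β : PhaseSpace n) :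
    fbiFun h (wavePacket h β) α = bergmanKernel h α β := by
  have hpi := Real.pi_pos
  have hc : (h : ℂ) ≠ 0 := by exact_mod_cast hh.ne'
  -- Centring at the midpoint of the two positions cancels the real cross terms: what remains is
  -- exp(-|v|²/h) with the imaginary linear term -i⟨ξ_α - ξ_β, v⟩/h.
  rw [fbiFun_eq, ← integral_add_left_eq_self _ ((1 / 2 : ℝ) • (α.1 + β.1))]
  have key : ∀ v : EuclideanSpace ℝ (Fin n),
      starRingEnd ℂ (wavePacket h α ((1 / 2 : ℝ) • (α.1 + β.1) + v)) *
        wavePacket h β ((1 / 2 : ℝ) • (α.1 + β.1) + v) =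
      (fbiNorm n h ^ 2 * Complex.exp (Complex.I / (2 * h) *
          (inner ℝ (α.1 - β.1) (α.2 + β.2) : ℝ) - 1 / (4 * h) * (‖α.1 - β.1‖ ^ 2 : ℝ))) *
        Complex.exp (-(1 / h : ℝ) * ‖v‖ ^ 2
          + (-Complex.I / h) * (inner ℝ (α.2 - β.2) v : ℝ)) := by
    intro v
    rw [conj_wavePacket, wavePacket, quadExp]
    have e1 : α.1 - ((1 / 2 : ℝ) • (α.1 + β.1) + v) = (1 / 2 : ℝ) • (α.1 - β.1) - v := by module
    have e2 : β.1 - ((1 / 2 : ℝ) • (α.1 + β.1) + v) = -((1 / 2 : ℝ) • (α.1 - β.1) + v) := by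
      module
    have e3 : (1 / 2 : ℝ) • (α.1 + β.1) + v - α.1 = -((1 / 2 : ℝ) • (α.1 - β.1) - v) := by module
    simp only [e2, e3]
    rw [norm_neg, norm_neg, norm_sub_sq_real, norm_add_sq_real]
    have e4 : ∀ a b c d : ℂ, (fbiNorm n h * Complex.exp a) * (fbiNorm n h * Complex.exp b) =
        fbiNorm n h ^ 2 * Complex.exp (a + b) := by
      intro a b _ _
      rw [Complex.exp_add]; ring
    rw [e4 _ _ 0 0, mul_assoc, ← Complex.exp_add]
    congr 2
    simp only [inner_neg_left, inner_sub_left, inner_sub_right, inner_add_left, inner_add_right,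
      real_inner_smul_left, norm_smul, real_inner_comm v]
    push_cast
    field_simp
    simp
    ring
  simp only [key]
  rw [integral_const_mul, integral_cexp_neg_mul_sq_norm_add_inner (by positivity), bergmanKernel,
    quadExp]
  have e5 : (((2 * Real.pi * h) ^ n)⁻¹ : ℝ) = fbiNorm n h ^ 2 * (Real.pi / (1 / h)) ^ ((n : ℝ) / 2) := by
    have := fbiNorm_sq n hh
    rw [div_div_eq_mul_div, div_one]
    field_simp
    linarith
  rw [e5]
  push_cast
  rw [mul_assoc, mul_left_comm (Complex.exp _), ← Complex.exp_add, ← mul_assoc]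
  congr 2
  field_simp
  rw [Complex.I_sq]
  ring

theorem conj_bergmanKernel (h : ℝ) (α β : PhaseSpace n) :
    starRingEnd ℂ (bergmanKernel h β α) = bergmanKernel h α β := by
  simp only [bergmanKernel, quadExp, map_mul, ← Complex.exp_conj, Complex.conj_ofReal, map_sub,
    map_div₀, Complex.conj_I, map_ofNat, norm_sub_rev β.1 α.1, norm_sub_rev β.2 α.2, map_one]
  rw [show β.1 - α.1 = -(α.1 - β.1) by abel, inner_neg_left, add_comm β.2 α.2]
  push_cast
  congr 2
  ring

theorem norm_quadExp {a b c : ℝ} (α β : PhaseSpace n) :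
    ‖quadExp (Complex.I * a) b c α β‖ =
      Real.exp (-b * ‖α.1 - β.1‖ ^ 2 - c * ‖α.2 - β.2‖ ^ 2) := by
  rw [quadExp, Complex.norm_exp]
  congr 1
  rw [show (Complex.I * a * (inner ℝ (α.1 - β.1) (α.2 + β.2) : ℝ) - b * (‖α.1 - β.1‖ ^ 2 : ℝ)
    - c * (‖α.2 - β.2‖ ^ 2 : ℝ) : ℂ) =
    ((-b * ‖α.1 - β.1‖ ^ 2 - c * ‖α.2 - β.2‖ ^ 2 : ℝ) : ℂ) +
    ((a * inner ℝ (α.1 - β.1) (α.2 + β.2) : ℝ) : ℂ) * Complex.I by push_cast; ring]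
  rw [Complex.add_re, Complex.ofReal_re, Complex.re_ofReal_mul, Complex.I_re]
  simp

theorem norm_bergmanKernel {h : ℝ} (hh : 0 < h) (α β : PhaseSpace n) :
    ‖bergmanKernel h α β‖ = ((2 * Real.pi * h) ^ n)⁻¹ *
      Real.exp (-(1 / (4 * h)) * ‖α.1 - β.1‖ ^ 2 - 1 / (4 * h) * ‖α.2 - β.2‖ ^ 2) := by
  have := Real.pi_pos
  have e := norm_quadExp (a := 1 / (2 * h)) (b := 1 / (4 * h)) (c := 1 / (4 * h)) α β
  rw [bergmanKernel, norm_mul, Complex.norm_real, Real.norm_of_nonneg (by positivity), ← e]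
  congr 3 <;> push_cast <;> ring

/-- The projector `T T*` onto the range of the FBI transform is an integral operator. -/
theorem fbiTransform_adjoint_ae {h : ℝ} (hh : 0 < h) (f : L2Phase n) :
    fbiTransform hh (ContinuousLinearMap.adjoint (fbiTransform hh).toContinuousLinearMap f)
      =ᵐ[volume] fun α => ∫ β, bergmanKernel h α β * f β := by
  filter_upwards [isFBITransform_fbiTransform hh
    (ContinuousLinearMap.adjoint (fbiTransform hh).toContinuousLinearMap f)] with α hα
  -- TT*f(α) = ⟨e_α, T*f⟩ = ⟨T e_α, f⟩, and T e_α is the explicit overlap of packets.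
  rw [hα, fbiFun_eq_inner hh, ContinuousLinearMap.adjoint_inner_right, L2.inner_def]
  refine integral_congr_ae ?_
  filter_upwards [fbiTransform_toLp_ae hh (wavePacketS hh α)] with β hβ
  have e : fbiFun h (wavePacketS hh α) β = bergmanKernel h β α := by
    rw [← fbiFun_wavePacket hh]
    congr 1
    funext y
    simp
  rw [RCLike.inner_apply]
  change f β * starRingEnd ℂ (fbiTransform hh _ β) = _
  rw [hβ, e, conj_bergmanKernel, mul_comm]

end BergmanKernel

/-! ### Gaussian averages of elements of ℋ. -/

section RangeSuperset

variable {n : ℕ}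

theorem exists_schwartz_quadExp {μ : ℝ} (hμ : 0 < μ) (a : ℝ) (α : PhaseSpace n) :
    ∃ f : 𝓢(PhaseSpace n, ℂ), ∀ β, f β = quadExp (Complex.I * a) μ μ α β := by
  have g1 : (fun β : PhaseSpace n => α.1 - β.1).HasTemperateGrowth :=
    (Function.HasTemperateGrowth.const α.1).sub
      (ContinuousLinearMap.fst ℝ (EuclideanSpace ℝ (Fin n))
        (EuclideanSpace ℝ (Fin n))).hasTemperateGrowth
  have g2 : (fun β : PhaseSpace n => α.2 + β.2).HasTemperateGrowth :=
    (Function.HasTemperateGrowth.const α.2).add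
      (ContinuousLinearMap.snd ℝ (EuclideanSpace ℝ (Fin n))
        (EuclideanSpace ℝ (Fin n))).hasTemperateGrowth
  have g3 : (fun β : PhaseSpace n => α.2 - β.2).HasTemperateGrowth :=
    (Function.HasTemperateGrowth.const α.2).sub
      (ContinuousLinearMap.snd ℝ (EuclideanSpace ℝ (Fin n))
        (EuclideanSpace ℝ (Fin n))).hasTemperateGrowth
  have i1 := (innerSL ℝ (E := EuclideanSpace ℝ (Fin n))).bilinear_hasTemperateGrowth g1 g2
  have i2 := (Function.hasTemperateGrowth_norm_sq (EuclideanSpace ℝ (Fin n))).comp g1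
  have i3 := (Function.hasTemperateGrowth_norm_sq (EuclideanSpace ℝ (Fin n))).comp g3
  have j1 := Function.Complex.hasTemperateGrowth_ofReal.comp i1
  have j2 := Function.Complex.hasTemperateGrowth_ofReal.comp i2
  have j3 := Function.Complex.hasTemperateGrowth_ofReal.comp i3
  refine exists_schwartzMap_cexp (ε := μ / 2) (C := μ * (‖α.1‖ ^ 2 + ‖α.2‖ ^ 2))
    ((((Function.HasTemperateGrowth.const (Complex.I * a)).mul j1).sub
    ((Function.HasTemperateGrowth.const (μ : ℂ)).mul j2)).sub
    ((Function.HasTemperateGrowth.const (μ : ℂ)).mul j3)) (by positivity) fun β => ?_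
  have hre : (Complex.I * a * (inner ℝ (α.1 - β.1) (α.2 + β.2) : ℝ)
      - μ * (‖α.1 - β.1‖ ^ 2 : ℝ) - μ * (‖α.2 - β.2‖ ^ 2 : ℝ) : ℂ).re
      = -μ * ‖α.1 - β.1‖ ^ 2 - μ * ‖α.2 - β.2‖ ^ 2 := by
    rw [show (Complex.I * a * (inner ℝ (α.1 - β.1) (α.2 + β.2) : ℝ)
      - μ * (‖α.1 - β.1‖ ^ 2 : ℝ) - μ * (‖α.2 - β.2‖ ^ 2 : ℝ) : ℂ) =
      ((-μ * ‖α.1 - β.1‖ ^ 2 - μ * ‖α.2 - β.2‖ ^ 2 : ℝ) : ℂ) +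
      ((a * inner ℝ (α.1 - β.1) (α.2 + β.2) : ℝ) : ℂ) * Complex.I by push_cast; ring]
    rw [Complex.add_re, Complex.ofReal_re, Complex.re_ofReal_mul, Complex.I_re]
    simp
  refine hre.le.trans ?_
  have tri : ∀ x y : EuclideanSpace ℝ (Fin n), ‖y‖ ^ 2 ≤ 2 * ‖x - y‖ ^ 2 + 2 * ‖x‖ ^ 2 := by
    intro x y
    have : ‖y‖ ≤ ‖x‖ + ‖x - y‖ := by
      calc ‖y‖ = ‖x - (x - y)‖ := by congr 1; abel
        _ ≤ _ := norm_sub_le _ _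
    nlinarith [norm_nonneg y, sq_nonneg (‖x - y‖ - ‖x‖)]
  have h1 := tri α.1 β.1
  have h2 := tri α.2 β.2
  have h3 : ‖β‖ ^ 2 ≤ ‖β.1‖ ^ 2 + ‖β.2‖ ^ 2 := by
    rw [Prod.norm_def]
    rcases max_cases ‖β.1‖ ‖β.2‖ with ⟨h, _⟩ | ⟨h, _⟩ <;> rw [h] <;> nlinarith [sq_nonneg ‖β.1‖, sq_nonneg ‖β.2‖]
  nlinarith

theorem transposeZ_cutoff_mul (h : ℝ) (j : Fin n) (χ : PhaseSpace n → ℝ)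
    (hχ : ContDiff ℝ ∞ χ) (φ : PhaseSpace n → ℂ) (hφ : ContDiff ℝ ∞ φ) (α : PhaseSpace n) :
    transposeZ h j (fun β => χ β * φ β) α = χ α * transposeZ h j φ α +
      (Complex.I * h * (fderiv ℝ χ α (EuclideanSpace.single j (1 : ℝ), 0) : ℝ)
        + h * (fderiv ℝ χ α (0, EuclideanSpace.single j (1 : ℝ)) : ℝ)) * φ α := by
  have e1 : HasFDerivAt (fun β => (χ β : ℂ)) (Complex.ofRealCLM ∘L fderiv ℝ χ α) α :=
    Complex.ofRealCLM.hasFDerivAt.comp α (hχ.contDiffAt.differentiableAt (by simp)).hasFDerivAt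
  have e2 := (hφ.contDiffAt (x := α)).differentiableAt (by simp) |>.hasFDerivAt
  have e3 := (e1.mul e2).fderiv
  simp only [transposeZ]
  change Complex.I * h * fderiv ℝ ((fun β => (χ β : ℂ)) * φ) α _ - _ +
    h * fderiv ℝ ((fun β => (χ β : ℂ)) * φ) α _ = _
  rw [e3]
  simp
  ring

/-- Membership in ℋ only tests compactly supported φ. Dilated cutoffs extend this to φ with φ and
Z_jᵗφ in L², since the commutator with the cutoff is of the order of the reciprocal radius.
Gaussians become admissible. -/
theorem integral_mem_fbiSpace_mul_transposeZ {h : ℝ} {w : L2Phase n}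
    (hw : w ∈ fbiSpace n h) (j : Fin n) {φ : PhaseSpace n → ℂ} (hφ : ContDiff ℝ ∞ φ)
    (hφ2 : MemLp φ 2 (volume : Measure (PhaseSpace n)))
    (hZ2 : MemLp (transposeZ h j φ) 2 (volume : Measure (PhaseSpace n))) :
    ∫ α, w α * transposeZ h j φ α = 0 := by
  let b : ContDiffBump (0 : PhaseSpace n) := ⟨1, 2, one_pos, one_lt_two⟩
  -- `R k` is the reciprocal of the cutoff radius, so it tends to zero and also bounds the
  -- derivative of the cutoff.
  let R : ℕ → ℝ := fun k => ((k : ℝ) + 1)⁻¹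
  have hR : ∀ k, 0 < R k := fun k => by positivity
  have hR1 : ∀ k, R k ≤ 1 := fun k => inv_le_one_of_one_le₀ (by simp)
  have hRlim : Filter.Tendsto R Filter.atTop (nhds 0) := by
    simpa [R, one_div] using tendsto_one_div_add_atTop_nhds_zero_nat (𝕜 := ℝ)
  let χ : ℕ → PhaseSpace n → ℝ := fun k α => b (R k • α)
  have hχ : ∀ k, ContDiff ℝ ∞ (χ k) := fun k => b.contDiff.comp (contDiff_const_smul (R k))
  have hχc : ∀ k, HasCompactSupport (χ k) := fun k =>
    b.hasCompactSupport.comp_smul (hR k).ne'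
  have hχd : ∀ k α v, fderiv ℝ (χ k) α v = R k * fderiv ℝ b (R k • α) v := by
    intro k α v
    have := fderiv_comp_smul (𝕜 := ℝ) (f := (b : PhaseSpace n → ℝ)) (R k) (x := α)
    change fderiv ℝ (fun α => b (R k • α)) α v = _
    rw [this]
    simp
  obtain ⟨M, hM⟩ : ∃ M, ∀ α, ‖fderiv ℝ (b : PhaseSpace n → ℝ) α‖ ≤ M :=
    (b.hasCompactSupport.fderiv (𝕜 := ℝ)).exists_bound_of_continuous
      (b.contDiff.continuous_fderiv (n := 1) one_ne_zero)
  have hM0 : 0 ≤ M := (norm_nonneg _).trans (hM 0)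
  set v : PhaseSpace n := (EuclideanSpace.single j (1 : ℝ), 0)
  set v' : PhaseSpace n := (0, EuclideanSpace.single j (1 : ℝ))
  have hzero : ∀ k, ∫ α, w α * transposeZ h j (fun β => χ k β * φ β) α = 0 := fun k =>
    hw j _ ((Complex.ofRealCLM.contDiff.comp (hχ k)).mul hφ)
      (((hχc k).comp_left (g := ((↑) : ℝ → ℂ)) Complex.ofReal_zero).mul_right)
  set D : ℕ → PhaseSpace n → ℂ := fun k α =>
    Complex.I * h * (fderiv ℝ (χ k) α v : ℝ) + h * (fderiv ℝ (χ k) α v' : ℝ)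
  have hDb : ∀ k α, ‖D k α‖ ≤ R k * (|h| * M * (‖v‖ + ‖v'‖)) := by
    intro k α
    have hb : ∀ v, ‖((fderiv ℝ (χ k) α v : ℝ) : ℂ)‖ ≤ R k * (M * ‖v‖) := by
      intro v
      rw [Complex.norm_real, hχd, norm_mul, Real.norm_of_nonneg (hR k).le]
      gcongr
      exact (ContinuousLinearMap.le_opNorm _ _).trans (by gcongr; exact hM _)
    refine (norm_add_le _ _).trans ?_
    rw [norm_mul, norm_mul, norm_mul, Complex.norm_I, Complex.norm_real, one_mul, Real.norm_eq_abs]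
    have h1 := mul_le_mul_of_nonneg_left (hb v) (abs_nonneg h)
    have h2 := mul_le_mul_of_nonneg_left (hb v') (abs_nonneg h)
    linarith
  have hlim : Filter.Tendsto (fun k => ∫ α, w α * transposeZ h j (fun β => χ k β * φ β) α)
      Filter.atTop (nhds (∫ α, w α * transposeZ h j φ α)) := by
    refine tendsto_integral_of_dominated_convergence
      (fun α => ‖w α * transposeZ h j φ α‖ + (|h| * M * (‖v‖ + ‖v'‖)) * ‖w α * φ α‖) ?_ ?_ ?_ ?_
    · intro k
      exact (Lp.aestronglyMeasurable w).mul (continuous_transposeZ h j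
        ((Complex.ofRealCLM.contDiff.comp (hχ k)).mul hφ)).aestronglyMeasurable
    · exact ((Lp.memLp w).integrable_mul hZ2).norm.add
        (((Lp.memLp w).integrable_mul hφ2).norm.const_mul _)
    · refine fun k => .of_forall fun α => ?_
      rw [transposeZ_cutoff_mul h j (χ k) (hχ k) φ hφ, mul_add]
      refine (norm_add_le _ _).trans (add_le_add ?_ ?_)
      · rw [norm_mul, norm_mul, norm_mul (w α)]
        refine mul_le_mul_of_nonneg_left (mul_le_of_le_one_left (norm_nonneg _) ?_) (norm_nonneg _)
        rw [Complex.norm_real, Real.norm_of_nonneg b.nonneg]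
        exact b.le_one
      · change ‖w α * (D k α * φ α)‖ ≤ _
        rw [mul_left_comm, norm_mul]
        refine mul_le_mul_of_nonneg_right ((hDb k α).trans ?_) (norm_nonneg _)
        exact mul_le_of_le_one_left (by positivity) (hR1 k)
    · refine .of_forall fun α => ?_
      have h1 : Filter.Tendsto (fun k => (χ k α : ℂ)) Filter.atTop (nhds 1) := by
        have hs : Filter.Tendsto (fun k => R k • α) Filter.atTop (nhds 0) := by
          simpa using hRlim.smul_const α
        have := (b.continuous.tendsto 0).comp hs
        rw [b.one_of_mem_closedBall (by simp [b])] at this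
        have h' := (Complex.continuous_ofReal.tendsto 1).comp this
        rw [Complex.ofReal_one] at h'
        exact h'
      have h2 : Filter.Tendsto (fun k => D k α) Filter.atTop (nhds 0) := by
        refine squeeze_zero_norm (fun k => hDb k α) ?_
        simpa using hRlim.mul_const (|h| * M * (‖v‖ + ‖v'‖))
      have h3 := ((h1.mul_const (transposeZ h j φ α)).add (h2.mul_const (φ α))).const_mul (w α)
      simp only [one_mul, zero_mul, add_zero] at h3
      refine h3.congr fun k => ?_
      rw [transposeZ_cutoff_mul h j (χ k) (hχ k) φ hφ]
  simp only [hzero] at hlim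
  exact tendsto_nhds_unique hlim tendsto_const_nhds |>.symm ▸ rfl

/-- The squared Euclidean distance of two phase space points. -/
noncomputable def distSq (α β : PhaseSpace n) : ℝ := ‖α.1 - β.1‖ ^ 2 + ‖α.2 - β.2‖ ^ 2

theorem distSq_nonneg (α β : PhaseSpace n) : 0 ≤ distSq α β := by unfold distSq; positivity

theorem hasTemperateGrowth_distSq (α : PhaseSpace n) :
    (fun β => (distSq α β : ℂ)).HasTemperateGrowth := by
  have g1 : (fun β : PhaseSpace n => α.1 - β.1).HasTemperateGrowth :=
    (Function.HasTemperateGrowth.const α.1).sub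
      (ContinuousLinearMap.fst ℝ (EuclideanSpace ℝ (Fin n))
        (EuclideanSpace ℝ (Fin n))).hasTemperateGrowth
  have g3 : (fun β : PhaseSpace n => α.2 - β.2).HasTemperateGrowth :=
    (Function.HasTemperateGrowth.const α.2).sub
      (ContinuousLinearMap.snd ℝ (EuclideanSpace ℝ (Fin n))
        (EuclideanSpace ℝ (Fin n))).hasTemperateGrowth
  have i2 := (Function.hasTemperateGrowth_norm_sq (EuclideanSpace ℝ (Fin n))).comp g1
  have i3 := (Function.hasTemperateGrowth_norm_sq (EuclideanSpace ℝ (Fin n))).comp g3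
  exact Function.Complex.hasTemperateGrowth_ofReal.comp (i2.add i3)

theorem memLp_mul_quadExp {g : PhaseSpace n → ℂ} (hg : g.HasTemperateGrowth) {μ : ℝ} (hμ : 0 < μ)
    (a : ℝ) (α : PhaseSpace n) :
    MemLp (fun β => g β * quadExp (Complex.I * a) μ μ α β) 2
      (volume : Measure (PhaseSpace n)) := by
  obtain ⟨f, hf⟩ := exists_schwartz_quadExp hμ a α
  have e : (fun β => g β * quadExp (Complex.I * a) μ μ α β) = SchwartzMap.smulLeftCLM ℂ g f := by
    funext β
    rw [SchwartzMap.smulLeftCLM_apply_apply hg, smul_eq_mul, hf]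
  rw [e]
  exact SchwartzMap.memLp _ _ _

theorem norm_quadExp_distSq {a μ : ℝ} (α β : PhaseSpace n) :
    ‖quadExp (Complex.I * a) μ μ α β‖ = Real.exp (-μ * distSq α β) := by
  rw [norm_quadExp, distSq]
  congr 1
  ring

theorem hasDerivAt_integral_mul_quadExp (w : L2Phase n) (a : ℝ) (α : PhaseSpace n) {μ₀ : ℝ}
    (hμ : 0 < μ₀) :
    HasDerivAt (fun μ : ℝ => ∫ β, w β * quadExp (Complex.I * a) μ μ α β)
      (-∫ β, w β * (distSq α β * quadExp (Complex.I * a) μ₀ μ₀ α β)) μ₀ := by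
  have hcont : ∀ μ : ℝ, Continuous (quadExp (Complex.I * a) μ μ α) := fun μ =>
    (contDiff_quadExp _ _ _ _).continuous
  have hd := (hasTemperateGrowth_distSq α).1.continuous
  have key := (hasDerivAt_integral_of_dominated_loc_of_deriv_le (μ := volume)
    (F := fun (μ : ℝ) β => w β * quadExp (Complex.I * a) μ μ α β)
    (F' := fun (μ : ℝ) β => w β * (-(distSq α β * quadExp (Complex.I * a) μ μ α β))) (x₀ := μ₀)
    -- On this ball μ ≥ μ₀/2, so one Gaussian of rate μ₀/2 dominates all the μ-derivatives.
    (s := Metric.ball μ₀ (μ₀ / 2))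
    (bound := fun β => ‖w β * (distSq α β *
      quadExp (Complex.I * a) (μ₀ / 2 : ℝ) (μ₀ / 2 : ℝ) α β)‖)
    (Metric.ball_mem_nhds _ (by positivity)) ?_ ?_ ?_ ?_ ?_ ?_).2
  · refine key.congr_deriv ?_
    rw [← integral_neg]
    refine integral_congr_ae (.of_forall fun β => ?_)
    ring
  · exact .of_forall fun μ => (Lp.aestronglyMeasurable w).mul (hcont μ).aestronglyMeasurable
  · have := memLp_mul_quadExp (Function.HasTemperateGrowth.const (1 : ℂ)) hμ a α
    simp only [one_mul] at this
    exact (Lp.memLp w).integrable_mul this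
  · exact (Lp.aestronglyMeasurable w).mul (hd.mul (hcont _)).neg.aestronglyMeasurable
  · refine .of_forall fun β μ hm => ?_
    rw [mul_neg, norm_neg, norm_mul, norm_mul, norm_mul, norm_mul, norm_quadExp_distSq,
      norm_quadExp_distSq]
    have h1 : μ₀ / 2 ≤ μ := by
      rw [Metric.mem_ball, Real.dist_eq] at hm
      linarith [(abs_lt.1 hm).1]
    gcongr
    · exact distSq_nonneg α β
  · exact ((Lp.memLp w).integrable_mul
      (memLp_mul_quadExp (hasTemperateGrowth_distSq α) (by positivity) a α)).norm
  · refine .of_forall fun β μ _ => ?_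
    have h1 : HasDerivAt (fun μ : ℝ => (μ : ℂ)) 1 μ := Complex.ofRealCLM.hasDerivAt
    have h2 := (((hasDerivAt_const μ (Complex.I * a * (inner ℝ (α.1 - β.1) (α.2 + β.2) : ℝ))).sub
      (h1.mul_const ((‖α.1 - β.1‖ ^ 2 : ℝ) : ℂ))).sub
      (h1.mul_const ((‖α.2 - β.2‖ ^ 2 : ℝ) : ℂ))).cexp.const_mul (w β)
    refine HasDerivAt.congr_deriv h2 ?_
    simp only [quadExp, distSq, Pi.sub_apply]
    push_cast
    ring

/-- The linear factor (ξ_j - η_j) - i(x_j - y_j) is chosen so that Z_jᵗ produces only a constant and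
the squared distance in the j-th coordinates: the equation Z_j w = 0 becomes an identity between
moments. -/
theorem transposeZ_creation_mul_quadExp {h : ℝ} (hh : 0 < h) (μ : ℝ) (j : Fin n)
    (α β : PhaseSpace n) :
    transposeZ h j (fun β => ((α.2 j - β.2 j : ℝ) - Complex.I * (α.1 j - β.1 j : ℝ)) *
        quadExp (Complex.I * (1 / (2 * h) : ℝ)) μ μ α β) β =
      (-2 * h + (1 / 2 + 2 * h * μ) *
        (((α.1 j - β.1 j) ^ 2 + (α.2 j - β.2 j) ^ 2 : ℝ) : ℂ)) *
        quadExp (Complex.I * (1 / (2 * h) : ℝ)) μ μ α β := by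
  have hc : (h : ℂ) ≠ 0 := by exact_mod_cast hh.ne'
  let L1 : PhaseSpace n →L[ℝ] ℂ := Complex.ofRealCLM ∘L (EuclideanSpace.proj j ∘L
    ContinuousLinearMap.fst ℝ (EuclideanSpace ℝ (Fin n)) (EuclideanSpace ℝ (Fin n)))
  let L2 : PhaseSpace n →L[ℝ] ℂ := Complex.ofRealCLM ∘L (EuclideanSpace.proj j ∘L
    ContinuousLinearMap.snd ℝ (EuclideanSpace ℝ (Fin n)) (EuclideanSpace ℝ (Fin n)))
  have hg : HasFDerivAt (fun β : PhaseSpace n =>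
      ((α.2 j - β.2 j : ℝ) - Complex.I * (α.1 j - β.1 j : ℝ) : ℂ)) (-L2 - Complex.I • -L1) β := by
    have h1 : HasFDerivAt (fun β : PhaseSpace n => ((α.2 j : ℂ) - L2 β) -
      Complex.I * ((α.1 j : ℂ) - L1 β)) (-L2 - Complex.I • -L1) β :=
      (L2.hasFDerivAt.const_sub _).sub ((L1.hasFDerivAt.const_sub _).const_mul _)
    convert h1 using 2 with β
    simp [L1, L2]
  have hq := ((contDiff_quadExp (Complex.I * (1 / (2 * h) : ℝ)) μ μ α).contDiffAt
    (x := β)).differentiableAt (by simp) |>.hasFDerivAt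
  have e3 := (hg.mul hq).fderiv
  simp only [transposeZ]
  change Complex.I * h * fderiv ℝ ((fun β : PhaseSpace n =>
      ((α.2 j - β.2 j : ℝ) - Complex.I * (α.1 j - β.1 j : ℝ) : ℂ)) *
      quadExp (Complex.I * (1 / (2 * h) : ℝ)) μ μ α) β _ - _ + h * fderiv ℝ ((fun β : PhaseSpace n
      => ((α.2 j - β.2 j : ℝ) - Complex.I * (α.1 j - β.1 j : ℝ) : ℂ)) *
      quadExp (Complex.I * (1 / (2 * h) : ℝ)) μ μ α) β _ = _
  rw [e3]
  simp only [add_apply, smul_apply, fderiv_quadExp_fst, fderiv_quadExp_snd]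
  generalize quadExp (Complex.I * (1 / (2 * h) : ℝ)) μ μ α β = q
  simp [L1, L2]
  field_simp
  ring_nf
  simp only [Complex.I_pow_three, Complex.I_sq]
  ring

theorem sum_sq_sub_eq_distSq (α β : PhaseSpace n) :
    ∑ j, ((α.1 j - β.1 j) ^ 2 + (α.2 j - β.2 j) ^ 2) = distSq α β := by
  rw [distSq, EuclideanSpace.norm_sq_eq, EuclideanSpace.norm_sq_eq, ← Finset.sum_add_distrib]
  simp

/-- Each coordinate ties a second moment of w to its zeroth moment; summing over j assembles the
full squared distance and the factor n. The squared distance is minus the logarithmic μ-derivative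
of the Gaussian, so this is a differential equation in μ. -/
theorem integral_mem_fbiSpace_mul_distSq {h : ℝ} (hh : 0 < h) {w : L2Phase n}
    (hw : w ∈ fbiSpace n h) {μ : ℝ} (hμ : 0 < μ) (α : PhaseSpace n) :
    (μ + 1 / (4 * h) : ℝ) * ∫ β, w β * (distSq α β *
        quadExp (Complex.I * (1 / (2 * h) : ℝ)) μ μ α β) =
      n * ∫ β, w β * quadExp (Complex.I * (1 / (2 * h) : ℝ)) μ μ α β := by
  have hc : (h : ℂ) ≠ 0 := by exact_mod_cast hh.ne'
  have i0 : Integrable fun β => w β * quadExp (Complex.I * (1 / (2 * h) : ℝ)) μ μ α β := by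
    have := memLp_mul_quadExp (Function.HasTemperateGrowth.const (1 : ℂ)) hμ (1 / (2 * h)) α
    simp only [one_mul] at this
    exact (Lp.memLp w).integrable_mul this
  have hcoord : ∀ j, (fun β : PhaseSpace n => ((α.2 j - β.2 j : ℝ) : ℂ)).HasTemperateGrowth ∧
      (fun β : PhaseSpace n => ((α.1 j - β.1 j : ℝ) : ℂ)).HasTemperateGrowth := by
    intro j
    have p1 := (EuclideanSpace.proj (𝕜 := ℝ) j ∘L ContinuousLinearMap.fst ℝ
      (EuclideanSpace ℝ (Fin n)) (EuclideanSpace ℝ (Fin n))).hasTemperateGrowth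
    have p2 := (EuclideanSpace.proj (𝕜 := ℝ) j ∘L ContinuousLinearMap.snd ℝ
      (EuclideanSpace ℝ (Fin n)) (EuclideanSpace ℝ (Fin n))).hasTemperateGrowth
    exact ⟨Function.Complex.hasTemperateGrowth_ofReal.comp
      ((Function.HasTemperateGrowth.const (α.2 j)).sub p2),
      Function.Complex.hasTemperateGrowth_ofReal.comp
      ((Function.HasTemperateGrowth.const (α.1 j)).sub p1)⟩
  have hsq : ∀ j, (fun β : PhaseSpace n =>
      (((α.1 j - β.1 j) ^ 2 + (α.2 j - β.2 j) ^ 2 : ℝ) : ℂ)).HasTemperateGrowth := by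
    intro j
    have e : (fun β : PhaseSpace n => (((α.1 j - β.1 j) ^ 2 + (α.2 j - β.2 j) ^ 2 : ℝ) : ℂ)) =
        (fun β : PhaseSpace n => ((α.1 j - β.1 j : ℝ) : ℂ)) ^ 2 +
        (fun β : PhaseSpace n => ((α.2 j - β.2 j : ℝ) : ℂ)) ^ 2 := by
      funext β
      simp
    rw [e]
    exact ((hcoord j).2.pow 2).add ((hcoord j).1.pow 2)
  have i1 : ∀ j, Integrable fun β => w β * ((((α.1 j - β.1 j) ^ 2 + (α.2 j - β.2 j) ^ 2 : ℝ) : ℂ)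
      * quadExp (Complex.I * (1 / (2 * h) : ℝ)) μ μ α β) := fun j =>
    (Lp.memLp w).integrable_mul (memLp_mul_quadExp (hsq j) hμ _ α)
  have hj : ∀ j, (2 * h * (μ + 1 / (4 * h) : ℝ)) *
      (∫ β, w β * ((((α.1 j - β.1 j) ^ 2 + (α.2 j - β.2 j) ^ 2 : ℝ) : ℂ) *
        quadExp (Complex.I * (1 / (2 * h) : ℝ)) μ μ α β)) =
      2 * h * ∫ β, w β * quadExp (Complex.I * (1 / (2 * h) : ℝ)) μ μ α β := by
    intro j
    set g : PhaseSpace n → ℂ := fun β => (α.2 j - β.2 j : ℝ) - Complex.I * (α.1 j - β.1 j : ℝ)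
    have hg : g.HasTemperateGrowth :=
      (hcoord j).1.sub ((Function.HasTemperateGrowth.const Complex.I).mul (hcoord j).2)
    have hZ := transposeZ_creation_mul_quadExp hh μ j α
    have hq : (fun β : PhaseSpace n => (-2 * h + (1 / 2 + 2 * h * μ) *
        (((α.1 j - β.1 j) ^ 2 + (α.2 j - β.2 j) ^ 2 : ℝ) : ℂ) : ℂ)).HasTemperateGrowth :=
      (Function.HasTemperateGrowth.const (-2 * h : ℂ)).add
        ((Function.HasTemperateGrowth.const (1 / 2 + 2 * h * μ : ℂ)).mul (hsq j))
    have h0 := integral_mem_fbiSpace_mul_transposeZ hw j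
      (φ := fun β => g β * quadExp (Complex.I * (1 / (2 * h) : ℝ)) μ μ α β)
      (hg.1.mul (contDiff_quadExp _ _ _ _)) (memLp_mul_quadExp hg hμ _ α)
      (by rw [funext hZ]; exact memLp_mul_quadExp hq hμ _ α)
    rw [funext hZ] at h0
    have e : ∫ β, w β * ((-2 * h + (1 / 2 + 2 * h * μ) *
        (((α.1 j - β.1 j) ^ 2 + (α.2 j - β.2 j) ^ 2 : ℝ) : ℂ)) *
        quadExp (Complex.I * (1 / (2 * h) : ℝ)) μ μ α β) =
      (2 * h * (μ + 1 / (4 * h) : ℝ)) *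
      (∫ β, w β * ((((α.1 j - β.1 j) ^ 2 + (α.2 j - β.2 j) ^ 2 : ℝ) : ℂ) *
        quadExp (Complex.I * (1 / (2 * h) : ℝ)) μ μ α β)) -
      2 * h * ∫ β, w β * quadExp (Complex.I * (1 / (2 * h) : ℝ)) μ μ α β := by
      rw [← integral_const_mul, ← integral_const_mul,
        ← integral_sub ((i1 j).const_mul _) (i0.const_mul _)]
      refine integral_congr_ae (.of_forall fun β => ?_)
      simp only
      push_cast
      field_simp
      ring
    rw [e] at h0
    linear_combination h0
  have hs := Finset.sum_congr (rfl : (Finset.univ : Finset (Fin n)) = Finset.univ)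
    fun j _ => hj j
  rw [← Finset.mul_sum, ← integral_finsetSum _ fun j _ => i1 j, Finset.sum_const,
    Finset.card_univ, Fintype.card_fin, nsmul_eq_mul] at hs
  have e2 : ∫ β, ∑ j, w β * ((((α.1 j - β.1 j) ^ 2 + (α.2 j - β.2 j) ^ 2 : ℝ) : ℂ) *
        quadExp (Complex.I * (1 / (2 * h) : ℝ)) μ μ α β) =
      ∫ β, w β * (distSq α β * quadExp (Complex.I * (1 / (2 * h) : ℝ)) μ μ α β) := by
    refine integral_congr_ae (.of_forall fun β => ?_)
    simp only
    rw [← Finset.mul_sum, ← Finset.sum_mul, ← Complex.ofReal_sum, sum_sq_sub_eq_distSq]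
  rw [e2] at hs
  have h2 : (2 * h : ℂ) ≠ 0 := by simpa using hc
  apply mul_left_cancel₀ h2
  linear_combination hs

/-- Gaussian averages of an element of `ℋ` do not depend on the width of the Gaussian. -/
theorem integral_mem_fbiSpace_mul_quadExp_const {h : ℝ} (hh : 0 < h) {w : L2Phase n}
    (hw : w ∈ fbiSpace n h) (α : PhaseSpace n) {μ₁ μ₂ : ℝ} (hμ₁ : 0 < μ₁) (hμ : μ₁ ≤ μ₂) :
    ((μ₂ + 1 / (4 * h) : ℝ) : ℂ) ^ n * ∫ β, w β *
        quadExp (Complex.I * (1 / (2 * h) : ℝ)) μ₂ μ₂ α β =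
      ((μ₁ + 1 / (4 * h) : ℝ) : ℂ) ^ n * ∫ β, w β *
        quadExp (Complex.I * (1 / (2 * h) : ℝ)) μ₁ μ₁ α β := by
  set J : ℝ → ℂ := fun μ => ∫ β, w β * quadExp (Complex.I * (1 / (2 * h) : ℝ)) μ μ α β
  have hd : ∀ μ : ℝ, 0 < μ →
      HasDerivAt (fun μ : ℝ => ((μ + 1 / (4 * h) : ℝ) : ℂ) ^ n * J μ) 0 μ := by
    intro μ hμ0
    have h1 := hasDerivAt_integral_mul_quadExp w (1 / (2 * h)) α hμ0
    have h2 : HasDerivAt (fun μ : ℝ => ((μ + 1 / (4 * h) : ℝ) : ℂ)) 1 μ := by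
      have := ((hasDerivAt_id μ).add_const (1 / (4 * h))).ofReal_comp
      simpa using this
    refine HasDerivAt.congr_deriv ((h2.pow n).mul h1) ?_
    have h3 := integral_mem_fbiSpace_mul_distSq hh hw hμ0 α
    have hne : ((μ + 1 / (4 * h) : ℝ) : ℂ) ≠ 0 := by
      have : (0 : ℝ) < μ + 1 / (4 * h) := by positivity
      exact_mod_cast this.ne'
    rcases n with _ | m
    -- Dimension zero is separate because the derivative of the n-th power involves n - 1; there the
    -- moment identity says that the second moment vanishes.
    · simp only [CharP.cast_eq_zero, zero_mul, mul_eq_zero, hne, false_or] at h3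
      rw [h3]
      simp
    · simp only [Nat.add_sub_cancel, Pi.pow_apply, mul_one]
      linear_combination (-((μ + 1 / (4 * h) : ℝ) : ℂ) ^ m) * h3
  refine constant_of_has_deriv_right_zero (a := μ₁) (b := μ₂)
    (f := fun μ : ℝ => ((μ + 1 / (4 * h) : ℝ) : ℂ) ^ n * J μ)
    (fun μ hm => (hd μ (hμ₁.trans_le hm.1)).continuousAt.continuousWithinAt)
    (fun μ hm => (hd μ (hμ₁.trans_le hm.1)).hasDerivWithinAt) μ₂ ⟨hμ, le_rfl⟩

end RangeSuperset

/-! ### Polynomial weights. -/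

section Decay

variable {V : Type*} [NormedAddCommGroup V]

/-- Peetre's inequality: a weight at x may be moved to y at the price of a power of 1 + ‖x - y‖,
which a Gaussian absorbs. -/
theorem inv_one_add_norm_pow_le (N : ℕ) (x y : V) :
    ((1 + ‖x‖) ^ N)⁻¹ ≤ ((1 + ‖y‖) ^ N)⁻¹ * (1 + ‖x - y‖) ^ N := by
  have h1 : 1 + ‖y‖ ≤ (1 + ‖x‖) * (1 + ‖x - y‖) := by
    have : ‖y‖ ≤ ‖x‖ + ‖x - y‖ := by
      calc ‖y‖ = ‖x - (x - y)‖ := by congr 1; abel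
        _ ≤ _ := norm_sub_le _ _
    nlinarith [norm_nonneg x, norm_nonneg (x - y), mul_nonneg (norm_nonneg x) (norm_nonneg (x - y))]
  have h2 : (1 + ‖y‖) ^ N ≤ (1 + ‖x‖) ^ N * (1 + ‖x - y‖) ^ N := by
    rw [← mul_pow]
    exact pow_le_pow_left₀ (by positivity) h1 N
  rw [inv_mul_eq_div, le_div_iff₀ (by positivity), inv_mul_le_iff₀ (by positivity)]
  exact h2

theorem integrable_inv_one_add_norm_pow [NormedSpace ℝ V] [FiniteDimensional ℝ V]
    [MeasurableSpace V] [BorelSpace V] {μ : Measure V} [μ.IsAddHaarMeasure] {N : ℕ}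
    (hN : Module.finrank ℝ V < N) : Integrable (fun x : V => ((1 + ‖x‖) ^ N)⁻¹) μ := by
  have := integrable_one_add_norm (μ := μ) (r := N) (by exact_mod_cast hN)
  refine this.congr (.of_forall fun x => ?_)
  simp only
  rw [Real.rpow_neg (by positivity), Real.rpow_natCast]

theorem SchwartzMap.integrable_one_add_norm_pow_mul [NormedSpace ℝ V] [MeasurableSpace V]
    [BorelSpace V] [SecondCountableTopology V] {μ : Measure V} [μ.HasTemperateGrowth]
    (f : 𝓢(V, ℂ)) (N m : ℕ) :
    Integrable (fun x => (1 + ‖x‖) ^ N * ‖iteratedFDeriv ℝ m f x‖) μ := by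
  have h1 := ((f.integrable_pow_mul_iteratedFDeriv μ 0 m).add
    (f.integrable_pow_mul_iteratedFDeriv μ N m)).const_mul (2 ^ (N - 1))
  refine h1.mono' ?_ (.of_forall fun x => ?_)
  · exact (((continuous_const.add continuous_norm).pow N).mul
      (f.smooth'.continuous_iteratedFDeriv (m := m) (by exact_mod_cast le_top)).norm
      ).aestronglyMeasurable
  · rw [Real.norm_of_nonneg (by positivity)]
    simp only [Pi.add_apply, pow_zero, one_mul]
    have := add_pow_le (zero_le_one) (norm_nonneg x) N
    rw [one_pow] at this
    calc _ ≤ (2 ^ (N - 1) * (1 + ‖x‖ ^ N)) * ‖iteratedFDeriv ℝ m f x‖ := by gcongr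
      _ = _ := by ring

end Decay

/-! ### The reproducing property and the range of T. -/

section Reproducing

variable {n : ℕ}

theorem finrank_phaseSpace : Module.finrank ℝ (PhaseSpace n) = 2 * n := by
  rw [Module.finrank_prod, finrank_euclideanSpace_fin]
  ring

theorem integrable_one_add_norm_pow_mul_exp_distSq (N : ℕ) {μ : ℝ} (hμ : 0 < μ) :
    Integrable (fun γ : PhaseSpace n => (1 + ‖γ‖) ^ N * Real.exp (-μ * distSq 0 γ)) := by
  obtain ⟨f, hf⟩ := exists_schwartz_quadExp hμ 0 (0 : PhaseSpace n)
  refine (f.integrable_one_add_norm_pow_mul N 0).congr (.of_forall fun γ => ?_)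
  simp only [norm_iteratedFDeriv_zero, hf, norm_quadExp_distSq]

theorem integral_exp_neg_distSq {μ : ℝ} (hμ : 0 < μ) :
    ∫ γ : PhaseSpace n, Real.exp (-μ * distSq 0 γ) = (Real.pi / μ) ^ n := by
  have hpi := Real.pi_pos
  have e : ∀ γ : PhaseSpace n, Real.exp (-μ * distSq 0 γ) =
      Real.exp (-μ * ‖γ.1‖ ^ 2) * Real.exp (-μ * ‖γ.2‖ ^ 2) := by
    intro γ
    rw [← Real.exp_add, distSq]
    simp [mul_add]
  simp only [e]
  rw [Measure.volume_eq_prod, integral_prod_mul (fun x : EuclideanSpace ℝ (Fin n) =>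
    Real.exp (-μ * ‖x‖ ^ 2)) fun x => Real.exp (-μ * ‖x‖ ^ 2),
    GaussianFourier.integral_rexp_neg_mul_sq_norm hμ, finrank_euclideanSpace_fin,
    ← Real.rpow_add (by positivity), add_halves, Real.rpow_natCast]

theorem quadExp_add_smul (a : ℝ) (μ δ : ℝ) (β γ : PhaseSpace n) :
    quadExp (Complex.I * a) μ μ (β + δ • γ) β =
      Complex.exp (Complex.I * ((a * δ * inner ℝ γ.1 ((2 : ℝ) • β.2 + δ • γ.2) : ℝ) : ℂ)
        - ((μ * δ ^ 2 * distSq 0 γ : ℝ) : ℂ)) := by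
  rw [quadExp]
  congr 1
  have e1 : (β + δ • γ).1 - β.1 = δ • γ.1 := by simp
  have e2 : (β + δ • γ).2 - β.2 = δ • γ.2 := by simp
  have e3 : (β + δ • γ).2 + β.2 = (2 : ℝ) • β.2 + δ • γ.2 := by
    rw [Prod.snd_add, Prod.smul_snd]; module
  rw [e1, e2, e3, norm_smul, norm_smul, real_inner_smul_left, distSq, mul_pow, mul_pow,
    Real.norm_eq_abs, sq_abs]
  simp only [Prod.fst_zero, Prod.snd_zero, zero_sub, norm_neg]
  push_cast
  ring

theorem distSq_zero_sub (α β : PhaseSpace n) : distSq 0 (α - β) = distSq α β := by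
  simp only [distSq, Prod.fst_zero, Prod.snd_zero, zero_sub, norm_neg, Prod.fst_sub, Prod.snd_sub]

/-- Cauchy–Schwarz: phase space has dimension 2n, so the weight is integrable and, being at most 1,
square integrable. An L² function thus enters dominated convergence arguments. -/
theorem integrable_norm_mul_inv_one_add_norm_pow (w : L2Phase n) {N : ℕ} (hN : 2 * n < N) :
    Integrable fun β => ‖w β‖ * ((1 + ‖β‖) ^ N)⁻¹ := by
  have h1 : Integrable fun β : PhaseSpace n => ((1 + ‖β‖) ^ N)⁻¹ :=
    integrable_inv_one_add_norm_pow (by rwa [finrank_phaseSpace])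
  have h2 : MemLp (fun β : PhaseSpace n => ((1 + ‖β‖) ^ N)⁻¹) 2 volume := by
    refine (memLp_two_iff_integrable_sq_norm h1.aestronglyMeasurable).2
      (h1.mono' (h1.aestronglyMeasurable.norm.pow 2) (.of_forall fun β => ?_))
    have : ((1 + ‖β‖) ^ N)⁻¹ ≤ 1 :=
      inv_le_one_of_one_le₀ (one_le_pow₀ (by linarith [norm_nonneg β]))
    rw [norm_pow, norm_norm, Real.norm_of_nonneg (by positivity)]
    exact pow_le_of_le_one (by positivity) this two_ne_zero
  exact (Lp.memLp w).norm.integrable_mul h2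

theorem exists_bound_inv_one_add_norm_pow {ψ : PhaseSpace n → ℝ} (hψ : Continuous ψ)
    (hc : HasCompactSupport ψ) (N : ℕ) : ∃ M, 0 ≤ M ∧ ∀ α, ‖ψ α‖ ≤ M * ((1 + ‖α‖) ^ N)⁻¹ := by
  obtain ⟨M, hM⟩ := (hc.mul_left (f := fun α => (1 + ‖α‖) ^ N)).exists_bound_of_continuous
    (((continuous_const.add continuous_norm).pow N).mul hψ)
  refine ⟨M, (norm_nonneg _).trans (hM 0), fun α => ?_⟩
  have := hM α
  rw [Pi.mul_apply, norm_mul, Real.norm_of_nonneg (by positivity)] at this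
  rw [← div_eq_mul_inv, le_div_iff₀ (by positivity), mul_comm]
  exact this

/-- Fubini and the substitution α = β + δγ, with Jacobian δ^{2n}, put the shrinking scale into the
arguments of ψ and of the Gaussian. -/
theorem integral_smul_gaussian_average {h : ℝ} (w : L2Phase n) {ψ : PhaseSpace n → ℝ}
    (hψ : Continuous ψ) (hc : HasCompactSupport ψ) {δ μ : ℝ} (hδ : 0 < δ) (hμ : 0 < μ) :
    ∫ α, (ψ α : ℂ) * ∫ β, w β * quadExp (Complex.I * (1 / (2 * h) : ℝ)) μ μ α β =
      δ ^ (2 * n) * ∫ β, ∫ γ : PhaseSpace n, w β * (ψ (β + δ • γ) *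
        quadExp (Complex.I * (1 / (2 * h) : ℝ)) μ μ (β + δ • γ) β) := by
  obtain ⟨M, hM0, hM⟩ := exists_bound_inv_one_add_norm_pow hψ hc (2 * n + 1)
  have hqc : Continuous fun q : PhaseSpace n × PhaseSpace n =>
      quadExp (Complex.I * (1 / (2 * h) : ℝ)) μ μ q.1 q.2 := by
    unfold quadExp; fun_prop
  have hint : Integrable (Function.uncurry fun α β => (ψ α : ℂ) *
      (w β * quadExp (Complex.I * (1 / (2 * h) : ℝ)) μ μ α β)) (volume.prod volume) := by
    have h1 := (integrable_norm_mul_inv_one_add_norm_pow w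
      (lt_add_one (2 * n))).convolution_integrand (ContinuousLinearMap.mul ℝ ℝ)
      ((integrable_one_add_norm_pow_mul_exp_distSq (n := n) (2 * n + 1) hμ).const_mul M)
    refine h1.mono' ?_ (.of_forall fun q => ?_)
    · refine AEStronglyMeasurable.mul ?_ (AEStronglyMeasurable.mul ?_ hqc.aestronglyMeasurable)
      · exact (Complex.continuous_ofReal.comp (hψ.comp continuous_fst)).aestronglyMeasurable
      · exact (Lp.aestronglyMeasurable w).comp_snd
    · simp only [Function.uncurry, ContinuousLinearMap.mul_apply']
      rw [norm_mul, norm_mul, norm_quadExp_distSq, Complex.norm_real, distSq_zero_sub]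
      calc _ ≤ (M * (((1 + ‖q.2‖) ^ (2 * n + 1))⁻¹ * (1 + ‖q.1 - q.2‖) ^ (2 * n + 1))) *
            (‖w q.2‖ * Real.exp (-μ * distSq q.1 q.2)) := by
            gcongr
            exact (hM _).trans (by gcongr; exact inv_one_add_norm_pow_le _ _ _)
        _ = _ := by ring
  simp only [← integral_const_mul]
  rw [integral_integral_swap hint]
  refine integral_congr_ae (.of_forall fun β => ?_)
  simp only
  rw [← integral_add_left_eq_self _ β]
  have e := Measure.integral_comp_smul (volume : Measure (PhaseSpace n)) (fun γ => (ψ (β + γ) : ℂ) *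
      (w β * quadExp (Complex.I * (1 / (2 * h) : ℝ)) μ μ (β + γ) β)) δ
  rw [finrank_phaseSpace, abs_of_pos (by positivity), Complex.real_smul] at e
  rw [integral_const_mul]
  have e2 : ∫ γ : PhaseSpace n, w β * (ψ (β + δ • γ) *
        quadExp (Complex.I * (1 / (2 * h) : ℝ)) μ μ (β + δ • γ) β) =
      ∫ γ : PhaseSpace n, ψ (β + δ • γ) * (w β *
        quadExp (Complex.I * (1 / (2 * h) : ℝ)) μ μ (β + δ • γ) β) :=
    integral_congr_ae (.of_forall fun γ => by ring)
  rw [e2, e, ← mul_assoc]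
  push_cast
  rw [mul_inv_cancel₀ (by simpa using fun h => absurd h hδ.ne'), one_mul]

/-- The rate μ satisfies μ + 1/(4h) = δ⁻². In the rescaled variable the modulus is exp(-(1 -
δ²/(4h)) |γ|²), at most exp(-|γ|²/2) when δ² ≤ 2h, and the phase tends to 1. The limit carries the
total mass π^n of the Gaussian exp(-|γ|²) on ℝ^{2n}. -/
theorem tendsto_gaussian_average {h : ℝ} (hh : 0 < h) (w : L2Phase n) {ψ : PhaseSpace n → ℝ}
    (hψ : Continuous ψ) (hc : HasCompactSupport ψ) {δ : ℕ → ℝ} (hδ0 : ∀ k, 0 < δ k)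
    (hδ1 : ∀ k, δ k ≤ 1) (hδh : ∀ k, δ k ^ 2 ≤ 2 * h)
    (hδ : Filter.Tendsto δ Filter.atTop (nhds 0)) :
    Filter.Tendsto (fun k => ∫ β, ∫ γ : PhaseSpace n, w β * (ψ (β + δ k • γ) *
        quadExp (Complex.I * (1 / (2 * h) : ℝ)) ((δ k ^ 2)⁻¹ - 1 / (4 * h) : ℝ)
          ((δ k ^ 2)⁻¹ - 1 / (4 * h) : ℝ) (β + δ k • γ) β)) Filter.atTop
      (nhds (Real.pi ^ n * ∫ β, w β * ψ β)) := by
  obtain ⟨M, hM0, hM⟩ := exists_bound_inv_one_add_norm_pow hψ hc (2 * n + 1)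
  have hbound : Integrable (fun q : PhaseSpace n × PhaseSpace n =>
      (‖w q.1‖ * ((1 + ‖q.1‖) ^ (2 * n + 1))⁻¹) *
      (M * ((1 + ‖q.2‖) ^ (2 * n + 1) * Real.exp (-(1 / 2) * distSq 0 q.2))))
      (volume.prod volume) :=
    (integrable_norm_mul_inv_one_add_norm_pow w (lt_add_one (2 * n))).mul_prod
      ((integrable_one_add_norm_pow_mul_exp_distSq (2 * n + 1) (by norm_num)).const_mul M)
  set F : ℕ → PhaseSpace n × PhaseSpace n → ℂ := fun k q => w q.1 * (ψ (q.1 + δ k • q.2) *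
    quadExp (Complex.I * (1 / (2 * h) : ℝ)) ((δ k ^ 2)⁻¹ - 1 / (4 * h) : ℝ)
          ((δ k ^ 2)⁻¹ - 1 / (4 * h) : ℝ) (q.1 + δ k • q.2) q.1)
  have hFm : ∀ k, AEStronglyMeasurable (F k) (volume.prod volume) := by
    intro k
    refine ((Lp.aestronglyMeasurable w).comp_fst).mul (Continuous.aestronglyMeasurable ?_)
    unfold quadExp
    fun_prop
  have hsq : ∀ k, ((δ k ^ 2)⁻¹ - 1 / (4 * h)) * δ k ^ 2 = 1 - δ k ^ 2 / (4 * h) := by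
    intro k
    have := hδ0 k
    field_simp
  have hFb : ∀ k, ∀ q, ‖F k q‖ ≤ (‖w q.1‖ * ((1 + ‖q.1‖) ^ (2 * n + 1))⁻¹) *
      (M * ((1 + ‖q.2‖) ^ (2 * n + 1) * Real.exp (-(1 / 2) * distSq 0 q.2))) := by
    intro k q
    have h1 : ‖ψ (q.1 + δ k • q.2)‖ ≤
        M * (((1 + ‖q.1‖) ^ (2 * n + 1))⁻¹ * (1 + ‖q.2‖) ^ (2 * n + 1)) := by
      refine (hM _).trans (mul_le_mul_of_nonneg_left ?_ hM0)
      refine (inv_one_add_norm_pow_le _ _ q.1).trans ?_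
      rw [add_sub_cancel_left, norm_smul, Real.norm_of_nonneg (hδ0 k).le]
      have h3 : δ k * ‖q.2‖ ≤ ‖q.2‖ := mul_le_of_le_one_left (norm_nonneg _) (hδ1 k)
      have h4 : 0 ≤ δ k * ‖q.2‖ := mul_nonneg (hδ0 k).le (norm_nonneg _)
      gcongr
    have h2 : ‖quadExp (Complex.I * (1 / (2 * h) : ℝ)) ((δ k ^ 2)⁻¹ - 1 / (4 * h) : ℝ)
          ((δ k ^ 2)⁻¹ - 1 / (4 * h) : ℝ) (q.1 + δ k • q.2) q.1‖ ≤
        Real.exp (-(1 / 2) * distSq 0 q.2) := by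
      rw [norm_quadExp_distSq, ← distSq_zero_sub, add_sub_cancel_left]
      have : distSq 0 (δ k • q.2) = δ k ^ 2 * distSq 0 q.2 := by
        simp only [distSq, Prod.fst_zero, Prod.snd_zero, zero_sub, norm_neg, Prod.smul_fst,
          Prod.smul_snd, norm_smul, mul_pow, Real.norm_eq_abs, sq_abs]
        ring
      rw [this, ← mul_assoc, neg_mul, hsq]
      refine Real.exp_le_exp.2 (mul_le_mul_of_nonneg_right ?_ (distSq_nonneg _ _))
      have : δ k ^ 2 / (4 * h) ≤ 1 / 2 := by
        rw [div_le_iff₀ (by positivity)]; linarith [hδh k]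
      linarith
    simp only [F]
    rw [norm_mul, norm_mul, Complex.norm_real]
    calc _ ≤ ‖w q.1‖ * ((M * (((1 + ‖q.1‖) ^ (2 * n + 1))⁻¹ * (1 + ‖q.2‖) ^ (2 * n + 1))) *
          Real.exp (-(1 / 2) * distSq 0 q.2)) := by gcongr
      _ = _ := by ring
  have hlim := tendsto_integral_of_dominated_convergence (μ := volume.prod volume) (F := F)
    (f := fun q => (w q.1 * ψ q.1) * (Real.exp (-1 * distSq 0 q.2) : ℂ)) _ hFm hbound
    (fun k => .of_forall (hFb k)) (.of_forall fun q => ?_)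
  · rw [integral_prod_mul (fun β => w β * (ψ β : ℂ))
      fun γ => (Real.exp (-1 * distSq 0 γ) : ℂ), integral_complex_ofReal,
      integral_exp_neg_distSq one_pos, div_one, mul_comm] at hlim
    push_cast at hlim ⊢
    refine hlim.congr fun k => ?_
    rw [integral_prod _ (hbound.mono' (hFm k) (.of_forall (hFb k)))]
    simp [F]
  · simp only [F, quadExp_add_smul, hsq, mul_assoc (w q.1)]
    refine Filter.Tendsto.const_mul _ (Filter.Tendsto.mul ?_ ?_)
    · have h1 : Filter.Tendsto (fun k => q.1 + δ k • q.2) Filter.atTop (nhds q.1) := by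
        simpa using (hδ.smul_const q.2).const_add q.1
      exact (Complex.continuous_ofReal.tendsto _).comp ((hψ.tendsto _).comp h1)
    · have hcont : Continuous fun d : ℝ => Complex.exp (Complex.I *
          ((1 / (2 * h) * d * inner ℝ q.2.1 ((2 : ℝ) • q.1.2 + d • q.2.2) : ℝ) : ℂ)
          - (((1 - d ^ 2 / (4 * h)) * distSq 0 q.2 : ℝ) : ℂ)) := by fun_prop
      have := (hcont.tendsto 0).comp hδ
      simpa [Function.comp_def] using this

/-- Elements of `ℋ` are reproduced by the projector `T T*`. -/
theorem fbiTransform_adjoint_of_mem {h : ℝ} (hh : 0 < h) {w : L2Phase n}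
    (hw : w ∈ fbiSpace n h) :
    fbiTransform hh (ContinuousLinearMap.adjoint (fbiTransform hh).toContinuousLinearMap w) = w := by
  have hpi := Real.pi_pos
  set W := fbiTransform hh (ContinuousLinearMap.adjoint (fbiTransform hh).toContinuousLinearMap w)
  have hloc : ∀ f : L2Phase n, LocallyIntegrable f volume := fun f =>
    (Lp.memLp f).locallyIntegrable (by norm_num)
  refine Lp.ext (ae_eq_of_integral_contDiff_smul_eq (hloc W) (hloc w) fun ψ hψ hc => ?_)
  -- The numerator ensures δ ≤ 1 and δ² ≤ 2h; the latter is equivalent to δ⁻² - 1/(4h) ≥ 1/(4h), so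
  -- the rate is never below that of the kernel of TT*.
  set δ : ℕ → ℝ := fun k => min 1 (2 * h) / ((k : ℝ) + 1)
  have hm : 0 < min 1 (2 * h) := by positivity
  have hδ0 : ∀ k, 0 < δ k := fun k => by positivity
  have hδm : ∀ k, δ k ≤ min 1 (2 * h) := fun k => div_le_self hm.le (by simp)
  have hδ1 : ∀ k, δ k ≤ 1 := fun k => (hδm k).trans (min_le_left _ _)
  have hδh : ∀ k, δ k ^ 2 ≤ 2 * h := fun k => by
    have := (hδm k).trans (min_le_right _ _)
    nlinarith [hδ0 k, hδ1 k]
  have hδ : Filter.Tendsto δ Filter.atTop (nhds 0) := by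
    simpa [δ, div_eq_mul_inv] using
      (tendsto_one_div_add_atTop_nhds_zero_nat (𝕜 := ℝ)).const_mul (min 1 (2 * h))
  have hlim := tendsto_gaussian_average hh w hψ.continuous hc hδ0 hδ1 hδh hδ
  -- The averages converging to π^n ∫ wψ do not depend on k: by independence of the rate, each
  -- already equals π^n ∫ ψ TT*w.
  have hconst : ∀ k, ∫ β, ∫ γ : PhaseSpace n, w β * (ψ (β + δ k • γ) *
        quadExp (Complex.I * (1 / (2 * h) : ℝ)) ((δ k ^ 2)⁻¹ - 1 / (4 * h) : ℝ)
          ((δ k ^ 2)⁻¹ - 1 / (4 * h) : ℝ) (β + δ k • γ) β) =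
      Real.pi ^ n * ∫ α, (ψ α : ℂ) * W α := by
    intro k
    have hk := hδ0 k
    have hle : 1 / (4 * h) ≤ (δ k ^ 2)⁻¹ - 1 / (4 * h) := by
      have h1 : (2 * h)⁻¹ ≤ (δ k ^ 2)⁻¹ := inv_anti₀ (by positivity) (hδh k)
      have h2 : (2 * h)⁻¹ = 1 / (4 * h) + 1 / (4 * h) := by field_simp; norm_num
      linarith
    have hpos : 0 < 1 / (4 * h) := by positivity
    have hW : ∀ᵐ α, W α = (Real.pi ^ n : ℂ)⁻¹ * (((δ k ^ 2)⁻¹ : ℝ) : ℂ) ^ n *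
        ∫ β, w β * quadExp (Complex.I * (1 / (2 * h) : ℝ)) ((δ k ^ 2)⁻¹ - 1 / (4 * h) : ℝ)
          ((δ k ^ 2)⁻¹ - 1 / (4 * h) : ℝ) α β := by
      filter_upwards [fbiTransform_adjoint_ae hh w] with α hα
      have hc := integral_mem_fbiSpace_mul_quadExp_const hh hw α hpos hle
      rw [sub_add_cancel] at hc
      rw [hα, mul_assoc, hc, ← mul_assoc, ← integral_const_mul]
      refine integral_congr_ae (.of_forall fun β => ?_)
      simp only [bergmanKernel]
      have e1 : (Complex.I * (1 / (2 * h) : ℝ) : ℂ) = Complex.I / (2 * h) := by push_cast; ring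
      have e2 : ((1 / (4 * h) : ℝ) : ℂ) = 1 / (4 * h) := by push_cast; ring
      have e3 : (((2 * Real.pi * h) ^ n)⁻¹ : ℝ) =
          (Real.pi ^ n)⁻¹ * (1 / (4 * h) + 1 / (4 * h)) ^ n := by
        rw [← inv_pow, ← inv_pow, ← mul_pow]
        congr 1
        field_simp
        norm_num
      rw [e1, e2, e3]
      push_cast
      ring
    have h3 := integral_smul_gaussian_average (h := h) w hψ.continuous hc hk (hpos.trans_le hle)
    have h4 : ∫ α, (ψ α : ℂ) * W α = (Real.pi ^ n : ℂ)⁻¹ * (((δ k ^ 2)⁻¹ : ℝ) : ℂ) ^ n *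
        ∫ α, (ψ α : ℂ) * ∫ β, w β * quadExp (Complex.I * (1 / (2 * h) : ℝ))
          ((δ k ^ 2)⁻¹ - 1 / (4 * h) : ℝ) ((δ k ^ 2)⁻¹ - 1 / (4 * h) : ℝ) α β := by
      rw [← integral_const_mul]
      refine integral_congr_ae ?_
      filter_upwards [hW] with α hα
      rw [hα]
      ring
    rw [h4, h3]
    have hk' : (δ k : ℂ) ≠ 0 := by exact_mod_cast hk.ne'
    have hp' : (Real.pi : ℂ) ≠ 0 := by exact_mod_cast hpi.ne'
    push_cast
    rw [pow_mul, inv_pow]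
    field_simp
  simp only [hconst] at hlim
  have heq := tendsto_nhds_unique tendsto_const_nhds hlim
  have hp' : (Real.pi ^ n : ℂ) ≠ 0 := by
    have : (Real.pi : ℂ) ≠ 0 := by exact_mod_cast hpi.ne'
    exact pow_ne_zero _ this
  have := mul_left_cancel₀ hp' heq
  simp only [Complex.real_smul]
  rw [this]
  simp only [mul_comm]

theorem range_fbiTransform {h : ℝ} (hh : 0 < h) :
    LinearMap.range (fbiTransform (n := n) hh).toLinearMap = fbiSpace n h := by
  ext w
  constructor
  · rintro ⟨u, rfl⟩
    exact fbiTransform_mem_fbiSpace hh u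
  · exact fun hw => ⟨_, fbiTransform_adjoint_of_mem hh hw⟩

end Reproducing

instance instIsNegInvariantPhaseSpace (n : ℕ) :
    (volume : Measure (PhaseSpace n)).IsNegInvariant where
  neg_eq_self := by
    have h := Measure.map_prod_map (volume : Measure (EuclideanSpace ℝ (Fin n)))
      (volume : Measure (EuclideanSpace ℝ (Fin n))) measurable_neg measurable_neg
    have h2 := Measure.neg_eq_self (volume : Measure (EuclideanSpace ℝ (Fin n)))
    rw [Measure.neg] at h2
    rw [show (Neg.neg : EuclideanSpace ℝ (Fin n) → _) = Neg.neg from rfl, h2] at h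
    exact h.symm

/-! ### The Schur test for convolution kernels. -/

section Young

variable {n : ℕ}

theorem le_mul_of_forall_le_weighted {x M a b : ℝ} (hM : 0 ≤ M) (ha : 0 ≤ a) (hb : 0 ≤ b)
    (hx : ∀ s : ℝ, 0 < s → x ≤ M * ((s * a ^ 2 + s⁻¹ * b ^ 2) / 2)) : x ≤ M * a * b := by
  have key : ∀ ε : ℝ, 0 < ε → x ≤ M * (a * b + ε * (a + b) / 2) := by
    intro ε hε
    -- The optimal s is b/a; the shift by ε keeps it positive and finite when a or b vanishes.
    refine (hx ((b + ε) / (a + ε)) (by positivity)).trans ?_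
    refine mul_le_mul_of_nonneg_left ?_ hM
    have h1 : (b + ε) / (a + ε) * a ^ 2 ≤ (b + ε) * a := by
      rw [div_mul_eq_mul_div, div_le_iff₀ (by positivity)]
      nlinarith [mul_nonneg (mul_nonneg (add_nonneg hb hε.le) ha) hε.le]
    have h2 : ((b + ε) / (a + ε))⁻¹ * b ^ 2 ≤ (a + ε) * b := by
      rw [inv_div, div_mul_eq_mul_div, div_le_iff₀ (by positivity)]
      nlinarith [mul_nonneg (mul_nonneg (add_nonneg ha hε.le) hb) hε.le]
    linarith
  have hlim : Filter.Tendsto (fun ε : ℝ => M * (a * b + ε * (a + b) / 2))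
      (nhdsWithin 0 (Set.Ioi 0)) (nhds (M * a * b)) := by
    have hc : Continuous fun ε : ℝ => M * (a * b + ε * (a + b) / 2) := by fun_prop
    have := (hc.tendsto 0).mono_left (nhdsWithin_le_nhds (s := Set.Ioi 0))
    convert this using 2
    ring
  refine ge_of_tendsto hlim ?_
  filter_upwards [self_mem_nhdsWithin] with ε hε using key ε hε

/-- Bound ‖U‖‖V‖ by (s‖U‖² + s⁻¹‖V‖²)/2 pointwise. Each term is then a convolution with m or its
reflection, of known integral, and optimising over s gives the product of the norms. -/
theorem integrable_convolution_kernel {m : PhaseSpace n → ℝ} (hm : Integrable m)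
    (hm0 : ∀ γ, 0 ≤ m γ) (U V : L2Phase n) :
    Integrable (fun q : PhaseSpace n × PhaseSpace n => m (q.1 - q.2) * (‖U q.2‖ * ‖V q.1‖))
      (volume.prod volume) ∧
    ∫ q : PhaseSpace n × PhaseSpace n, m (q.1 - q.2) * (‖U q.2‖ * ‖V q.1‖)
      ∂(volume.prod volume) ≤ (∫ γ, m γ) * ‖U‖ * ‖V‖ := by
  have hsq : ∀ W : L2Phase n, Integrable fun α => ‖W α‖ ^ 2 := fun W =>
    (memLp_two_iff_integrable_sq_norm (Lp.aestronglyMeasurable W)).1 (Lp.memLp W)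
  have h1 := (hsq U).convolution_integrand (ContinuousLinearMap.mul ℝ ℝ) hm
  have h2' := ((hsq V).convolution_integrand (ContinuousLinearMap.mul ℝ ℝ) hm.comp_neg).swap
  simp only [Function.comp_def, Prod.fst_swap, Prod.snd_swap, neg_sub,
    ContinuousLinearMap.mul_apply'] at h1 h2'
  have e1 : ∫ q : PhaseSpace n × PhaseSpace n, ‖U q.2‖ ^ 2 * m (q.1 - q.2)
      ∂(volume.prod volume) = (∫ γ, m γ) * ‖U‖ ^ 2 := by
    rw [integral_prod _ h1]
    have := integral_convolution (ContinuousLinearMap.mul ℝ ℝ) (hsq U) hm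
    simp only [convolution, ContinuousLinearMap.mul_apply'] at this
    rw [this, norm_sq_Lp_two, mul_comm]
  have e2 : ∫ q : PhaseSpace n × PhaseSpace n, ‖V q.1‖ ^ 2 * m (q.1 - q.2)
      ∂(volume.prod volume) = (∫ γ, m γ) * ‖V‖ ^ 2 := by
    rw [integral_prod_symm _ h2']
    have := integral_convolution (ContinuousLinearMap.mul ℝ ℝ) (hsq V) hm.comp_neg
    simp only [convolution, ContinuousLinearMap.mul_apply', neg_sub] at this
    rw [this, norm_sq_Lp_two, mul_comm]
    congr 1
    exact integral_neg_eq_self m volume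
  have hbd : ∀ s : ℝ, 0 < s → ∀ q : PhaseSpace n × PhaseSpace n,
      m (q.1 - q.2) * (‖U q.2‖ * ‖V q.1‖) ≤
        (s / 2) * (‖U q.2‖ ^ 2 * m (q.1 - q.2)) + (s⁻¹ / 2) * (‖V q.1‖ ^ 2 * m (q.1 - q.2)) := by
    intro s hs q
    have h3 : ‖U q.2‖ * ‖V q.1‖ ≤ s / 2 * ‖U q.2‖ ^ 2 + s⁻¹ / 2 * ‖V q.1‖ ^ 2 := by
      have h4 : s * (s⁻¹ * ‖V q.1‖) = ‖V q.1‖ := mul_inv_cancel_left₀ hs.ne' _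
      have h5 := mul_nonneg hs.le (sq_nonneg (‖U q.2‖ - s⁻¹ * ‖V q.1‖))
      have h6 : s * (s⁻¹ * ‖V q.1‖) ^ 2 = s⁻¹ * ‖V q.1‖ ^ 2 := by field_simp
      have h7 : s * (‖U q.2‖ - s⁻¹ * ‖V q.1‖) ^ 2 = s * ‖U q.2‖ ^ 2
          - 2 * ‖U q.2‖ * (s * (s⁻¹ * ‖V q.1‖)) + s * (s⁻¹ * ‖V q.1‖) ^ 2 := by ring
      rw [h7, h4, h6] at h5
      linarith
    have := mul_le_mul_of_nonneg_left h3 (hm0 (q.1 - q.2))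
    linarith
  have hint : Integrable (fun q : PhaseSpace n × PhaseSpace n =>
      m (q.1 - q.2) * (‖U q.2‖ * ‖V q.1‖)) (volume.prod volume) := by
    refine ((h1.const_mul (1 / 2)).add (h2'.const_mul (1⁻¹ / 2))).mono' ?_
      (.of_forall fun q => ?_)
    · have hmm : AEStronglyMeasurable (fun q : PhaseSpace n × PhaseSpace n => m (q.1 - q.2))
          (volume.prod volume) := hm.aestronglyMeasurable.comp_quasiMeasurePreserving
            (quasiMeasurePreserving_sub_of_right_invariant volume volume)
      exact hmm.mul ((Lp.aestronglyMeasurable U).comp_snd.norm.mul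
        (Lp.aestronglyMeasurable V).comp_fst.norm)
    · rw [Real.norm_of_nonneg (mul_nonneg (hm0 _) (by positivity))]
      exact hbd 1 one_pos q
  refine ⟨hint, le_mul_of_forall_le_weighted (integral_nonneg hm0) (norm_nonneg _) (norm_nonneg _)
    fun s hs => ?_⟩
  refine (integral_mono hint ((h1.const_mul (s / 2)).add (h2'.const_mul (s⁻¹ / 2)))
    (hbd s hs)).trans ?_
  simp only [Pi.add_apply]
  rw [integral_add (h1.const_mul (s / 2)) (h2'.const_mul (s⁻¹ / 2)), integral_const_mul,
    integral_const_mul, e1, e2]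
  apply le_of_eq
  ring

/-- Pair F with itself in the bilinear bound and cancel one factor ‖F‖. -/
theorem norm_le_of_norm_le_convolution {m : PhaseSpace n → ℝ} (hm : Integrable m)
    (hm0 : ∀ γ, 0 ≤ m γ) (F U : L2Phase n)
    (hF : ∀ᵐ α, ‖F α‖ ≤ ∫ β, m (α - β) * ‖U β‖) : ‖F‖ ≤ (∫ γ, m γ) * ‖U‖ := by
  obtain ⟨h1, h2⟩ := integrable_convolution_kernel hm hm0 U F
  have h3 : ‖F‖ ^ 2 ≤ (∫ γ, m γ) * ‖U‖ * ‖F‖ := by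
    refine le_trans ?_ h2
    rw [norm_sq_Lp_two, integral_prod _ h1]
    refine integral_mono_ae
      ((memLp_two_iff_integrable_sq_norm (Lp.aestronglyMeasurable F)).1 (Lp.memLp F))
      h1.integral_prod_left ?_
    filter_upwards [hF] with α hα
    simp only [← mul_assoc]
    rw [integral_mul_const, sq]
    exact mul_le_mul_of_nonneg_right hα (norm_nonneg _)
  rcases (norm_nonneg F).eq_or_lt with h | h
  · rw [← h]
    exact mul_nonneg (integral_nonneg hm0) (norm_nonneg _)
  · rw [sq] at h3
    exact le_of_mul_le_mul_right h3 h

end Young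

/-! ### Multiplication by p almost preserves ℋ, up to √h. -/

section Commutator

variable {n : ℕ}

theorem mulOp_ae {p : PhaseSpace n → ℂ} (hp : MemLp p ∞ (volume : Measure (PhaseSpace n)))
    (w : L2Phase n) : mulOp p hp w =ᵐ[volume] fun α => p α * w α := by
  have h1 := ContinuousLinearMap.coeFn_holder (r := 2) (ContinuousLinearMap.mul ℂ ℂ) hp.toLp w
  filter_upwards [h1, hp.coeFn_toLp] with α h2 h3
  change (ContinuousLinearMap.mul ℂ ℂ).holder 2 hp.toLp w α = _
  rw [h2, h3]
  rfl

theorem memLp_bergmanKernel {h : ℝ} (hh : 0 < h) (α : PhaseSpace n) :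
    MemLp (bergmanKernel h α) 2 volume := by
  have h1 := memLp_mul_quadExp (Function.HasTemperateGrowth.const
    ((((2 * Real.pi * h) ^ n)⁻¹ : ℝ) : ℂ)) (μ := 1 / (4 * h)) (by positivity) (1 / (2 * h)) α
  convert h1 using 1
  funext β
  rw [bergmanKernel]
  congr 2 <;> push_cast <;> ring

theorem IsSymbolBoundedBy.norm_sub_le {B : ℕ → ℝ} {p : PhaseSpace n → ℂ}
    (hp : IsSymbolBoundedBy B p) (α β : PhaseSpace n) : ‖p α - p β‖ ≤ B 1 * ‖α - β‖ := by
  refine Convex.norm_image_sub_le_of_norm_fderiv_le (𝕜 := ℝ) (s := Set.univ)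
    (fun x _ => hp.smooth.contDiffAt.differentiableAt (by simp)) (fun x _ => ?_) convex_univ
    trivial trivial
  rw [← norm_iteratedFDeriv_one]
  exact hp.bound 1 x

theorem integral_phaseSpace_comp_sqrt_smul {h : ℝ} (hh : 0 < h) {F : Type*}
    [NormedAddCommGroup F] [NormedSpace ℝ F] (f : PhaseSpace n → F) :
    ∫ γ, f γ = h ^ n • ∫ γ, f (√h • γ) := by
  rw [Measure.integral_comp_smul, finrank_phaseSpace, pow_mul, Real.sq_sqrt hh.le,
    abs_of_pos (by positivity), smul_inv_smul₀ (by positivity)]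

theorem distSq_zero_smul (δ : ℝ) (γ : PhaseSpace n) : distSq 0 (δ • γ) = δ ^ 2 * distSq 0 γ := by
  simp only [distSq, Prod.fst_zero, Prod.snd_zero, zero_sub, norm_neg, Prod.smul_fst,
    Prod.smul_snd, norm_smul, mul_pow, Real.norm_eq_abs, sq_abs]
  ring

theorem integrable_norm_mul_exp_distSq {μ : ℝ} (hμ : 0 < μ) :
    Integrable (fun γ : PhaseSpace n => ‖γ‖ * Real.exp (-μ * distSq 0 γ)) := by
  refine (integrable_one_add_norm_pow_mul_exp_distSq 1 hμ).mono' ?_ (.of_forall fun γ => ?_)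
  · refine Continuous.aestronglyMeasurable ?_
    unfold distSq
    fun_prop
  · rw [Real.norm_of_nonneg (by positivity), pow_one]
    gcongr
    linarith

theorem norm_sq_le_distSq (γ : PhaseSpace n) : ‖γ‖ ^ 2 ≤ distSq 0 γ := by
  simp only [distSq, Prod.fst_zero, Prod.snd_zero, zero_sub, norm_neg]
  rw [Prod.norm_def]
  rcases max_cases ‖γ.1‖ ‖γ.2‖ with ⟨h, _⟩ | ⟨h, _⟩ <;> rw [h] <;>
    nlinarith [sq_nonneg ‖γ.1‖, sq_nonneg ‖γ.2‖]

/-- Since w reproduces itself, pw - TT*(pw) has kernel K(α,β)(p(α) - p(β)). The Lipschitz bound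
inserts B 1 ‖α - β‖, and rescaling the Gaussian by √h makes this factor contribute √h while h^n
cancels the size of K. -/
theorem norm_mulOp_sub_proj_le {h : ℝ} (hh : 0 < h) {B : ℕ → ℝ} {p : PhaseSpace n → ℂ}
    (hp : IsSymbolBoundedBy B p) {w : L2Phase n} (hw : w ∈ fbiSpace n h) :
    ‖mulOp p hp.memLp_top w - fbiTransform hh (ContinuousLinearMap.adjoint
      (fbiTransform hh).toContinuousLinearMap (mulOp p hp.memLp_top w))‖ ≤
    ((2 * Real.pi) ^ n)⁻¹ * B 1 * (∫ γ : PhaseSpace n, ‖γ‖ * Real.exp (-(1 / 4) * distSq 0 γ))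
      * √h * ‖w‖ := by
  have hpi := Real.pi_pos
  have hB1 : 0 ≤ B 1 := (norm_nonneg _).trans (hp.bound 1 0)
  set m : PhaseSpace n → ℝ := fun γ => ((2 * Real.pi * h) ^ n)⁻¹ * B 1 *
    (‖γ‖ * Real.exp (-(1 / (4 * h)) * distSq 0 γ))
  have hm : Integrable m := (integrable_norm_mul_exp_distSq (by positivity)).const_mul _
  have hm0 : ∀ γ, 0 ≤ m γ := fun γ => by positivity
  have hmi : ∫ γ, m γ = ((2 * Real.pi) ^ n)⁻¹ * B 1 *
      (∫ γ : PhaseSpace n, ‖γ‖ * Real.exp (-(1 / 4) * distSq 0 γ)) * √h := by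
    simp only [m]
    rw [integral_const_mul, integral_phaseSpace_comp_sqrt_smul hh]
    have e : ∀ γ : PhaseSpace n, ‖√h • γ‖ * Real.exp (-(1 / (4 * h)) * distSq 0 (√h • γ)) =
        √h * (‖γ‖ * Real.exp (-(1 / 4) * distSq 0 γ)) := by
      intro γ
      rw [distSq_zero_smul, Real.sq_sqrt hh.le, norm_smul, Real.norm_of_nonneg (Real.sqrt_nonneg h),
        mul_assoc]
      have : -(1 / (4 * h)) * (h * distSq 0 γ) = -(1 / 4) * distSq 0 γ := by field_simp
      rw [this]
    simp only [e]
    rw [integral_const_mul, smul_eq_mul, mul_pow]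
    field_simp
  rw [← hmi]
  refine norm_le_of_norm_le_convolution hm hm0 _ w ?_
  have hrep := fbiTransform_adjoint_ae hh w
  rw [fbiTransform_adjoint_of_mem hh hw] at hrep
  filter_upwards [hrep, fbiTransform_adjoint_ae hh (mulOp p hp.memLp_top w),
    mulOp_ae hp.memLp_top w, Lp.coeFn_sub (mulOp p hp.memLp_top w) (fbiTransform hh
      (ContinuousLinearMap.adjoint (fbiTransform hh).toContinuousLinearMap
        (mulOp p hp.memLp_top w)))] with α h1 h2 h3 h4
  have e2 : ∫ β, bergmanKernel h α β * mulOp p hp.memLp_top w β =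
      ∫ β, bergmanKernel h α β * (p β * w β) := by
    refine integral_congr_ae ?_
    filter_upwards [mulOp_ae hp.memLp_top w] with β hβ
    rw [hβ]
  have hk := memLp_bergmanKernel hh α
  have i1 : Integrable fun β => bergmanKernel h α β * w β := hk.integrable_mul (Lp.memLp w)
  have i2 : Integrable fun β => bergmanKernel h α β * (p β * w β) := by
    refine (hk.integrable_mul (Lp.memLp (mulOp p hp.memLp_top w))).congr ?_
    filter_upwards [mulOp_ae hp.memLp_top w] with β hβ
    rw [Pi.mul_apply, hβ]
  rw [h4, Pi.sub_apply, h3, h2, h1, e2, ← integral_const_mul,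
    ← integral_sub (i1.const_mul _) i2]
  have i3 : Integrable fun β => m (α - β) * ‖w β‖ := by
    have hml : MemLp (fun β => m (α - β)) 2 volume := by
      have := memLp_mul_quadExp (hasTemperateGrowth_distSq α) (μ := 1 / (4 * h))
        (by positivity) 0 α
      have h0 := memLp_mul_quadExp (Function.HasTemperateGrowth.const (1 : ℂ)) (μ := 1 / (4 * h))
        (by positivity) 0 α
      simp only [one_mul] at h0
      refine ((this.norm.add h0.norm).const_mul (((2 * Real.pi * h) ^ n)⁻¹ * B 1)).of_le ?_
        (.of_forall fun β => ?_)
      · refine Continuous.aestronglyMeasurable ?_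
        simp only [m]
        unfold distSq
        fun_prop
      -- This replaces the non-smooth norm by a polynomial, so that square integrability follows
      -- from that of Gaussians with polynomial factors.
      · have h5 : ‖α - β‖ ≤ distSq 0 (α - β) + 1 := by
          nlinarith [norm_sq_le_distSq (α - β), sq_nonneg (‖α - β‖ - 1 / 2)]
        refine le_trans ?_ (le_abs_self _)
        rw [Real.norm_of_nonneg (hm0 _), Pi.add_apply, norm_mul,
          norm_quadExp_distSq, Complex.norm_real,
          Real.norm_of_nonneg (distSq_nonneg _ _), ← distSq_zero_sub]
        simp only [m]
        rw [← add_one_mul]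
        gcongr
    exact hml.integrable_mul (Lp.memLp w).norm
  refine norm_integral_le_of_norm_le i3 (.of_forall fun β => ?_)
  rw [show p α * (bergmanKernel h α β * w β) - bergmanKernel h α β * (p β * w β) =
    bergmanKernel h α β * (p α - p β) * w β by ring, norm_mul, norm_mul, norm_bergmanKernel hh]
  refine mul_le_mul_of_nonneg_right ?_ (norm_nonneg _)
  have e3 : -(1 / (4 * h)) * ‖α.1 - β.1‖ ^ 2 - 1 / (4 * h) * ‖α.2 - β.2‖ ^ 2 =
      -(1 / (4 * h)) * distSq 0 (α - β) := by
    rw [distSq_zero_sub, distSq]; ring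
  rw [e3]
  calc _ ≤ ((2 * Real.pi * h) ^ n)⁻¹ * Real.exp (-(1 / (4 * h)) * distSq 0 (α - β)) *
        (B 1 * ‖α - β‖) := by
        gcongr
        exact hp.norm_sub_le α β
    _ = m (α - β) := by ring

end Commutator

/-! ### Wave packets on the Fourier side and integrability of Tu. -/

section WavePacketDecomposition

open scoped FourierTransform ComplexConjugate

variable {n : ℕ}

/-- The semiclassical Fourier transform `ξ ↦ ∫ exp(-(i/h)⟨y, ξ⟩) u(y) dy`. -/
noncomputable def planckFourier (h : ℝ) (u : EuclideanSpace ℝ (Fin n) → ℂ)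
    (ξ : EuclideanSpace ℝ (Fin n)) : ℂ := 𝓕 u ((2 * Real.pi * h)⁻¹ • ξ)

theorem planckFourier_eq {h : ℝ} (hh : 0 < h) (u : EuclideanSpace ℝ (Fin n) → ℂ)
    (ξ : EuclideanSpace ℝ (Fin n)) :
    planckFourier h u ξ = ∫ y, Complex.exp (-(Complex.I / h) * (inner ℝ y ξ : ℝ)) * u y := by
  rw [planckFourier, Real.fourier_eq']
  refine integral_congr_ae (.of_forall fun y => ?_)
  have := Real.pi_pos
  simp only [inner_smul_right, smul_eq_mul]
  congr 2
  push_cast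
  have h1 : (Real.pi : ℂ) ≠ 0 := by exact_mod_cast this.ne'
  have h2 : (h : ℂ) ≠ 0 := by exact_mod_cast hh.ne'
  field_simp

theorem integrable_planckFourier {h : ℝ} (hh : 0 < h) (u : 𝓢(EuclideanSpace ℝ (Fin n), ℂ)) :
    Integrable (planckFourier h u) := by
  have := Real.pi_pos
  refine (Integrable.comp_smul (f := fun ξ => (𝓕 u) ξ) (𝓕 u).integrable
    (R := (2 * Real.pi * h)⁻¹) (by positivity)).congr
    (.of_forall fun ξ => ?_)
  simp only [planckFourier, SchwartzMap.fourier_coe]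

theorem continuous_planckFourier (h : ℝ) (u : 𝓢(EuclideanSpace ℝ (Fin n), ℂ)) :
    Continuous (planckFourier h u) := by
  have : planckFourier h u = fun ξ => (𝓕 u) ((2 * Real.pi * h)⁻¹ • ξ) := by
    ext ξ
    simp only [planckFourier, SchwartzMap.fourier_coe]
  rw [this]
  fun_prop

/-- The semiclassical Fourier transform of a wave packet. -/
noncomputable def packetFourier (h : ℝ) (β : PhaseSpace n) (ξ : EuclideanSpace ℝ (Fin n)) : ℂ :=
  ((fbiNorm n h * (2 * Real.pi * h) ^ ((n : ℝ) / 2) : ℝ) : ℂ) *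
    Complex.exp (-(Complex.I / h) * (inner ℝ β.1 ξ : ℝ)
        - (‖ξ - β.2‖ ^ 2 : ℝ) / (2 * h))

theorem continuous_packetFourier_uncurry (h : ℝ) :
    Continuous fun q : PhaseSpace n × EuclideanSpace ℝ (Fin n) => packetFourier h q.1 q.2 := by
  unfold packetFourier
  fun_prop

theorem norm_packetFourier {h : ℝ} (hh : 0 < h) (β : PhaseSpace n)
    (ξ : EuclideanSpace ℝ (Fin n)) :
    ‖packetFourier h β ξ‖ = fbiNorm n h * (2 * Real.pi * h) ^ ((n : ℝ) / 2) *
      Real.exp (-(1 / (2 * h)) * ‖ξ - β.2‖ ^ 2) := by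
  have h1 := fbiNorm_pos n hh
  have := Real.pi_pos
  rw [packetFourier, norm_mul, Complex.norm_exp, Complex.norm_real, Real.norm_eq_abs,
    abs_of_pos (by positivity)]
  congr 2
  have e : -(Complex.I / h) * (inner ℝ β.1 ξ : ℝ) - ((‖ξ - β.2‖ ^ 2 : ℝ) : ℂ) / (2 * h)
      = ((-(1 / (2 * h)) * ‖ξ - β.2‖ ^ 2 : ℝ) : ℂ)
        + ((-(1 / h) * inner ℝ β.1 ξ : ℝ) : ℂ) * Complex.I := by
    push_cast
    ring
  rw [e, Complex.add_re, Complex.ofReal_re, Complex.re_ofReal_mul, Complex.I_re, mul_zero,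
    add_zero]

theorem planckFourier_wavePacket {h : ℝ} (hh : 0 < h) (β : PhaseSpace n)
    (ξ : EuclideanSpace ℝ (Fin n)) :
    planckFourier h (wavePacket h β) ξ = packetFourier h β ξ := by
  have hpi := Real.pi_pos
  rw [planckFourier_eq hh, ← integral_add_left_eq_self _ β.1]
  have e : ∀ v : EuclideanSpace ℝ (Fin n),
      Complex.exp (-(Complex.I / h) * (inner ℝ (β.1 + v) ξ : ℝ)) * wavePacket h β (β.1 + v)
      = (fbiNorm n h : ℂ) * Complex.exp (-(Complex.I / h) * (inner ℝ β.1 ξ : ℝ)) *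
        Complex.exp (-((1 / (2 * h) : ℝ) : ℂ) * ‖v‖ ^ 2
          + (Complex.I / h) * (inner ℝ (β.2 - ξ) v : ℝ)) := by
    intro v
    rw [wavePacket, mul_left_comm, mul_assoc, ← Complex.exp_add, ← Complex.exp_add]
    congr 2
    simp only [sub_add_cancel_left, inner_neg_left, norm_neg, inner_add_left, inner_sub_left]
    rw [real_inner_comm v β.2, real_inner_comm v ξ]
    push_cast
    ring
  simp only [e]
  rw [integral_const_mul, integral_cexp_neg_mul_sq_norm_add_inner (by positivity), packetFourier,
    sub_eq_add_neg (-(Complex.I / h) * ((inner ℝ β.1 ξ : ℝ) : ℂ)), Complex.exp_add]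
  have h2 : Real.pi / (1 / (2 * h)) = 2 * Real.pi * h := by field_simp
  have h3 : (Complex.I / h) ^ 2 * ‖β.2 - ξ‖ ^ 2 / (4 * (1 / (2 * h) : ℝ))
      = -((‖ξ - β.2‖ ^ 2 : ℝ) / (2 * h)) := by
    have h4 : (h : ℂ) ≠ 0 := by exact_mod_cast hh.ne'
    rw [norm_sub_rev, div_pow, Complex.I_sq]
    push_cast
    field_simp
    ring
  rw [h2, h3]
  push_cast
  ring

theorem planckFourier_schwartz (h : ℝ) (u : 𝓢(EuclideanSpace ℝ (Fin n), ℂ))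
    (ξ : EuclideanSpace ℝ (Fin n)) :
    planckFourier h u ξ = (𝓕 u) ((2 * Real.pi * h)⁻¹ • ξ) := by
  simp only [planckFourier, SchwartzMap.fourier_coe]

/-- Parseval. On the Fourier side the packet is a Gaussian centred at the momentum β.2, which makes
decay in ξ visible just as the original formula shows decay in x. -/
theorem fbiFun_eq_integral_planckFourier {h : ℝ} (hh : 0 < h)
    (u : 𝓢(EuclideanSpace ℝ (Fin n), ℂ)) (β : PhaseSpace n) :
    fbiFun h u β = ((2 * Real.pi * h) ^ n : ℝ)⁻¹ *
      ∫ ξ, conj (packetFourier h β ξ) * planckFourier h u ξ := by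
  have hpi := Real.pi_pos
  have h1 := SchwartzMap.integral_inner_fourier_fourier (wavePacketS hh β) u
  have h2 := integral_comp_inv_planck_smul hh fun η : EuclideanSpace ℝ (Fin n) =>
    inner ℂ ((𝓕 (wavePacketS hh β)) η) ((𝓕 u) η)
  have h4 : ⇑(wavePacketS hh β) = wavePacket h β := funext fun y => wavePacketS_apply hh β y
  have h3 : ∀ ξ, inner ℂ ((𝓕 (wavePacketS hh β)) ((2 * Real.pi * h)⁻¹ • ξ))
      ((𝓕 u) ((2 * Real.pi * h)⁻¹ • ξ))
      = conj (packetFourier h β ξ) * planckFourier h u ξ := by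
    intro ξ
    rw [← planckFourier_schwartz, ← planckFourier_schwartz, h4, planckFourier_wavePacket hh,
      RCLike.inner_apply, mul_comm]
  simp only [h3] at h2
  rw [h2, h1, fbiFun_eq, Complex.real_smul, ← mul_assoc, ← Complex.ofReal_mul,
    inv_mul_cancel₀ (by positivity), Complex.ofReal_one, one_mul]
  refine integral_congr_ae (.of_forall fun y => ?_)
  simp only [wavePacketS_apply, RCLike.inner_apply, mul_comm]

theorem exists_integral_exp_mul_norm_le (f : 𝓢(EuclideanSpace ℝ (Fin n), ℂ)) {b : ℝ} (hb : 0 < b)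
    (N : ℕ) : ∃ C, 0 ≤ C ∧ ∀ x, ∫ y, Real.exp (-b * ‖x - y‖ ^ 2) * ‖f y‖ ≤
      C * ((1 + ‖x‖) ^ N)⁻¹ := by
  have hI := f.integrable_one_add_norm_pow_mul (μ := volume) N 0
  simp only [norm_iteratedFDeriv_zero] at hI
  obtain ⟨g, hg⟩ := exists_schwartz_gaussian (n := n) (h := 1 / (2 * b)) (by positivity) 0
  obtain ⟨M, hM⟩ : ∃ M, ∀ z : EuclideanSpace ℝ (Fin n),
      (1 + ‖z‖) ^ N * Real.exp (-b * ‖z‖ ^ 2) ≤ M := by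
    refine ⟨2 ^ (N, 0).1 * ((Finset.Iic (N, 0)).sup
      fun m => SchwartzMap.seminorm ℝ m.1 m.2) g, fun z => ?_⟩
    have := g.one_add_le_sup_seminorm_apply (𝕜 := ℝ) (m := (N, 0)) (k := N) (n := 0) le_rfl le_rfl z
    rw [norm_iteratedFDeriv_zero, hg] at this
    refine le_trans (le_of_eq ?_) this
    rw [Complex.norm_real, Real.norm_eq_abs, Real.abs_exp, zero_sub, norm_neg]
    congr 3
    field_simp
  have hM0 : 0 ≤ M := le_trans (by positivity) (hM 0)
  refine ⟨M * ∫ y, (1 + ‖y‖) ^ N * ‖f y‖, by positivity, fun x => ?_⟩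
  rw [mul_assoc, mul_comm _ ((1 + ‖x‖) ^ N)⁻¹, ← integral_const_mul, ← integral_const_mul]
  refine integral_mono_of_nonneg (.of_forall fun y => by positivity)
    ((hI.const_mul _).const_mul _) (.of_forall fun y => ?_)
  have h1 : (1 + ‖x‖) ^ N ≤ (1 + ‖x - y‖) ^ N * (1 + ‖y‖) ^ N := by
    rw [← mul_pow]
    have := norm_add_le (x - y) y
    rw [sub_add_cancel] at this
    refine pow_le_pow_left₀ (by positivity) ?_ N
    nlinarith [norm_nonneg (x - y), norm_nonneg y]
  have h2 : Real.exp (-b * ‖x - y‖ ^ 2) ≤ M * ((1 + ‖x‖) ^ N)⁻¹ * (1 + ‖y‖) ^ N := by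
    have h3 : (1 + ‖x‖) ^ N * Real.exp (-b * ‖x - y‖ ^ 2) ≤ M * (1 + ‖y‖) ^ N := by
      calc _ ≤ (1 + ‖x - y‖) ^ N * (1 + ‖y‖) ^ N * Real.exp (-b * ‖x - y‖ ^ 2) :=
            mul_le_mul_of_nonneg_right h1 (Real.exp_nonneg _)
        _ = ((1 + ‖x - y‖) ^ N * Real.exp (-b * ‖x - y‖ ^ 2)) * (1 + ‖y‖) ^ N := by ring
        _ ≤ _ := mul_le_mul_of_nonneg_right (hM _) (by positivity)
    rw [mul_right_comm, ← div_eq_mul_inv, le_div_iff₀ (by positivity), mul_comm]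
    exact h3
  calc _ ≤ M * ((1 + ‖x‖) ^ N)⁻¹ * (1 + ‖y‖) ^ N * ‖f y‖ :=
        mul_le_mul_of_nonneg_right h2 (norm_nonneg _)
    _ = _ := by ring

/-- Decay in x and decay in ξ are obtained separately; the geometric mean of the two bounds decays
in both. The exponents 2(n+1) leave n + 1 > n in each variable after the square root. -/
theorem integrable_fbiFun {h : ℝ} (hh : 0 < h) (u : 𝓢(EuclideanSpace ℝ (Fin n), ℂ)) :
    Integrable (fbiFun h u) := by
  have hpi := Real.pi_pos
  have hC := fbiNorm_pos n hh
  have hb : 0 < 1 / (2 * h) := by positivity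
  obtain ⟨A, hA0, hA⟩ := exists_integral_exp_mul_norm_le u hb (2 * (n + 1))
  obtain ⟨f, hf⟩ : ∃ f : 𝓢(EuclideanSpace ℝ (Fin n), ℂ), ∀ ξ, f ξ = planckFourier h u ξ := by
    refine ⟨SchwartzMap.compCLMOfContinuousLinearEquiv ℂ
      (ContinuousLinearEquiv.smulLeft (Units.mk0 ((2 * Real.pi * h)⁻¹) (by positivity))) (𝓕 u),
      fun ξ => ?_⟩
    rw [planckFourier_schwartz]
    rfl
  obtain ⟨A', hA'0, hA'⟩ := exists_integral_exp_mul_norm_le f hb (2 * (n + 1))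
  have hx : ∀ α : PhaseSpace n, ‖fbiFun h u α‖ ≤
      (fbiNorm n h * A) * ((1 + ‖α.1‖) ^ (2 * (n + 1)))⁻¹ := by
    intro α
    rw [fbiFun_eq]
    refine (norm_integral_le_integral_norm _).trans ?_
    simp only [norm_mul, RCLike.norm_conj, norm_wavePacket hh, mul_assoc]
    rw [integral_const_mul]
    exact mul_le_mul_of_nonneg_left (hA _) hC.le
  set D := ((2 * Real.pi * h) ^ n)⁻¹ * (fbiNorm n h * (2 * Real.pi * h) ^ ((n : ℝ) / 2)) with hD
  have hD0 : 0 ≤ D := by positivity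
  have hξ : ∀ α : PhaseSpace n, ‖fbiFun h u α‖ ≤
      (D * A') * ((1 + ‖α.2‖) ^ (2 * (n + 1)))⁻¹ := by
    intro α
    rw [fbiFun_eq_integral_planckFourier hh, norm_mul, Complex.norm_real,
      Real.norm_eq_abs, abs_of_pos (show (0 : ℝ) < ((2 * Real.pi * h) ^ n)⁻¹ by positivity),
      show D * A' * ((1 + ‖α.2‖) ^ (2 * (n + 1)))⁻¹ = ((2 * Real.pi * h) ^ n)⁻¹ *
        ((fbiNorm n h * (2 * Real.pi * h) ^ ((n : ℝ) / 2)) *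
          (A' * ((1 + ‖α.2‖) ^ (2 * (n + 1)))⁻¹)) by rw [hD]; ring]
    refine mul_le_mul_of_nonneg_left ?_ (by positivity)
    refine (norm_integral_le_integral_norm _).trans ?_
    simp only [norm_mul, RCLike.norm_conj, norm_packetFourier hh, ← hf, norm_sub_rev _ α.2]
    simp only [mul_assoc (fbiNorm n h * (2 * Real.pi * h) ^ ((n : ℝ) / 2))]
    rw [integral_const_mul]
    exact mul_le_mul_of_nonneg_left (hA' _) (by positivity)
  have hN := integrable_inv_one_add_norm_pow (V := EuclideanSpace ℝ (Fin n)) (μ := volume)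
    (N := n + 1) (by simp)
  refine ((hN.mul_prod hN).const_mul (√((fbiNorm n h * A) * (D * A')))).mono'
    (aestronglyMeasurable_fbiFun h u.continuous.aestronglyMeasurable) (.of_forall fun α => ?_)
  have e : ‖fbiFun h u α‖ ^ 2 ≤ (fbiNorm n h * A) * (D * A') *
      (((1 + ‖α.1‖) ^ (n + 1))⁻¹ * ((1 + ‖α.2‖) ^ (n + 1))⁻¹) ^ 2 := by
    calc ‖fbiFun h u α‖ ^ 2 ≤ ((fbiNorm n h * A) * ((1 + ‖α.1‖) ^ (2 * (n + 1)))⁻¹) *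
          ((D * A') * ((1 + ‖α.2‖) ^ (2 * (n + 1)))⁻¹) := by
          rw [sq]
          exact mul_le_mul (hx α) (hξ α) (norm_nonneg _) (by positivity)
      _ = _ := by
          rw [pow_mul' (1 + ‖α.1‖), pow_mul' (1 + ‖α.2‖)]
          generalize (1 + ‖α.1‖) ^ (n + 1) = X
          generalize (1 + ‖α.2‖) ^ (n + 1) = Y
          ring
  refine (Real.le_sqrt_of_sq_le e).trans (le_of_eq ?_)
  rw [Real.sqrt_mul (by positivity), Real.sqrt_sq (by positivity)]

end WavePacketDecomposition

/-! ### Decay of oscillatory integrals with uniform constants. -/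

section OscillatoryIntegral

variable {n : ℕ}

/-- The pairing `⟨s, σ⟩ + ⟨t, τ⟩` of `(s, t)` and `(σ, τ)`. -/
noncomputable def phasePairing (n : ℕ) : PhaseSpace n →L[ℝ] PhaseSpace n →L[ℝ] ℝ :=
  (innerSL ℝ).bilinearComp (ContinuousLinearMap.fst ℝ _ _) (ContinuousLinearMap.fst ℝ _ _) +
    (innerSL ℝ).bilinearComp (ContinuousLinearMap.snd ℝ _ _) (ContinuousLinearMap.snd ℝ _ _)

theorem phasePairing_apply (v w : PhaseSpace n) :
    phasePairing n v w = inner ℝ v.1 w.1 + inner ℝ v.2 w.2 := rfl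

/-- Phase space carries the maximum norm, so the larger component of w alone serves as the direction
in which to integrate by parts. -/
theorem exists_norm_and_pairing_eq (w : PhaseSpace n) :
    ∃ v : PhaseSpace n, ‖v‖ = ‖w‖ ∧ phasePairing n v w = ‖w‖ ^ 2 := by
  rcases le_total ‖w.2‖ ‖w.1‖ with hle | hle
  · have hw : ‖w‖ = ‖w.1‖ := by rw [Prod.norm_def, max_eq_left hle]
    refine ⟨(w.1, 0), ?_, ?_⟩
    · rw [hw, Prod.norm_def, norm_zero, max_eq_left (norm_nonneg _)]
    · rw [phasePairing_apply, hw, inner_zero_left, add_zero, real_inner_self_eq_norm_sq]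
  · have hw : ‖w‖ = ‖w.2‖ := by rw [Prod.norm_def, max_eq_right hle]
    refine ⟨(0, w.2), ?_, ?_⟩
    · rw [hw, Prod.norm_def, norm_zero, max_eq_right (norm_nonneg _)]
    · rw [phasePairing_apply, hw, inner_zero_left, zero_add, real_inner_self_eq_norm_sq]

theorem fourierIntegral_phasePairing (f : PhaseSpace n → ℂ) (w : PhaseSpace n) :
    VectorFourier.fourierIntegral Real.fourierChar volume (phasePairing n).toLinearMap₁₂ f
      (-(2 * Real.pi)⁻¹ • w) =
    ∫ γ, f γ * Complex.exp (Complex.I * ((inner ℝ γ.1 w.1 + inner ℝ γ.2 w.2 : ℝ) : ℂ)) := by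
  rw [VectorFourier.fourierIntegral]
  refine integral_congr_ae (.of_forall fun γ => ?_)
  have hpi : (Real.pi : ℂ) ≠ 0 := by exact_mod_cast Real.pi_ne_zero
  have e : ((phasePairing n).toLinearMap₁₂ γ) (-(2 * Real.pi)⁻¹ • w)
      = -(2 * Real.pi)⁻¹ * (inner ℝ γ.1 w.1 + inner ℝ γ.2 w.2) := by
    rw [← phasePairing_apply]
    exact (phasePairing n γ).map_smul _ _
  simp only [e, Circle.smul_def, Real.fourierChar_apply, smul_eq_mul]
  rw [mul_comm]
  congr 2
  push_cast
  field_simp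

theorem norm_iteratedFDeriv_mul_schwartz_le (G : 𝓢(PhaseSpace n, ℂ)) {b : PhaseSpace n → ℂ}
    (hb : ContDiff ℝ ∞ b) {N : ℕ} {A : ℝ}
    (hA : ∀ k ≤ N, ∀ γ, ‖iteratedFDeriv ℝ k b γ‖ ≤ A) {j : ℕ} (hj : j ≤ N) (γ : PhaseSpace n) :
    ‖iteratedFDeriv ℝ j (fun γ => b γ * G γ) γ‖ ≤
      A * ∑ i ∈ Finset.range (j + 1), (j.choose i : ℝ) * ‖iteratedFDeriv ℝ (j - i) G γ‖ := by
  refine (norm_iteratedFDeriv_mul_le (N := ∞) hb (G.smooth ⊤) γ (by exact_mod_cast le_top)).trans ?_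
  rw [Finset.mul_sum]
  refine Finset.sum_le_sum fun i hi => ?_
  calc _ ≤ (j.choose i : ℝ) * A * ‖iteratedFDeriv ℝ (j - i) G γ‖ := by
        refine mul_le_mul_of_nonneg_right (mul_le_mul_of_nonneg_left (hA i ?_ γ)
          (Nat.cast_nonneg _)) (norm_nonneg _)
        exact (Finset.mem_range_succ_iff.1 hi).trans hj
    _ = _ := by ring

/-- Integrating by parts M + 1 times gains ‖w‖^{-(M+1)}. By Leibniz the amplitude enters only
through the bound A on its derivatives, so the constant depends on G and M alone. -/
theorem exists_norm_oscillatory_integral_le (G : 𝓢(PhaseSpace n, ℂ)) (M : ℕ) :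
    ∃ C, 0 ≤ C ∧ ∀ (b : PhaseSpace n → ℂ) (A : ℝ), ContDiff ℝ ∞ b →
      (∀ k ≤ M + 1, ∀ γ, ‖iteratedFDeriv ℝ k b γ‖ ≤ A) → ∀ w : PhaseSpace n,
      ‖∫ γ, (b γ * G γ) *
          Complex.exp (Complex.I * ((inner ℝ γ.1 w.1 + inner ℝ γ.2 w.2 : ℝ) : ℂ))‖ ≤
        C * A * ((1 + ‖w‖) ^ (M + 1))⁻¹ := by
  have hpi := Real.pi_pos
  set c : ℕ → PhaseSpace n → ℝ := fun j γ =>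
    ∑ i ∈ Finset.range (j + 1), (j.choose i : ℝ) * ‖iteratedFDeriv ℝ (j - i) G γ‖ with hc
  have hcI : ∀ j, Integrable (c j) := fun j => integrable_finsetSum _ fun i _ =>
    ((by simpa using G.integrable_one_add_norm_pow_mul (μ := volume) 0 (j - i) :
      Integrable fun γ => ‖iteratedFDeriv ℝ (j - i) G γ‖)).const_mul _
  have hc0 : ∀ j γ, 0 ≤ c j γ := fun j γ => Finset.sum_nonneg fun i _ => by positivity
  set S := ∑ p ∈ Finset.range 1 ×ˢ Finset.range (M + 1 + 1), ∫ γ, c p.2 γ with hS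
  have hS0 : 0 ≤ S := Finset.sum_nonneg fun p _ => integral_nonneg (hc0 _)
  refine ⟨2 ^ (M + 1) * (S + (4 * Real.pi) ^ (M + 1) * S), by positivity, fun b A hb hA w => ?_⟩
  have hA0 : 0 ≤ A := (norm_nonneg _).trans (hA 0 (by omega) 0)
  set f : PhaseSpace n → ℂ := fun γ => b γ * G γ with hf
  have hfs : ContDiff ℝ ∞ f := hb.mul (G.smooth ⊤)
  have hfb : ∀ j ≤ M + 1, ∀ γ, ‖iteratedFDeriv ℝ j f γ‖ ≤ A * c j γ := fun j hj γ =>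
    norm_iteratedFDeriv_mul_schwartz_le G hb hA hj γ
  have hfI : ∀ j ≤ M + 1, Integrable fun γ => ‖iteratedFDeriv ℝ j f γ‖ := fun j hj =>
    ((hcI j).const_mul A).mono'
      (hfs.continuous_iteratedFDeriv (by exact_mod_cast le_top)).norm.aestronglyMeasurable
      (.of_forall fun γ => by rw [norm_norm]; exact hfb j hj γ)
  have hfInt : ∀ j ≤ M + 1, ∫ γ, ‖iteratedFDeriv ℝ j f γ‖ ≤ A * ∫ γ, c j γ := fun j hj => by
    rw [← integral_const_mul]
    exact integral_mono (hfI j hj) ((hcI j).const_mul A) (hfb j hj)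
  -- Only m = 0 and m = M + 1 are used, for small and for large w respectively.
  have key : ∀ (v : PhaseSpace n) (m : ℕ), m ≤ M + 1 →
      |phasePairing n v (-(2 * Real.pi)⁻¹ • w)| ^ m *
        ‖∫ γ, f γ * Complex.exp (Complex.I * ((inner ℝ γ.1 w.1 + inner ℝ γ.2 w.2 : ℝ) : ℂ))‖
      ≤ ‖v‖ ^ m * 2 ^ m * (A * S) := by
    intro v m hm
    have h1 := VectorFourier.pow_mul_norm_iteratedFDeriv_fourierIntegral_le
      (μ := volume) (phasePairing n) (K := 0)
      (N := (M + 1 : ℕ)) (f := f) (hfs.of_le (by exact_mod_cast le_top))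
      (fun k j hk hj => by
        obtain rfl : k = 0 := by simpa using hk
        simpa using hfI j (by exact_mod_cast hj))
      (k := 0) (n := m) (by simp) (by exact_mod_cast hm) v (-(2 * Real.pi)⁻¹ • w)
    rw [norm_iteratedFDeriv_zero, fourierIntegral_phasePairing] at h1
    refine h1.trans ?_
    simp only [pow_zero, mul_one, Nat.cast_zero, mul_zero, zero_add]
    refine mul_le_mul_of_nonneg_left ?_ (by positivity)
    rw [hS, Finset.mul_sum]
    calc _ ≤ ∑ p ∈ Finset.range 1 ×ˢ Finset.range (m + 1), A * ∫ γ, c p.2 γ := by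
          refine Finset.sum_le_sum fun p hp => ?_
          simp only [Finset.mem_product, Finset.mem_range] at hp
          obtain hp1 : p.1 = 0 := by omega
          simp only [hp1, pow_zero, one_mul]
          exact hfInt p.2 (by omega)
      _ ≤ _ := by
          refine Finset.sum_le_sum_of_subset_of_nonneg
            (Finset.product_subset_product_right (Finset.range_mono (by omega))) fun p _ _ => ?_
          exact mul_nonneg hA0 (integral_nonneg (hc0 _))
  set J := ‖∫ γ, f γ *
    Complex.exp (Complex.I * ((inner ℝ γ.1 w.1 + inner ℝ γ.2 w.2 : ℝ) : ℂ))‖ with hJ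
  have hJ0 : J ≤ A * S := by simpa using key 0 0 (by omega)
  have hJw : ‖w‖ ^ (M + 1) * J ≤ (4 * Real.pi) ^ (M + 1) * (A * S) := by
    rcases eq_or_ne w 0 with rfl | hw
    · rw [norm_zero, zero_pow (by omega), zero_mul]
      positivity
    · have hw' : 0 < ‖w‖ := norm_pos_iff.2 hw
      obtain ⟨v, hv1, hv2⟩ := exists_norm_and_pairing_eq w
      have h2 := key v (M + 1) le_rfl
      rw [map_smul, hv1, hv2, smul_eq_mul, abs_mul, abs_neg,
        abs_of_pos (show 0 < (2 * Real.pi)⁻¹ by positivity), abs_of_pos (by positivity), sq,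
        mul_pow, mul_pow] at h2
      have h3 : ‖w‖ ^ (M + 1) * ((2 * Real.pi)⁻¹ ^ (M + 1) * (‖w‖ ^ (M + 1) * J)) ≤
          ‖w‖ ^ (M + 1) * (2 ^ (M + 1) * (A * S)) := by linarith
      have h4 := le_of_mul_le_mul_left h3 (by positivity)
      rw [inv_pow, inv_mul_le_iff₀ (by positivity), ← mul_assoc, ← mul_pow] at h4
      rwa [show 4 * Real.pi = 2 * Real.pi * 2 by ring]
  rw [← div_eq_mul_inv, le_div_iff₀ (by positivity), mul_comm]
  have h5 : (1 + ‖w‖) ^ (M + 1) ≤ 2 ^ (M + 1) * (1 + ‖w‖ ^ (M + 1)) := by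
    rcases le_total ‖w‖ 1 with h | h
    · calc (1 + ‖w‖) ^ (M + 1) ≤ 2 ^ (M + 1) :=
            pow_le_pow_left₀ (by positivity) (by linarith) _
        _ ≤ _ := le_mul_of_one_le_right (by positivity) (by linarith [pow_nonneg (norm_nonneg w) (M + 1)])
    · calc (1 + ‖w‖) ^ (M + 1) ≤ (2 * ‖w‖) ^ (M + 1) :=
            pow_le_pow_left₀ (by positivity) (by linarith) _
        _ ≤ _ := by
            rw [mul_pow]
            exact mul_le_mul_of_nonneg_left (by linarith) (by positivity)
  calc _ ≤ 2 ^ (M + 1) * (1 + ‖w‖ ^ (M + 1)) * J :=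
        mul_le_mul_of_nonneg_right h5 (norm_nonneg _)
    _ = 2 ^ (M + 1) * (J + ‖w‖ ^ (M + 1) * J) := by ring
    _ ≤ 2 ^ (M + 1) * (A * S + (4 * Real.pi) ^ (M + 1) * (A * S)) := by
        exact mul_le_mul_of_nonneg_left (add_le_add hJ0 hJw) (by positivity)
    _ = _ := by ring

/-- Contracting the argument by δ ≤ 1 does not increase derivatives. With δ = √h this is how h ≤ 1
makes the kernel bounds uniform. -/
theorem norm_iteratedFDeriv_comp_affine_le {a : PhaseSpace n → ℂ} (ha : ContDiff ℝ ∞ a) {N : ℕ}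
    {A : ℝ} (hA : ∀ k ≤ N, ∀ γ, ‖iteratedFDeriv ℝ k a γ‖ ≤ A) {δ : ℝ} (hδ : 0 ≤ δ) (hδ1 : δ ≤ 1)
    (γ₀ : PhaseSpace n) {k : ℕ} (hk : k ≤ N) (γ : PhaseSpace n) :
    ‖iteratedFDeriv ℝ k (fun γ => a (γ₀ + δ • γ)) γ‖ ≤ A := by
  have h1 : ContDiff ℝ k fun γ => a (γ₀ + γ) :=
    (ha.comp (contDiff_const.add contDiff_id)).of_le (by exact_mod_cast le_top)
  have h2 := iteratedFDeriv_comp_const_smul (𝕜 := ℝ) (i := k) δ h1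
  have h3 : iteratedFDeriv ℝ k (fun γ => a (γ₀ + δ • γ)) γ =
      δ ^ k • iteratedFDeriv ℝ k (fun γ => a (γ₀ + γ)) (δ • γ) := by
    simpa using congrFun h2 γ
  rw [h3, iteratedFDeriv_comp_add_left, norm_smul, norm_pow, Real.norm_eq_abs, abs_of_nonneg hδ]
  exact (mul_le_of_le_one_left (norm_nonneg _) (pow_le_one₀ hδ hδ1)).trans (hA k hk _)

end OscillatoryIntegral

/-! ### Inversion formula and the form of the quantization. -/

section Inversion

open scoped FourierTransform ComplexConjugate

variable {n : ℕ}

/-- The shear (x, v) ↦ (x, v - c(x)) preserves the product measure. -/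
theorem MeasureTheory.Integrable.mul_comp_sub {X V : Type*} [MeasurableSpace X]
    [NormedAddCommGroup V] [MeasurableSpace V] [BorelSpace V] [SecondCountableTopology V]
    {μ : Measure X} [SFinite μ] {ν : Measure V} [SFinite ν] [ν.IsAddRightInvariant]
    {f : X → ℝ} {g : V → ℝ} (hf : Integrable f μ) (hg : Integrable g ν) {c : X → V}
    (hc : Measurable c) :
    Integrable (fun q : X × V => f q.1 * g (q.2 - c q.1)) (μ.prod ν) := by
  have hmp : MeasurePreserving (fun q : X × V => (q.1, q.2 - c q.1)) (μ.prod ν) (μ.prod ν) :=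
    (MeasurePreserving.id μ).skew_product (g := fun x v => v - c x)
      (measurable_snd.sub (hc.comp measurable_fst))
      (.of_forall fun x => (measurePreserving_sub_right ν (c x)).map_eq)
  exact (hmp.integrable_comp (hf.mul_prod hg).aestronglyMeasurable).2 (hf.mul_prod hg)

theorem integral_conj_fbiFun_mul_fbiFun {h : ℝ} (hh : 0 < h)
    (u v : 𝓢(EuclideanSpace ℝ (Fin n), ℂ)) :
    ∫ β, conj (fbiFun h v β) * fbiFun h u β = ∫ y, conj (v y) * u y := by
  have h1 := (fbiTransform hh).inner_map_map (v.toLp 2) (u.toLp 2)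
  rw [L2.inner_def, L2.inner_def] at h1
  rw [← integral_congr_ae (f := fun β => inner ℂ (fbiTransform hh (v.toLp 2) β)
      (fbiTransform hh (u.toLp 2) β)), h1]
  · refine integral_congr_ae ?_
    filter_upwards [v.coeFn_toLp 2 volume, u.coeFn_toLp 2 volume] with y h2 h3
    rw [h2, h3, RCLike.inner_apply, mul_comm]
  · filter_upwards [fbiTransform_toLp_ae hh u, fbiTransform_toLp_ae hh v] with β h2 h3
    rw [h2, h3, RCLike.inner_apply, mul_comm]

theorem integrable_fbiFun_mul_wavePacket {h : ℝ} (hh : 0 < h)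
    (u : 𝓢(EuclideanSpace ℝ (Fin n), ℂ)) :
    Integrable (fun q : PhaseSpace n × EuclideanSpace ℝ (Fin n) =>
      fbiFun h u q.1 * wavePacket h q.1 q.2) (volume.prod volume) := by
  have h1 := (integrable_fbiFun hh u).norm.mul_comp_sub
    ((integrable_exp_neg_mul_sq_norm (n := n) (b := 1 / (2 * h)) (by positivity)).const_mul
      (fbiNorm n h)) measurable_fst
  refine h1.mono' ?_ (.of_forall fun q => ?_)
  · exact (integrable_fbiFun hh u).aestronglyMeasurable.comp_fst.mul
      (continuous_wavePacket_uncurry h).aestronglyMeasurable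
  · rw [norm_mul, norm_wavePacket hh, norm_sub_rev]

/-- This is T*T = 1 as an absolutely convergent integral, obtained by polarising the isometry and
testing against smooth compactly supported functions. -/
theorem ae_eq_integral_fbiFun_mul_wavePacket {h : ℝ} (hh : 0 < h)
    (u : 𝓢(EuclideanSpace ℝ (Fin n), ℂ)) :
    u =ᵐ[volume] fun y => ∫ β, fbiFun h u β * wavePacket h β y := by
  have hI := integrable_fbiFun_mul_wavePacket hh u
  refine ae_eq_of_integral_contDiff_smul_eq u.integrable.locallyIntegrable
    hI.swap.integral_prod_left.locallyIntegrable fun g hg hgc => ?_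
  have hgc' : HasCompactSupport fun y => (g y : ℂ) := hgc.comp_left Complex.ofReal_zero
  set v := hgc'.toSchwartzMap (Complex.ofRealCLM.contDiff.comp hg) with hv
  have hvg : ∀ y, v y = (g y : ℂ) := fun y => rfl
  obtain ⟨M, hM⟩ := hgc.exists_bound_of_continuous hg.continuous
  have h1 := integral_conj_fbiFun_mul_fbiFun hh u v
  have e1 : ∀ y, conj (v y) * u y = g y • u y := fun y => by
    rw [hvg, Complex.conj_ofReal, Complex.real_smul]
  have e2 : ∀ β, conj (fbiFun h v β) * fbiFun h u β =
      ∫ y, g y • (fbiFun h u β * wavePacket h β y) := by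
    intro β
    rw [fbiFun_eq h v, ← integral_conj, ← integral_mul_const]
    refine integral_congr_ae (.of_forall fun y => ?_)
    simp only [map_mul, Complex.conj_conj, hvg, Complex.conj_ofReal, Complex.real_smul]
    ring
  simp only [e1, e2] at h1
  rw [← h1, integral_integral_swap]
  · refine integral_congr_ae (.of_forall fun y => ?_)
    simp only
    rw [integral_smul]
  · refine hI.bdd_smul M (hg.continuous.comp continuous_snd).aestronglyMeasurable
      (.of_forall fun q => hM _)

/-- Inserting the inversion formula under the Fourier integral removes its exceptional null set, so
the identity holds at every ξ. -/
theorem planckFourier_eq_integral_fbiFun {h : ℝ} (hh : 0 < h)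
    (u : 𝓢(EuclideanSpace ℝ (Fin n), ℂ)) (ξ : EuclideanSpace ℝ (Fin n)) :
    planckFourier h u ξ = ∫ β, fbiFun h u β * packetFourier h β ξ := by
  have hI := integrable_fbiFun_mul_wavePacket hh u
  have hn : ∀ y : EuclideanSpace ℝ (Fin n),
      ‖Complex.exp (-(Complex.I / h) * (inner ℝ y ξ : ℝ))‖ = 1 := by
    intro y
    rw [show -(Complex.I / h) * ((inner ℝ y ξ : ℝ) : ℂ)
      = ((-(1 / h) * inner ℝ y ξ : ℝ) : ℂ) * Complex.I by push_cast; ring]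
    exact Complex.norm_exp_ofReal_mul_I _
  rw [planckFourier_eq hh]
  have e1 : ∫ y, Complex.exp (-(Complex.I / h) * (inner ℝ y ξ : ℝ)) * u y =
      ∫ y, ∫ β, Complex.exp (-(Complex.I / h) * (inner ℝ y ξ : ℝ)) *
        (fbiFun h u β * wavePacket h β y) := by
    refine integral_congr_ae ?_
    filter_upwards [ae_eq_integral_fbiFun_mul_wavePacket hh u] with y hy
    rw [integral_const_mul, ← hy]
  rw [e1, integral_integral_swap]
  · refine integral_congr_ae (.of_forall fun β => ?_)
    simp only
    rw [← planckFourier_wavePacket hh, planckFourier_eq hh, ← integral_const_mul]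
    refine integral_congr_ae (.of_forall fun y => ?_)
    simp only
    ring
  · refine hI.swap.bdd_mul (c := 1) ?_ (.of_forall fun q => (hn q.1).le)
    exact Continuous.aestronglyMeasurable (by fun_prop)

/-- The distribution `(2πh)⁻ⁿ exp(i⟨x, ξ⟩/h) conj(v(x)) û(ξ)` on phase space, whose integral against
`a` is `⟨v, a(x, hD) u⟩`. -/
noncomputable def rihaczek (h : ℝ) (u v : EuclideanSpace ℝ (Fin n) → ℂ) (γ : PhaseSpace n) : ℂ :=
  (((2 * Real.pi * h) ^ n)⁻¹ : ℝ) * Complex.exp (Complex.I / h * (inner ℝ γ.1 γ.2 : ℝ)) *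
    (conj (v γ.1) * planckFourier h u γ.2)

theorem norm_cexp_inner (h : ℝ) (x ξ : EuclideanSpace ℝ (Fin n)) :
    ‖Complex.exp (Complex.I / h * (inner ℝ x ξ : ℝ))‖ = 1 := by
  rw [show Complex.I / h * ((inner ℝ x ξ : ℝ) : ℂ)
    = ((1 / h * inner ℝ x ξ : ℝ) : ℂ) * Complex.I by push_cast; ring]
  exact Complex.norm_exp_ofReal_mul_I _

theorem integrable_rihaczek {h : ℝ} (hh : 0 < h) (u v : 𝓢(EuclideanSpace ℝ (Fin n), ℂ)) :
    Integrable (rihaczek h u v) := by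
  have h1 : Integrable (fun γ : PhaseSpace n => conj (v γ.1) * planckFourier h u γ.2) :=
    Integrable.mul_prod (f := fun x => conj (v x)) (Complex.conjCLE.integrable_comp_iff.2 v.integrable)
      (integrable_planckFourier hh u)
  refine h1.bdd_mul (c := ‖(((2 * Real.pi * h) ^ n)⁻¹ : ℝ)‖)
    (Continuous.aestronglyMeasurable (by fun_prop)) (.of_forall fun γ => ?_)
  rw [norm_mul, norm_cexp_inner, mul_one, Complex.norm_real]

/-- The sesquilinear form `⟨v, a(x, hD) u⟩`. -/
noncomputable def quantForm (a : PhaseSpace n → ℂ) (h : ℝ) (u v : EuclideanSpace ℝ (Fin n) → ℂ) :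
    ℂ := ∫ γ, a γ * rihaczek h u v γ

theorem quantFun_eq {h : ℝ} (hh : 0 < h) (a : PhaseSpace n → ℂ)
    (u : EuclideanSpace ℝ (Fin n) → ℂ) (x : EuclideanSpace ℝ (Fin n)) :
    quantFun a h u x = (((2 * Real.pi * h) ^ n)⁻¹ : ℝ) *
      ∫ ξ, a (x, ξ) * (Complex.exp (Complex.I / h * (inner ℝ x ξ : ℝ)) * planckFourier h u ξ) := by
  rw [quantFun]
  congr 1
  refine integral_congr_ae (.of_forall fun ξ => ?_)
  simp only
  rw [planckFourier_eq hh, ← integral_const_mul, ← integral_const_mul]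
  refine integral_congr_ae (.of_forall fun y => ?_)
  simp only
  rw [← mul_assoc _ _ (u y), ← Complex.exp_add, mul_assoc]
  congr 3
  rw [inner_sub_left]
  push_cast
  ring

theorem integral_conj_mul_quantFun {h : ℝ} (hh : 0 < h) {a : PhaseSpace n → ℂ}
    (ha : Continuous a) {A : ℝ} (hA : ∀ γ, ‖a γ‖ ≤ A) (u v : 𝓢(EuclideanSpace ℝ (Fin n), ℂ)) :
    ∫ x, conj (v x) * quantFun a h u x = quantForm a h u v := by
  have hI : Integrable (fun γ => a γ * rihaczek h u v γ) :=
    (integrable_rihaczek hh u v).bdd_mul (c := A) ha.aestronglyMeasurable (.of_forall hA)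
  rw [quantForm, Measure.volume_eq_prod, integral_prod _ hI]
  refine integral_congr_ae (.of_forall fun x => ?_)
  simp only
  rw [quantFun_eq hh, ← integral_const_mul, ← integral_const_mul]
  refine integral_congr_ae (.of_forall fun ξ => ?_)
  simp only [rihaczek]
  ring

end Inversion

/-! ### The quantization as a kernel between wave packets. -/

section CalderonVaillancourt

open scoped FourierTransform ComplexConjugate

variable {n : ℕ}

/-- The matrix element `⟨e_α, a(x, hD) e_β⟩` between wave packets. -/
noncomputable def quantKernel (a : PhaseSpace n → ℂ) (h : ℝ) (α β : PhaseSpace n) : ℂ :=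
  ∫ γ : PhaseSpace n, a γ * (conj (wavePacket h α γ.1) * packetFourier h β γ.2 *
    ((((2 * Real.pi * h) ^ n)⁻¹ : ℝ) * Complex.exp (Complex.I / h * (inner ℝ γ.1 γ.2 : ℝ))))

theorem integrable_exp_neg_distSq {μ : ℝ} (hμ : 0 < μ) :
    Integrable fun γ : PhaseSpace n => Real.exp (-μ * distSq 0 γ) := by
  simpa using integrable_one_add_norm_pow_mul_exp_distSq (n := n) 0 hμ

/-- Expand v in packets in position and û in packets in momentum, then apply Fubini. The triple
integral converges absolutely because Tu and Tv are integrable and the Gaussians localise γ near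
(α.1, β.2). -/
theorem quantForm_eq_integral_quantKernel {h : ℝ} (hh : 0 < h) {a : PhaseSpace n → ℂ}
    (ha : Continuous a) {A : ℝ} (hA : ∀ γ, ‖a γ‖ ≤ A) (u v : 𝓢(EuclideanSpace ℝ (Fin n), ℂ)) :
    quantForm a h u v = ∫ q : PhaseSpace n × PhaseSpace n,
      conj (fbiFun h v q.1) * fbiFun h u q.2 * quantKernel a h q.1 q.2
        ∂(volume.prod volume) := by
  have hpi := Real.pi_pos
  set D : ℝ := ((2 * Real.pi * h) ^ n)⁻¹ with hD
  set Φ : PhaseSpace n → PhaseSpace n × PhaseSpace n → ℂ := fun γ q =>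
    conj (fbiFun h v q.1) * fbiFun h u q.2 * (a γ * (conj (wavePacket h q.1 γ.1) *
      packetFourier h q.2 γ.2 * (D * Complex.exp (Complex.I / h * (inner ℝ γ.1 γ.2 : ℝ)))))
    with hΦ
  have hfv := integrable_fbiFun hh v
  have hfu := integrable_fbiFun hh u
  have hI : Integrable (Function.uncurry fun q γ => Φ γ q)
      ((volume.prod volume).prod (volume : Measure (PhaseSpace n))) := by
    have h1 := (hfv.norm.mul_prod hfu.norm).mul_comp_sub
      ((integrable_exp_neg_distSq (n := n) (μ := 1 / (2 * h)) (by positivity)).const_mul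
      (A * (fbiNorm n h * (fbiNorm n h * (2 * Real.pi * h) ^ ((n : ℝ) / 2)) * D)))
      (c := fun q : PhaseSpace n × PhaseSpace n => (q.1.1, q.2.2)) (by fun_prop)
    refine h1.mono' ?_ (.of_forall fun q => ?_)
    · have m1 : AEStronglyMeasurable (fun q : (PhaseSpace n × PhaseSpace n) × PhaseSpace n =>
          conj (fbiFun h v q.1.1)) ((volume.prod volume).prod volume) :=
        Complex.continuous_conj.comp_aestronglyMeasurable
          (hfv.aestronglyMeasurable.comp_fst.comp_fst)
      have m2 : AEStronglyMeasurable (fun q : (PhaseSpace n × PhaseSpace n) × PhaseSpace n =>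
          fbiFun h u q.1.2) ((volume.prod volume).prod volume) :=
        hfu.aestronglyMeasurable.comp_snd.comp_fst
      refine (m1.mul m2).mul (Continuous.aestronglyMeasurable ?_)
      have c1 : Continuous fun q : (PhaseSpace n × PhaseSpace n) × PhaseSpace n =>
          wavePacket h q.1.1 q.2.1 :=
        (continuous_wavePacket_uncurry h).comp (f := fun q : (PhaseSpace n × PhaseSpace n) ×
          PhaseSpace n => (q.1.1, q.2.1)) (by fun_prop)
      have c2 : Continuous fun q : (PhaseSpace n × PhaseSpace n) × PhaseSpace n =>
          packetFourier h q.1.2 q.2.2 :=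
        (continuous_packetFourier_uncurry h).comp (f := fun q : (PhaseSpace n × PhaseSpace n) ×
          PhaseSpace n => (q.1.2, q.2.2)) (by fun_prop)
      fun_prop
    · obtain ⟨⟨α, β⟩, γ⟩ := q
      simp only [Function.uncurry, hΦ, norm_mul, RCLike.norm_conj, norm_cexp_inner,
        norm_wavePacket hh, norm_packetFourier hh, Complex.norm_real, Real.norm_eq_abs]
      have hD0 : |D| = D := abs_of_pos (by positivity)
      have hN := fbiNorm_pos n hh
      have e : Real.exp (-(1 / (2 * h)) * distSq 0 (γ - (α.1, β.2))) =
          Real.exp (-(1 / (2 * h)) * ‖α.1 - γ.1‖ ^ 2) *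
            Real.exp (-(1 / (2 * h)) * ‖γ.2 - β.2‖ ^ 2) := by
        rw [← Real.exp_add, ← mul_add, distSq]
        simp only [Prod.fst_zero, Prod.snd_zero, zero_sub, norm_neg, Prod.fst_sub, Prod.snd_sub]
        rw [norm_sub_rev γ.1]
      rw [e, hD0, mul_one]
      refine mul_le_mul_of_nonneg_left ?_ (by positivity)
      calc _ ≤ A * (fbiNorm n h * Real.exp (-(1 / (2 * h)) * ‖α.1 - γ.1‖ ^ 2) *
          (fbiNorm n h * (2 * Real.pi * h) ^ ((n : ℝ) / 2) *
            Real.exp (-(1 / (2 * h)) * ‖γ.2 - β.2‖ ^ 2)) * D) :=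
            mul_le_mul_of_nonneg_right (hA γ) (by positivity)
        _ = _ := by ring
  have e1 : quantForm a h u v = ∫ γ, ∫ q, Φ γ q ∂(volume.prod volume) := by
    rw [quantForm]
    refine integral_congr_ae ?_
    have hae := (Measure.quasiMeasurePreserving_fst (μ := volume)
      (ν := (volume : Measure (EuclideanSpace ℝ (Fin n))))).ae
      (ae_eq_integral_fbiFun_mul_wavePacket hh v)
    rw [← Measure.volume_eq_prod] at hae
    filter_upwards [hae] with γ hγ
    have e2 : ∀ q, Φ γ q = (a γ * (D * Complex.exp (Complex.I / h * (inner ℝ γ.1 γ.2 : ℝ)))) *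
        (conj (fbiFun h v q.1 * wavePacket h q.1 γ.1) *
          (fbiFun h u q.2 * packetFourier h q.2 γ.2)) := by
      intro q
      simp only [hΦ, map_mul]
      ring
    simp only [e2]
    rw [integral_const_mul, integral_prod_mul (fun α => conj (fbiFun h v α * wavePacket h α γ.1))
      (fun β => fbiFun h u β * packetFourier h β γ.2), integral_conj, ← hγ,
      ← planckFourier_eq_integral_fbiFun hh, rihaczek]
    ring
  rw [e1, ← integral_integral_swap hI]
  refine integral_congr_ae (.of_forall fun q => ?_)
  simp only [hΦ]
  rw [integral_const_mul, quantKernel]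

/-- The integrand concentrates at (α.1, β.2) on the scale √h. Shifting and rescaling there leaves a
fixed Schwartz function with frequency (β.2 - α.2, α.1 - β.1)/√h: a symplectically rotated α - β,
whose size governs the decay. -/
theorem quantKernel_eq {h : ℝ} (hh : 0 < h) (a : PhaseSpace n → ℂ) (α β : PhaseSpace n) :
    quantKernel a h α β =
      ((h ^ n * (fbiNorm n h * (fbiNorm n h * (2 * Real.pi * h) ^ ((n : ℝ) / 2)) *
        ((2 * Real.pi * h) ^ n)⁻¹) : ℝ) : ℂ) *
      Complex.exp (((1 / h * inner ℝ (α.1 - β.1) β.2 : ℝ) : ℂ) * Complex.I) *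
      ∫ γ : PhaseSpace n, (a ((α.1, β.2) + √h • γ) * quadExp (Complex.I * (-1 : ℝ)) (1 / 2 : ℝ)
          (1 / 2 : ℝ) 0 γ) *
        Complex.exp (Complex.I * ((inner ℝ γ.1 ((√h)⁻¹ • (β.2 - α.2)) +
          inner ℝ γ.2 ((√h)⁻¹ • (α.1 - β.1)) : ℝ) : ℂ)) := by
  obtain ⟨r, hr, rfl⟩ : ∃ r : ℝ, 0 < r ∧ h = r ^ 2 := ⟨√h, Real.sqrt_pos.2 hh, (Real.sq_sqrt hh.le).symm⟩
  have hr0 : (r : ℂ) ≠ 0 := by exact_mod_cast hr.ne'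
  rw [quantKernel, ← integral_add_left_eq_self _ ((α.1, β.2) : PhaseSpace n),
    integral_phaseSpace_comp_sqrt_smul hh, Complex.real_smul, Complex.ofReal_mul (_ ^ n),
    mul_assoc (((r ^ 2) ^ n : ℝ) : ℂ), mul_assoc (((r ^ 2) ^ n : ℝ) : ℂ)]
  congr 1
  rw [← integral_const_mul]
  refine integral_congr_ae (.of_forall fun γ => ?_)
  simp only [Real.sqrt_sq hr.le]
  generalize a ((α.1, β.2) + r • γ) = z
  obtain ⟨s, t⟩ := γ
  obtain ⟨x, ξ⟩ := α
  obtain ⟨y, η⟩ := β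
  simp only [Prod.smul_mk, Prod.mk_add_mk, wavePacket, packetFourier, quadExp, map_mul,
    Complex.conj_ofReal, ← Complex.exp_conj]
  have e : ∀ (c₁ c₂ c₃ w₁ w₂ w₃ : ℂ), z * (c₁ * Complex.exp w₁ * (c₂ * Complex.exp w₂) *
      (c₃ * Complex.exp w₃)) = c₁ * c₂ * c₃ * (z * Complex.exp (w₁ + w₂ + w₃)) := by
    intros
    rw [Complex.exp_add, Complex.exp_add]
    ring
  have e' : ∀ (c w₁ w₂ w₃ : ℂ), c * Complex.exp w₁ * (z * Complex.exp w₂ * Complex.exp w₃) =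
      c * (z * Complex.exp (w₁ + w₂ + w₃)) := by
    intros
    rw [Complex.exp_add, Complex.exp_add]
    ring
  rw [e, e']
  congr 1
  · push_cast
    ring
  congr 2
  simp only [sub_add_cancel_left, add_sub_cancel_left, inner_neg_left,
    inner_add_left, inner_add_right, inner_sub_left, inner_sub_right, inner_smul_left,
    inner_smul_right, norm_neg, norm_smul, Prod.fst_zero, Prod.snd_zero, zero_sub, zero_add,
    map_mul, map_sub, map_neg, map_div₀, Complex.conj_I, Complex.conj_ofReal,
    Real.norm_eq_abs, abs_of_pos hr, real_inner_comm t y, real_inner_comm t x,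
    real_inner_comm η y, real_inner_comm η x, real_inner_comm ξ s, real_inner_comm η s,
    conj_trivial, map_ofNat]
  push_cast
  field_simp
  ring

end CalderonVaillancourt

/-! ### The uniform Calderón–Vaillancourt bound. -/

section CalderonVaillancourtBound

open scoped FourierTransform ComplexConjugate

variable {n : ℕ}

theorem quantKernel_const {h : ℝ} (hh : 0 < h) :
    h ^ n * (fbiNorm n h * (fbiNorm n h * (2 * Real.pi * h) ^ ((n : ℝ) / 2)) *
      ((2 * Real.pi * h) ^ n)⁻¹) =
    (2 : ℝ) ^ ((n : ℝ) / 2) * ((2 * Real.pi) ^ n)⁻¹ ^ 2 * (h ^ n)⁻¹ := by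
  have hpi := Real.pi_pos
  have h1 := fbiNorm_sq n hh
  have h2 : (2 * Real.pi * h) ^ ((n : ℝ) / 2) =
      (2 : ℝ) ^ ((n : ℝ) / 2) * (Real.pi * h) ^ ((n : ℝ) / 2) := by
    rw [mul_assoc, Real.mul_rpow (by norm_num) (by positivity)]
  have h3 : fbiNorm n h ^ 2 * (Real.pi * h) ^ ((n : ℝ) / 2) = ((2 * Real.pi * h) ^ n)⁻¹ := by
    refine eq_inv_of_mul_eq_one_left ?_
    rw [← h1]
    ring
  rw [h2]
  calc _ = h ^ n * (fbiNorm n h ^ 2 * (Real.pi * h) ^ ((n : ℝ) / 2)) * (2 : ℝ) ^ ((n : ℝ) / 2) *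
        ((2 * Real.pi * h) ^ n)⁻¹ := by ring
    _ = _ := by
      rw [h3, mul_pow (2 * Real.pi) h]
      field_simp

theorem exists_norm_quantKernel_le (n M : ℕ) :
    ∃ C, 0 ≤ C ∧ ∀ h : ℝ, 0 < h → h ≤ 1 → ∀ (a : PhaseSpace n → ℂ) (A : ℝ), ContDiff ℝ ∞ a →
      (∀ k ≤ M + 1, ∀ γ, ‖iteratedFDeriv ℝ k a γ‖ ≤ A) → ∀ α β,
      ‖quantKernel a h α β‖ ≤
        C * A * (h ^ n)⁻¹ * ((1 + ‖(√h)⁻¹ • (α - β)‖) ^ (M + 1))⁻¹ := by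
  obtain ⟨G, hG⟩ := exists_schwartz_quadExp (n := n) (μ := 1 / 2) (by norm_num) (-1) 0
  obtain ⟨C, hC0, hC⟩ := exists_norm_oscillatory_integral_le G M
  have hpi := Real.pi_pos
  refine ⟨(2 : ℝ) ^ ((n : ℝ) / 2) * ((2 * Real.pi) ^ n)⁻¹ ^ 2 * C, by positivity,
    fun h hh h1 a A ha hA α β => ?_⟩
  have hs : √h ≤ 1 := Real.sqrt_le_one.2 h1
  have hw := hC (fun γ => a ((α.1, β.2) + √h • γ)) A (ha.comp (by fun_prop))
    (fun k hk γ => norm_iteratedFDeriv_comp_affine_le ha hA (Real.sqrt_nonneg h) hs _ hk γ)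
    ((√h)⁻¹ • (β.2 - α.2), (√h)⁻¹ • (α.1 - β.1))
  rw [quantKernel_eq hh, norm_mul, norm_mul, Complex.norm_exp_ofReal_mul_I, mul_one,
    Complex.norm_real, Real.norm_eq_abs, quantKernel_const hh, abs_of_pos (by positivity)]
  simp only [hG] at hw
  have e : ‖(((√h)⁻¹ • (β.2 - α.2), (√h)⁻¹ • (α.1 - β.1)) : PhaseSpace n)‖ =
      ‖(√h)⁻¹ • (α - β)‖ := by
    rw [Prod.norm_def, Prod.norm_def, max_comm]
    simp only [Prod.smul_fst, Prod.smul_snd, Prod.fst_sub, Prod.snd_sub, norm_smul,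
      norm_sub_rev β.2]
  rw [e] at hw
  calc _ ≤ (2 : ℝ) ^ ((n : ℝ) / 2) * ((2 * Real.pi) ^ n)⁻¹ ^ 2 * (h ^ n)⁻¹ *
        (C * A * ((1 + ‖(√h)⁻¹ • (α - β)‖) ^ (M + 1))⁻¹) :=
        mul_le_mul_of_nonneg_left hw (by positivity)
    _ = _ := by ring

/-- The **Calderón–Vaillancourt** bound, uniformly in `0 < h ≤ 1`. -/
theorem exists_norm_quantForm_le (n : ℕ) :
    ∃ C, 0 ≤ C ∧ ∀ h : ℝ, 0 < h → h ≤ 1 → ∀ (a : PhaseSpace n → ℂ) (A : ℝ), ContDiff ℝ ∞ a →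
      (∀ k ≤ 2 * n + 1, ∀ γ, ‖iteratedFDeriv ℝ k a γ‖ ≤ A) →
      ∀ u v : 𝓢(EuclideanSpace ℝ (Fin n), ℂ),
      ‖quantForm a h u v‖ ≤ C * A * ‖u.toLp 2 volume‖ * ‖v.toLp 2 volume‖ := by
  -- The parameter 2n gives decay of order 2n + 1, just above the dimension of phase space, and
  -- fixes the number of derivatives of the symbol required.
  obtain ⟨C, hC0, hC⟩ := exists_norm_quantKernel_le n (2 * n)
  set I := ∫ γ : PhaseSpace n, ((1 + ‖γ‖) ^ (2 * n + 1))⁻¹ with hI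
  have hI0 : 0 ≤ I := integral_nonneg fun γ => by positivity
  refine ⟨C * I, by positivity, fun h hh h1 a A ha hA u v => ?_⟩
  have hA0 : 0 ≤ A := (norm_nonneg _).trans (hA 0 (by omega) 0)
  have hs : 0 < √h := Real.sqrt_pos.2 hh
  set m : PhaseSpace n → ℝ := fun γ =>
    C * A * (h ^ n)⁻¹ * ((1 + ‖(√h)⁻¹ • γ‖) ^ (2 * n + 1))⁻¹ with hm
  have hmI : Integrable m := by
    refine Integrable.const_mul (Integrable.comp_smul
      (f := fun γ : PhaseSpace n => ((1 + ‖γ‖) ^ (2 * n + 1))⁻¹)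
      (integrable_inv_one_add_norm_pow (by rw [finrank_phaseSpace]; omega))
      (R := (√h)⁻¹) (by positivity)) _
  have hm0 : ∀ γ, 0 ≤ m γ := fun γ => by positivity
  -- The kernel size h^{-n} is cancelled by the Jacobian of the √h rescaling, so the Schur constant
  -- is independent of h.
  have hmint : ∫ γ, m γ = C * A * I := by
    rw [integral_phaseSpace_comp_sqrt_smul hh]
    simp only [hm, inv_smul_smul₀ hs.ne']
    rw [integral_const_mul, smul_eq_mul, ← hI]
    field_simp
  obtain ⟨k1, k2⟩ := integrable_convolution_kernel hmI hm0 (fbiTransform hh (u.toLp 2))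
    (fbiTransform hh (v.toLp 2))
  rw [hmint, (fbiTransform hh).norm_map, (fbiTransform hh).norm_map] at k2
  rw [quantForm_eq_integral_quantKernel hh ha.continuous
    (fun γ => by simpa using hA 0 (by omega) γ)]
  refine (norm_integral_le_of_norm_le k1 ?_).trans (k2.trans (le_of_eq (by ring)))
  have a1 := (Measure.quasiMeasurePreserving_fst (μ := volume)
    (ν := (volume : Measure (PhaseSpace n)))).ae (fbiTransform_toLp_ae hh v)
  have a2 := (Measure.quasiMeasurePreserving_snd (μ := (volume : Measure (PhaseSpace n)))
    (ν := volume)).ae (fbiTransform_toLp_ae hh u)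
  filter_upwards [a1, a2] with q h3 h4
  rw [h3, h4, norm_mul, norm_mul, RCLike.norm_conj, mul_comm (m _), mul_comm ‖fbiFun h u q.2‖]
  exact mul_le_mul_of_nonneg_left (hC h hh h1 a A ha hA q.1 q.2) (by positivity)

end CalderonVaillancourtBound

/-! ### From the bounded form to the operator on L². -/

section QuantizationOperator

open scoped ComplexConjugate

variable {n : ℕ}

theorem SchwartzMap.integrable_mul_of_bound {f : EuclideanSpace ℝ (Fin n) → ℂ}
    (hf : AEStronglyMeasurable f) {M : ℝ} (hM : ∀ x, ‖f x‖ ≤ M)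
    (v : 𝓢(EuclideanSpace ℝ (Fin n), ℂ)) : Integrable fun x => v x * f x := by
  simpa only [mul_comm] using v.integrable.bdd_mul (c := M) hf (.of_forall hM)

/-- A bounded function whose pairing with Schwartz functions is continuous for the `L²` norm is
square integrable. -/
theorem exists_Lp_of_bounded_pairing {f : EuclideanSpace ℝ (Fin n) → ℂ}
    (hf : AEStronglyMeasurable f) {M : ℝ} (hM : ∀ x, ‖f x‖ ≤ M) {K : ℝ} (hK : 0 ≤ K)
    (hb : ∀ v : 𝓢(EuclideanSpace ℝ (Fin n), ℂ),
      ‖∫ x, conj (v x) * f x‖ ≤ K * ‖v.toLp 2 volume‖) :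
    ∃ w : L2Config n, w =ᵐ[volume] f ∧ ‖w‖ ≤ K := by
  have hf' : AEStronglyMeasurable (fun x => conj (f x)) :=
    Complex.continuous_conj.comp_aestronglyMeasurable hf
  have hM' : ∀ x, ‖conj (f x)‖ ≤ M := fun x => by rw [RCLike.norm_conj]; exact hM x
  -- The pairing is conjugate linear in v; its complex conjugate is linear, so it can be extended by
  -- density and represented by Riesz.
  set ℓ : 𝓢(EuclideanSpace ℝ (Fin n), ℂ) →ₗ[ℂ] ℂ :=
    { toFun := fun v => ∫ x, v x * conj (f x)
      map_add' := fun v w => by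
        rw [← integral_add (v.integrable_mul_of_bound hf' hM')
          (w.integrable_mul_of_bound hf' hM')]
        simp only [add_apply, add_mul]
      map_smul' := fun c v => by
        rw [RingHom.id_apply, smul_eq_mul, ← integral_const_mul]
        simp only [smul_apply, smul_eq_mul, mul_assoc] } with hℓ
  have hℓb : ∀ v, ‖ℓ v‖ ≤ K * ‖v.toLp 2 volume‖ := fun v => by
    refine le_trans (le_of_eq ?_) (hb v)
    rw [← RCLike.norm_conj, show ℓ v = ∫ x, v x * conj (f x) from rfl, ← integral_conj]
    simp only [map_mul, Complex.conj_conj]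
  have hd := SchwartzMap.denseRange_toLpCLM (E := EuclideanSpace ℝ (Fin n)) (F := ℂ) (p := 2)
    (μ := volume) ENNReal.ofNat_ne_top
  set e := (SchwartzMap.toLpCLM ℂ ℂ 2
    (volume : Measure (EuclideanSpace ℝ (Fin n)))).toLinearMap with he
  set w := (InnerProductSpace.toDual ℂ (L2Config n)).symm (ℓ.extendOfNorm e) with hw
  have hwv : ∀ v : 𝓢(EuclideanSpace ℝ (Fin n), ℂ), inner ℂ w (v.toLp 2) = ∫ x, v x * conj (f x) := by
    intro v
    rw [hw, InnerProductSpace.toDual_symm_apply]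
    exact LinearMap.extendOfNorm_eq (e := e) hd ⟨K, hℓb⟩ v
  refine ⟨w, ?_, ?_⟩
  · refine ae_eq_of_integral_contDiff_smul_eq
      ((Lp.memLp w).locallyIntegrable (by norm_num))
      (((memLp_top_of_bound hf M (.of_forall hM))).locallyIntegrable le_top) fun g hg hgc => ?_
    have hgc' : HasCompactSupport fun y => (g y : ℂ) := hgc.comp_left Complex.ofReal_zero
    have h1 := hwv (hgc'.toSchwartzMap (Complex.ofRealCLM.contDiff.comp hg))
    set v := hgc'.toSchwartzMap (Complex.ofRealCLM.contDiff.comp hg)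
    have hvg : ∀ y, v y = (g y : ℂ) := fun y => rfl
    have h2 := congrArg conj h1
    rw [inner_conj_symm, L2.inner_def, ← integral_conj] at h2
    have e1 : ∀ x, conj (v x * conj (f x)) = g x • f x := fun x => by
      rw [hvg, map_mul, Complex.conj_ofReal, Complex.conj_conj, Complex.real_smul]
    simp only [e1] at h2
    rw [← h2]
    refine integral_congr_ae ?_
    filter_upwards [v.coeFn_toLp 2 volume] with x hx
    rw [hx, hvg, RCLike.inner_apply, Complex.conj_ofReal, Complex.real_smul, mul_comm]
  · rw [hw, LinearIsometryEquiv.norm_map]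
    exact ContinuousLinearMap.opNorm_le_bound _ hK
      (LinearMap.norm_extendOfNorm_apply_le (e := e) hd K hℓb)

theorem exists_norm_quantFun_le {h : ℝ} (hh : 0 < h) {a : PhaseSpace n → ℂ} {A : ℝ} (hA : ∀ γ, ‖a γ‖ ≤ A) (u : 𝓢(EuclideanSpace ℝ (Fin n), ℂ)) :
    ∃ M, ∀ x, ‖quantFun a h u x‖ ≤ M := by
  refine ⟨‖(((2 * Real.pi * h) ^ n)⁻¹ : ℝ)‖ * ∫ ξ, A * ‖planckFourier h u ξ‖, fun x => ?_⟩
  rw [quantFun_eq hh, norm_mul, Complex.norm_real]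
  refine mul_le_mul_of_nonneg_left (norm_integral_le_of_norm_le
    ((integrable_planckFourier hh u).norm.const_mul A) (.of_forall fun ξ => ?_)) (norm_nonneg _)
  rw [norm_mul, norm_mul, norm_cexp_inner, one_mul]
  exact mul_le_mul_of_nonneg_right (hA _) (norm_nonneg _)

theorem integrable_quantFun_integrand {h : ℝ} (hh : 0 < h) {a : PhaseSpace n → ℂ}
    (ha : Continuous a) {A : ℝ} (hA : ∀ γ, ‖a γ‖ ≤ A) (u : 𝓢(EuclideanSpace ℝ (Fin n), ℂ))
    (x : EuclideanSpace ℝ (Fin n)) :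
    Integrable fun ξ => a (x, ξ) *
      (Complex.exp (Complex.I / h * (inner ℝ x ξ : ℝ)) * planckFourier h u ξ) := by
  refine ((integrable_planckFourier hh u).bdd_mul (c := 1) ?_ ?_).bdd_mul (c := A) ?_ ?_
  · exact Continuous.aestronglyMeasurable (by fun_prop)
  · exact .of_forall fun ξ => (norm_cexp_inner h x ξ).le
  · exact Continuous.aestronglyMeasurable (by fun_prop)
  · exact .of_forall fun ξ => hA _

theorem aestronglyMeasurable_quantFun {h : ℝ} (hh : 0 < h) {a : PhaseSpace n → ℂ}
    (ha : Continuous a) (u : 𝓢(EuclideanSpace ℝ (Fin n), ℂ)) :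
    AEStronglyMeasurable (quantFun a h u) := by
  rw [funext (quantFun_eq hh a u)]
  have hc := continuous_planckFourier h u
  refine AEStronglyMeasurable.const_mul (StronglyMeasurable.aestronglyMeasurable ?_) _
  refine StronglyMeasurable.integral_prod_right' (f := fun q : PhaseSpace n => a (q.1, q.2) *
      (Complex.exp (Complex.I / h * (inner ℝ q.1 q.2 : ℝ)) * planckFourier h u q.2)) ?_
  exact Continuous.stronglyMeasurable (by fun_prop)

/-- The quantization of a symbol `a` whose form is bounded, as an operator on `L²`. -/
theorem exists_isQuantization {h : ℝ} (hh : 0 < h) {a : PhaseSpace n → ℂ}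
    (ha : Continuous a) {A : ℝ} (hA : ∀ γ, ‖a γ‖ ≤ A) {K : ℝ} (hK : 0 ≤ K)
    (hb : ∀ u v : 𝓢(EuclideanSpace ℝ (Fin n), ℂ),
      ‖quantForm a h u v‖ ≤ K * ‖u.toLp 2 volume‖ * ‖v.toLp 2 volume‖) :
    ∃ P : L2Config n →L[ℂ] L2Config n, IsQuantization a h P := by
  have key : ∀ u : 𝓢(EuclideanSpace ℝ (Fin n), ℂ), ∃ w : L2Config n,
      w =ᵐ[volume] quantFun a h u ∧ ‖w‖ ≤ K * ‖u.toLp 2 volume‖ := by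
    intro u
    obtain ⟨M, hM⟩ := exists_norm_quantFun_le hh hA u
    refine exists_Lp_of_bounded_pairing (aestronglyMeasurable_quantFun hh ha u) hM (by positivity)
      fun v => ?_
    rw [integral_conj_mul_quantFun hh ha hA]
    exact hb u v
  choose W hW hWn using key
  have hd := SchwartzMap.denseRange_toLpCLM (E := EuclideanSpace ℝ (Fin n)) (F := ℂ) (p := 2)
    (μ := volume) ENNReal.ofNat_ne_top
  set L : 𝓢(EuclideanSpace ℝ (Fin n), ℂ) →ₗ[ℂ] L2Config n :=
    { toFun := W
      map_add' := fun u v => by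
        refine Lp.ext ?_
        filter_upwards [hW (u + v), hW u, hW v, Lp.coeFn_add (W u) (W v)] with x h1 h2 h3 h4
        rw [h1, h4, Pi.add_apply, h2, h3, quantFun_eq hh, quantFun_eq hh, quantFun_eq hh,
          ← mul_add, ← integral_add (integrable_quantFun_integrand hh ha hA u x)
            (integrable_quantFun_integrand hh ha hA v x)]
        congr 1
        refine integral_congr_ae (.of_forall fun ξ => ?_)
        simp only [planckFourier_schwartz, FourierTransform.fourier_add, add_apply]
        ring
      map_smul' := fun c u => by
        refine Lp.ext ?_
        filter_upwards [hW (c • u), hW u, Lp.coeFn_smul c (W u)] with x h1 h2 h3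
        rw [h1, RingHom.id_apply, h3, Pi.smul_apply, h2, quantFun_eq hh, quantFun_eq hh,
          smul_eq_mul, mul_left_comm, ← integral_const_mul c]
        congr 1
        refine integral_congr_ae (.of_forall fun ξ => ?_)
        simp only [planckFourier_schwartz, FourierTransform.fourier_smul, smul_apply,
          smul_eq_mul]
        ring } with hL
  refine ⟨L.extendOfNorm (SchwartzMap.toLpCLM ℂ ℂ 2
    (volume : Measure (EuclideanSpace ℝ (Fin n)))).toLinearMap, fun u => ?_⟩
  have h1 : L.extendOfNorm (SchwartzMap.toLpCLM ℂ ℂ 2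
      (volume : Measure (EuclideanSpace ℝ (Fin n)))).toLinearMap (u.toLp 2) = W u :=
    LinearMap.extendOfNorm_eq (e := (SchwartzMap.toLpCLM ℂ ℂ 2
      (volume : Measure (EuclideanSpace ℝ (Fin n)))).toLinearMap) hd ⟨K, hWn⟩ u
  rw [h1]
  exact hW u

theorem IsQuantization.inner_eq {h : ℝ} (hh : 0 < h) {a : PhaseSpace n → ℂ}
    (ha : Continuous a) {A : ℝ} (hA : ∀ γ, ‖a γ‖ ≤ A) {P : L2Config n →L[ℂ] L2Config n}
    (hP : IsQuantization a h P) (u v : 𝓢(EuclideanSpace ℝ (Fin n), ℂ)) :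
    inner ℂ (v.toLp 2) (P (u.toLp 2)) = quantForm a h u v := by
  rw [L2.inner_def, ← integral_conj_mul_quantFun hh ha hA]
  refine integral_congr_ae ?_
  filter_upwards [hP u, v.coeFn_toLp 2 volume] with x h1 h2
  rw [h1, h2, RCLike.inner_apply, mul_comm]

end QuantizationOperator

/-! ### The averaging weight between Toeplitz and standard quantization. -/

section ToeplitzAverage

open scoped ComplexConjugate

variable {n : ℕ}

/-- The normalised weight `2^{n/2} (2π)^{-n} exp(-i⟨s, t⟩ - (|s|² + |t|²)/2)` that turns a Toeplitz
symbol into the symbol of a standard quantization. -/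
noncomputable def averagingWeight (σ : PhaseSpace n) : ℂ :=
  (((2 : ℝ) ^ ((n : ℝ) / 2) * ((2 * Real.pi) ^ n)⁻¹ : ℝ) : ℂ) *
    quadExp (Complex.I * (1 : ℝ)) (1 / 2 : ℝ) (1 / 2 : ℝ) 0 σ

theorem averagingWeight_neg (σ : PhaseSpace n) : averagingWeight (-σ) = averagingWeight σ := by
  simp [averagingWeight, quadExp]

theorem exists_schwartz_averagingWeight (n : ℕ) :
    ∃ f : 𝓢(PhaseSpace n, ℂ), ∀ σ, f σ = averagingWeight σ := by
  obtain ⟨G, hG⟩ := exists_schwartz_quadExp (n := n) (μ := 1 / 2) (by norm_num) 1 0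
  exact ⟨(((2 : ℝ) ^ ((n : ℝ) / 2) * ((2 * Real.pi) ^ n)⁻¹ : ℝ) : ℂ) • G, fun σ => by
    rw [smul_apply, hG, smul_eq_mul, averagingWeight]⟩

theorem integrable_pow_mul_norm_averagingWeight (n k : ℕ) :
    Integrable fun σ : PhaseSpace n => ‖σ‖ ^ k * ‖averagingWeight σ‖ := by
  obtain ⟨f, hf⟩ := exists_schwartz_averagingWeight n
  simpa [hf] using f.integrable_pow_mul volume k

theorem integrable_averagingWeight (n : ℕ) :
    Integrable (averagingWeight : PhaseSpace n → ℂ) := by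
  obtain ⟨f, hf⟩ := exists_schwartz_averagingWeight n
  exact f.integrable.congr (.of_forall hf)

theorem integral_averagingWeight (n : ℕ) : ∫ σ : PhaseSpace n, averagingWeight σ = 1 := by
  have hpi := Real.pi_pos
  have h0 := integrable_averagingWeight n
  rw [Measure.volume_eq_prod] at h0 ⊢
  rw [integral_prod _ h0]
  -- Integrating the oscillation over t contributes another exp(-|s|²/2), so exp(-|s|²) remains in
  -- s.
  have e1 : ∀ s : EuclideanSpace ℝ (Fin n), ∫ t, averagingWeight ((s, t) : PhaseSpace n) =
      (((2 : ℝ) ^ ((n : ℝ) / 2) * ((2 * Real.pi) ^ n)⁻¹ : ℝ) : ℂ) *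
        (((Real.pi / (1 / 2 : ℝ)) ^ ((n : ℝ) / 2) : ℝ) *
          Complex.exp (-((1 : ℝ) : ℂ) * ‖s‖ ^ 2 + 0 * (inner ℝ 0 s : ℝ))) := by
    intro s
    have e2 : ∀ t, averagingWeight ((s, t) : PhaseSpace n) =
        (((2 : ℝ) ^ ((n : ℝ) / 2) * ((2 * Real.pi) ^ n)⁻¹ : ℝ) : ℂ) *
          (Complex.exp (-((1 / 2 : ℝ) : ℂ) * ‖s‖ ^ 2) *
          Complex.exp (-((1 / 2 : ℝ) : ℂ) * ‖t‖ ^ 2 + -Complex.I * (inner ℝ s t : ℝ))) := by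
      intro t
      rw [averagingWeight, quadExp, ← Complex.exp_add]
      simp only [Prod.fst_zero, Prod.snd_zero, zero_sub, zero_add, norm_neg, inner_neg_left]
      congr 2
      push_cast
      ring
    simp only [e2]
    rw [integral_const_mul, integral_const_mul,
      integral_cexp_neg_mul_sq_norm_add_inner (by norm_num), mul_left_comm (Complex.exp _),
      ← Complex.exp_add]
    congr 3
    rw [neg_sq, Complex.I_sq]
    push_cast
    ring
  simp only [e1]
  rw [integral_const_mul, integral_const_mul, integral_cexp_neg_mul_sq_norm_add_inner one_pos]
  simp only [ne_eq, OfNat.ofNat_ne_zero, not_false_eq_true, zero_pow, norm_zero,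
    Complex.ofReal_zero, mul_zero, zero_div, Complex.exp_zero, mul_one]
  rw [← Complex.ofReal_mul, ← Complex.ofReal_mul, Complex.ofReal_eq_one, div_one,
    show Real.pi / (1 / 2) = 2 * Real.pi by ring, Real.mul_rpow (by norm_num) hpi.le]
  have e3 : ∀ x : ℝ, 0 < x → x ^ ((n : ℝ) / 2) * x ^ ((n : ℝ) / 2) = x ^ n := fun x hx => by
    rw [← Real.rpow_add hx, add_halves, Real.rpow_natCast]
  calc _ = ((2 : ℝ) ^ ((n : ℝ) / 2) * (2 : ℝ) ^ ((n : ℝ) / 2)) *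
        (Real.pi ^ ((n : ℝ) / 2) * Real.pi ^ ((n : ℝ) / 2)) * ((2 * Real.pi) ^ n)⁻¹ := by ring
    _ = 1 := by
      rw [e3 _ two_pos, e3 _ hpi, ← mul_pow, mul_inv_cancel₀ (by positivity)]

/-- With the centre written as γ + √h σ, the terms of the phase that mix γ and σ cancel. Only the
Rihaczek phase in γ and a weight in σ remain, and h^n is the Jacobian of the rescaling. -/
theorem wavePacket_mul_conj_packetFourier {h : ℝ} (hh : 0 < h) (γ σ : PhaseSpace n) (w z : ℂ) :
    ((h ^ n : ℝ) : ℂ) * (wavePacket h (γ + √h • σ) γ.1 * w *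
      ((((2 * Real.pi * h) ^ n)⁻¹ : ℝ) * (conj (packetFourier h (γ + √h • σ) γ.2) * z))) =
    averagingWeight σ * ((((2 * Real.pi * h) ^ n)⁻¹ : ℝ) *
      Complex.exp (Complex.I / h * (inner ℝ γ.1 γ.2 : ℝ)) * (w * z)) := by
  have hpi := Real.pi_pos
  have hc := quantKernel_const (n := n) hh
  have hc2 : (2 : ℝ) ^ ((n : ℝ) / 2) * ((2 * Real.pi) ^ n)⁻¹ * ((2 * Real.pi * h) ^ n)⁻¹ =
      h ^ n * (fbiNorm n h * (fbiNorm n h * (2 * Real.pi * h) ^ ((n : ℝ) / 2)) *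
        ((2 * Real.pi * h) ^ n)⁻¹) := by
    rw [hc, mul_pow (2 * Real.pi) h, mul_inv]
    ring
  obtain ⟨r, hr, rfl⟩ : ∃ r : ℝ, 0 < r ∧ h = r ^ 2 :=
    ⟨√h, Real.sqrt_pos.2 hh, (Real.sq_sqrt hh.le).symm⟩
  have hr0 : (r : ℂ) ≠ 0 := by exact_mod_cast hr.ne'
  simp only [Real.sqrt_sq hr.le]
  obtain ⟨s, t⟩ := σ
  obtain ⟨x, ξ⟩ := γ
  simp only [Prod.smul_mk, Prod.mk_add_mk, wavePacket, packetFourier, averagingWeight, quadExp,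
    map_mul, Complex.conj_ofReal, ← Complex.exp_conj]
  have e : ∀ (c₀ c₁ c₂ c₃ w₁ w₂ : ℂ), c₀ * (c₁ * Complex.exp w₁ * w * (c₂ *
      (c₃ * Complex.exp w₂ * z))) = (c₀ * (c₁ * c₃ * c₂)) * (w * z * Complex.exp (w₁ + w₂)) := by
    intros
    rw [Complex.exp_add]
    ring
  have e' : ∀ (c c' w₁ w₂ : ℂ), c * Complex.exp w₁ * (c' * Complex.exp w₂ * (w * z)) =
      (c * c') * (w * z * Complex.exp (w₁ + w₂)) := by
    intros
    rw [Complex.exp_add]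
    ring
  rw [e, e', ← Complex.ofReal_mul, ← Complex.ofReal_mul, ← Complex.ofReal_mul,
    ← Complex.ofReal_mul, hc2]
  congr 3
  simp only [add_sub_cancel_left, sub_add_cancel_left, inner_neg_left,
    inner_add_left, inner_add_right, inner_smul_left,
    inner_smul_right, norm_neg, norm_smul, Prod.fst_zero, Prod.snd_zero, zero_sub, zero_add,
    map_mul, map_sub, map_neg, map_div₀, Complex.conj_I, Complex.conj_ofReal,
    Real.norm_eq_abs, abs_of_pos hr, conj_trivial, map_ofNat]
  push_cast
  field_simp
  ring

end ToeplitzAverage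

/-! ### The Toeplitz form as an average of quantization forms. -/

section ToeplitzForm

open scoped ComplexConjugate

variable {n : ℕ}

theorem integrable_toeplitz_integrand {h : ℝ} (hh : 0 < h) {p : PhaseSpace n → ℂ}
    (hp : Continuous p) {A : ℝ} (hA : ∀ γ, ‖p γ‖ ≤ A) (u v : 𝓢(EuclideanSpace ℝ (Fin n), ℂ)) :
    Integrable (fun q : PhaseSpace n × PhaseSpace n => p q.2 *
      (wavePacket h q.2 q.1.1 * conj (v q.1.1) * ((((2 * Real.pi * h) ^ n)⁻¹ : ℝ) *
        (conj (packetFourier h q.2 q.1.2) * planckFourier h u q.1.2))))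
      (volume.prod volume) := by
  have hpi := Real.pi_pos
  have hN := fbiNorm_pos n hh
  have hpc := continuous_planckFourier h u
  have h0 : Integrable (fun γ : PhaseSpace n => ‖v γ.1‖ * ‖planckFourier h u γ.2‖) :=
    v.integrable.norm.mul_prod (integrable_planckFourier hh u).norm
  have h1 := h0.mul_comp_sub
      ((integrable_exp_neg_distSq (n := n) (μ := 1 / (2 * h)) (by positivity)).const_mul
      (A * (fbiNorm n h * (fbiNorm n h * (2 * Real.pi * h) ^ ((n : ℝ) / 2)) *
        ((2 * Real.pi * h) ^ n)⁻¹))) (ν := volume) measurable_id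
  refine h1.mono' (Continuous.aestronglyMeasurable ?_) (.of_forall fun q => ?_)
  · have c1 : Continuous fun q : PhaseSpace n × PhaseSpace n => wavePacket h q.2 q.1.1 :=
      (continuous_wavePacket_uncurry h).comp (f := fun q : PhaseSpace n × PhaseSpace n =>
        (q.2, q.1.1)) (by fun_prop)
    have c2 : Continuous fun q : PhaseSpace n × PhaseSpace n => packetFourier h q.2 q.1.2 :=
      (continuous_packetFourier_uncurry h).comp (f := fun q : PhaseSpace n × PhaseSpace n =>
        (q.2, q.1.2)) (by fun_prop)
    fun_prop
  · obtain ⟨γ, β⟩ := q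
    simp only [norm_mul, RCLike.norm_conj, norm_wavePacket hh, norm_packetFourier hh,
      Complex.norm_real, Real.norm_eq_abs, id]
    rw [abs_of_pos (show (0 : ℝ) < ((2 * Real.pi * h) ^ n)⁻¹ by positivity)]
    have e : Real.exp (-(1 / (2 * h)) * distSq 0 (β - γ)) =
        Real.exp (-(1 / (2 * h)) * ‖β.1 - γ.1‖ ^ 2) *
          Real.exp (-(1 / (2 * h)) * ‖γ.2 - β.2‖ ^ 2) := by
      rw [← Real.exp_add, ← mul_add, distSq]
      simp only [Prod.fst_zero, Prod.snd_zero, zero_sub, norm_neg, Prod.fst_sub, Prod.snd_sub]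
      rw [norm_sub_rev γ.2]
    rw [e]
    refine (mul_le_mul_of_nonneg_right (hA β) (by positivity)).trans (le_of_eq ?_)
    ring

theorem integrable_averagingWeight_mul_rihaczek {h : ℝ} (hh : 0 < h) {p : PhaseSpace n → ℂ}
    (hp : Continuous p) {A : ℝ} (hA : ∀ γ, ‖p γ‖ ≤ A) (u v : 𝓢(EuclideanSpace ℝ (Fin n), ℂ)) :
    Integrable (fun q : PhaseSpace n × PhaseSpace n =>
      averagingWeight q.2 * (p (q.1 + √h • q.2) * rihaczek h u v q.1)) (volume.prod volume) := by
  have h1 := ((integrable_rihaczek hh u v).mul_prod (integrable_averagingWeight n)).bdd_mul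
    (c := A) (f := fun q : PhaseSpace n × PhaseSpace n => p (q.1 + √h • q.2))
    (Continuous.aestronglyMeasurable (by fun_prop)) (.of_forall fun q => hA _)
  refine h1.congr (.of_forall fun q => ?_)
  simp only
  ring

theorem inner_mulOp_eq_integral {h : ℝ} (hh : 0 < h) {p : PhaseSpace n → ℂ}
    (hpm : MemLp p ∞ (volume : Measure (PhaseSpace n))) (u v : 𝓢(EuclideanSpace ℝ (Fin n), ℂ)) :
    inner ℂ (fbiTransform hh (v.toLp 2)) (mulOp p hpm (fbiTransform hh (u.toLp 2))) =
      ∫ β, p β * (conj (fbiFun h v β) * fbiFun h u β) := by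
  rw [L2.inner_def]
  refine integral_congr_ae ?_
  filter_upwards [mulOp_ae hpm (fbiTransform hh (u.toLp 2)), fbiTransform_toLp_ae hh u,
    fbiTransform_toLp_ae hh v] with β h1 h2 h3
  rw [h1, h2, h3, RCLike.inner_apply]
  ring

theorem conj_fbiFun_mul_fbiFun {h : ℝ} (hh : 0 < h) (u v : 𝓢(EuclideanSpace ℝ (Fin n), ℂ))
    (β : PhaseSpace n) :
    conj (fbiFun h v β) * fbiFun h u β = ∫ γ : PhaseSpace n, wavePacket h β γ.1 * conj (v γ.1) *
        ((((2 * Real.pi * h) ^ n)⁻¹ : ℝ) *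
          (conj (packetFourier h β γ.2) * planckFourier h u γ.2)) := by
  have e := integral_prod_mul (μ := (volume : Measure (EuclideanSpace ℝ (Fin n))))
    (ν := (volume : Measure (EuclideanSpace ℝ (Fin n))))
    (fun x => wavePacket h β x * conj (v x)) (fun ξ => ((((2 * Real.pi * h) ^ n)⁻¹ : ℝ) : ℂ) *
          (conj (packetFourier h β ξ) * planckFourier h u ξ))
  refine Eq.trans ?_ e.symm
  rw [integral_const_mul, ← fbiFun_eq_integral_planckFourier hh, fbiFun_eq h v, ← integral_conj]
  simp only [map_mul, Complex.conj_conj]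

theorem integral_toeplitz_integrand {h : ℝ} (hh : 0 < h) (p : PhaseSpace n → ℂ)
    (u v : EuclideanSpace ℝ (Fin n) → ℂ) (γ : PhaseSpace n) :
    ∫ β, p β * (wavePacket h β γ.1 * conj (v γ.1) *
        ((((2 * Real.pi * h) ^ n)⁻¹ : ℝ) *
          (conj (packetFourier h β γ.2) * planckFourier h u γ.2))) =
      ∫ σ, averagingWeight σ * (p (γ + √h • σ) * rihaczek h u v γ) := by
  rw [← integral_add_left_eq_self _ γ, integral_phaseSpace_comp_sqrt_smul hh, Complex.real_smul,
    ← integral_const_mul]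
  refine integral_congr_ae (.of_forall fun σ => ?_)
  simp only
  rw [mul_left_comm, wavePacket_mul_conj_packetFourier hh, rihaczek]
  ring

/-- The Toeplitz form of `p` is an average of the forms of the translates of `p`. -/
theorem inner_mulOp_eq_integral_quantForm {h : ℝ} (hh : 0 < h) {p : PhaseSpace n → ℂ}
    (hp : Continuous p) (hpm : MemLp p ∞ (volume : Measure (PhaseSpace n)))
    {A : ℝ} (hA : ∀ γ, ‖p γ‖ ≤ A) (u v : 𝓢(EuclideanSpace ℝ (Fin n), ℂ)) :
    inner ℂ (fbiTransform hh (v.toLp 2)) (mulOp p hpm (fbiTransform hh (u.toLp 2))) =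
      ∫ σ, averagingWeight σ * quantForm (fun γ => p (γ + √h • σ)) h u v := by
  rw [inner_mulOp_eq_integral hh hpm]
  -- Tv is expanded in position and Tu in momentum, so the pair of integration variables is a point
  -- γ of phase space; Fubini then integrates over the packet centre first.
  simp only [conj_fbiFun_mul_fbiFun hh, ← integral_const_mul]
  have hI : Integrable (Function.uncurry fun β γ : PhaseSpace n => p β *
      (wavePacket h β γ.1 * conj (v γ.1) * ((((2 * Real.pi * h) ^ n)⁻¹ : ℝ) *
        (conj (packetFourier h β γ.2) * planckFourier h u γ.2)))) (volume.prod volume) :=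
    (integrable_toeplitz_integrand hh hp hA u v).swap
  rw [integral_integral_swap hI]
  simp only [integral_toeplitz_integrand hh]
  have hI2 : Integrable (Function.uncurry fun γ σ : PhaseSpace n =>
      averagingWeight σ * (p (γ + √h • σ) * rihaczek h u v γ)) (volume.prod volume) :=
    integrable_averagingWeight_mul_rihaczek hh hp hA u v
  rw [integral_integral_swap hI2]
  simp only [integral_const_mul, quantForm]

theorem integrable_averagingWeight_mul_quantForm {h : ℝ} (hh : 0 < h) {p : PhaseSpace n → ℂ}
    (hp : Continuous p) {A : ℝ} (hA : ∀ γ, ‖p γ‖ ≤ A) (u v : 𝓢(EuclideanSpace ℝ (Fin n), ℂ)) :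
    Integrable fun σ : PhaseSpace n =>
      averagingWeight σ * quantForm (fun γ => p (γ + √h • σ)) h u v := by
  refine (integrable_averagingWeight_mul_rihaczek hh hp hA u v).integral_prod_right.congr
    (.of_forall fun σ => ?_)
  simp only
  rw [integral_const_mul, quantForm]

theorem quantForm_sub {h : ℝ} (hh : 0 < h) {a b : PhaseSpace n → ℂ} (ha : Continuous a)
    (hb : Continuous b) {A : ℝ} (hA : ∀ γ, ‖a γ‖ ≤ A) (hB : ∀ γ, ‖b γ‖ ≤ A)
    (u v : 𝓢(EuclideanSpace ℝ (Fin n), ℂ)) :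
    quantForm (fun γ => a γ - b γ) h u v = quantForm a h u v - quantForm b h u v := by
  have hR := integrable_rihaczek hh u v
  rw [quantForm, quantForm, quantForm, ← integral_sub
    (hR.bdd_mul (c := A) ha.aestronglyMeasurable (.of_forall hA))
    (hR.bdd_mul (c := A) hb.aestronglyMeasurable (.of_forall hB))]
  simp only [sub_mul]

end ToeplitzForm

/-! ### Second differences of symbols and the O(h) comparison. -/

section SecondDifference

variable {n : ℕ}

theorem IsSymbolBoundedBy.norm_iteratedFDeriv_sub_le {B : ℕ → ℝ} {p : PhaseSpace n → ℂ}
    (hp : IsSymbolBoundedBy B p) (k : ℕ) (x y : PhaseSpace n) :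
    ‖iteratedFDeriv ℝ k p x - iteratedFDeriv ℝ k p y‖ ≤ B (k + 1) * ‖x - y‖ := by
  have hd : Differentiable ℝ (iteratedFDeriv ℝ k p) :=
    hp.smooth.differentiable_iteratedFDeriv (by exact_mod_cast ENat.natCast_lt_top k)
  refine Convex.norm_image_sub_le_of_norm_fderiv_le (𝕜 := ℝ) (s := Set.univ)
    (fun x _ => hd x) (fun x _ => ?_) convex_univ trivial trivial
  rw [norm_fderiv_iteratedFDeriv]
  exact hp.bound (k + 1) x

/-- A second difference is the increment of w ↦ F(w + v) - F(w) over a step v. The derivative of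
that function is again an increment, so the mean value inequality applied twice gives ‖v‖². -/
theorem IsSymbolBoundedBy.norm_iteratedFDeriv_secondDifference_le {B : ℕ → ℝ}
    {p : PhaseSpace n → ℂ} (hp : IsSymbolBoundedBy B p) (k : ℕ) (v γ : PhaseSpace n) :
    ‖iteratedFDeriv ℝ k (fun γ => (p (γ + v) - p γ) - (p γ - p (γ + -v))) γ‖ ≤
      B (k + 2) * ‖v‖ ^ 2 := by
  have hs : ∀ w : PhaseSpace n, ContDiff ℝ k fun γ => p (γ + w) := fun w =>
    (hp.smooth.comp (contDiff_id.add contDiff_const)).of_le (by exact_mod_cast le_top)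
  have hs0 : ContDiff ℝ k p := hp.smooth.of_le (by exact_mod_cast le_top)
  have hd : Differentiable ℝ (iteratedFDeriv ℝ k p) :=
    hp.smooth.differentiable_iteratedFDeriv (by exact_mod_cast ENat.natCast_lt_top k)
  rw [fun_iteratedFDeriv_sub_apply ((hs v).sub hs0).contDiffAt (hs0.sub (hs (-v))).contDiffAt,
    fun_iteratedFDeriv_sub_apply (hs v).contDiffAt hs0.contDiffAt,
    fun_iteratedFDeriv_sub_apply hs0.contDiffAt (hs (-v)).contDiffAt,
    iteratedFDeriv_comp_add_right, iteratedFDeriv_comp_add_right]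
  set F := iteratedFDeriv ℝ k p with hF
  set g : PhaseSpace n → _ := fun w => F (w + v) - F w with hg
  have hFd : ∀ x y : PhaseSpace n, ‖fderiv ℝ F x - fderiv ℝ F y‖ ≤ B (k + 2) * ‖x - y‖ := by
    intro x y
    have h1 := hp.norm_iteratedFDeriv_sub_le (k + 1) x y
    rw [iteratedFDeriv_succ_eq_comp_left, Function.comp, Function.comp, ← dist_eq_norm,
      LinearIsometryEquiv.dist_map, dist_eq_norm] at h1
    exact h1
  have hgd : ∀ w, HasFDerivAt g (fderiv ℝ F (w + v) - fderiv ℝ F w) w := fun w =>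
    ((hasFDerivAt_comp_add_right v).2 (hd (w + v)).hasFDerivAt).sub (hd w).hasFDerivAt
  have h2 := Convex.norm_image_sub_le_of_norm_hasFDerivWithin_le (𝕜 := ℝ) (s := Set.univ) (f := g)
    (C := B (k + 2) * ‖v‖) (fun w _ => (hgd w).hasFDerivWithinAt) (fun w _ => by
      refine (hFd _ _).trans (le_of_eq ?_)
      rw [add_sub_cancel_left]) convex_univ (Set.mem_univ (γ + -v)) (Set.mem_univ γ)
  have e : g γ - g (γ + -v) = F (γ + v) - F γ - (F γ - F (γ + -v)) := by
    simp only [hg, neg_add_cancel_right]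
  rw [← e]
  refine h2.trans (le_of_eq ?_)
  rw [sub_add_cancel_left, neg_neg]
  ring

/-- The standard and the Toeplitz quantization of a symbol differ by `O(h)`. -/
theorem exists_norm_quantForm_sub_inner_mulOp_le (n : ℕ) :
    ∃ C, 0 ≤ C ∧ ∀ (h : ℝ) (hh : 0 < h), h ≤ 1 → ∀ (B : ℕ → ℝ) (p : PhaseSpace n → ℂ)
      (hp : IsSymbolBoundedBy B p) (u v : 𝓢(EuclideanSpace ℝ (Fin n), ℂ)),
      ‖quantForm p h u v - inner ℂ (fbiTransform hh (v.toLp 2))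
        (mulOp p hp.memLp_top (fbiTransform hh (u.toLp 2)))‖ ≤
      C * (∑ k ∈ Finset.range (2 * n + 2), |B (k + 2)|) * h * ‖u.toLp 2 volume‖ *
        ‖v.toLp 2 volume‖ := by
  obtain ⟨C, hC0, hC⟩ := exists_norm_quantForm_le n
  have hW := integrable_pow_mul_norm_averagingWeight n 2
  set J := ∫ σ : PhaseSpace n, ‖σ‖ ^ 2 * ‖averagingWeight σ‖ with hJ
  have hJ0 : 0 ≤ J := integral_nonneg fun σ => by positivity
  refine ⟨C * J, by positivity, fun h hh h1 B p hp u v => ?_⟩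
  -- The boundedness theorem uses orders 0 to 2n + 1 of the second difference, each costing two more
  -- derivatives of p.
  set A := ∑ k ∈ Finset.range (2 * n + 2), |B (k + 2)| with hA
  have hB0 : ∀ γ, ‖p γ‖ ≤ B 0 := fun γ => by simpa using hp.bound 0 γ
  have hpc := hp.smooth.continuous
  set Φ : PhaseSpace n → ℂ := fun σ =>
    averagingWeight σ * quantForm (fun γ => p (γ + √h • σ)) h u v with hΦ
  have hΦI : Integrable Φ := integrable_averagingWeight_mul_quantForm hh hpc hB0 u v
  have hΦn : ∫ σ, Φ (-σ) = ∫ σ, Φ σ := integral_neg_eq_self Φ volume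
  have hconst : ∫ σ : PhaseSpace n, averagingWeight σ * quantForm p h u v = quantForm p h u v := by
    rw [integral_mul_const, integral_averagingWeight, one_mul]
  have hcI : Integrable fun σ : PhaseSpace n => averagingWeight σ * quantForm p h u v :=
    (integrable_averagingWeight n).mul_const _
  have hT := inner_mulOp_eq_integral_quantForm hh hpc hp.memLp_top hB0 u v
  have hdiff : ∀ σ : PhaseSpace n, (Φ σ - averagingWeight σ * quantForm p h u v) -
      (averagingWeight σ * quantForm p h u v - Φ (-σ)) = averagingWeight σ *
      quantForm (fun γ => (p (γ + √h • σ) - p γ) - (p γ - p (γ + -(√h • σ)))) h u v := by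
    intro σ
    have hb : ∀ w γ : PhaseSpace n, ‖p (γ + w) - p γ‖ ≤ B 0 + B 0 := fun w γ =>
      (norm_sub_le _ _).trans (add_le_add (hB0 _) (hB0 _))
    have hb' : ∀ w γ : PhaseSpace n, ‖p γ - p (γ + w)‖ ≤ B 0 + B 0 := fun w γ =>
      (norm_sub_le _ _).trans (add_le_add (hB0 _) (hB0 _))
    rw [quantForm_sub hh (by fun_prop) (by fun_prop) (hb _) (hb' _),
      quantForm_sub hh (by fun_prop) hpc (fun γ => hB0 _) hB0,
      quantForm_sub hh hpc (by fun_prop) hB0 (fun γ => hB0 _)]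
    simp only [hΦ, averagingWeight_neg, smul_neg]
    ring
  -- Evenness of the weight lets σ and -σ be averaged, and its unit mass turns the constant form
  -- into an average too; first-order terms cancel without a Taylor expansion.
  have hmain : -(2 * (quantForm p h u v - ∫ σ, Φ σ)) = ∫ σ : PhaseSpace n, averagingWeight σ *
      quantForm (fun γ => (p (γ + √h • σ) - p γ) - (p γ - p (γ + -(√h • σ)))) h u v := by
    simp only [← hdiff]
    have i1 : Integrable fun σ => Φ σ - averagingWeight σ * quantForm p h u v := hΦI.sub hcI
    have i2 : Integrable fun σ => averagingWeight σ * quantForm p h u v - Φ (-σ) :=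
      hcI.sub hΦI.comp_neg
    rw [integral_sub i1 i2, integral_sub hΦI hcI,
      integral_sub hcI hΦI.comp_neg, hΦn, hconst]
    ring
  have hbound : ‖-(2 * (quantForm p h u v - ∫ σ, Φ σ))‖ ≤
      ∫ σ : PhaseSpace n, (‖σ‖ ^ 2 * ‖averagingWeight σ‖) *
        (C * A * h * ‖u.toLp 2 volume‖ * ‖v.toLp 2 volume‖) := by
    rw [hmain]
    refine norm_integral_le_of_norm_le (hW.mul_const _) (.of_forall fun σ => ?_)
    have hk : ∀ k ≤ 2 * n + 1, ∀ γ, ‖iteratedFDeriv ℝ k (fun γ => (p (γ + √h • σ) - p γ) -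
        (p γ - p (γ + -(√h • σ)))) γ‖ ≤ A * (h * ‖σ‖ ^ 2) := by
      intro k hk γ
      refine (hp.norm_iteratedFDeriv_secondDifference_le k _ γ).trans ?_
      rw [norm_smul, mul_pow, Real.norm_eq_abs, sq_abs, Real.sq_sqrt hh.le]
      refine mul_le_mul_of_nonneg_right ((le_abs_self _).trans ?_) (by positivity)
      exact Finset.single_le_sum (f := fun k => |B (k + 2)|) (fun i _ => abs_nonneg _)
        (Finset.mem_range.2 (by omega))
    have hs : ContDiff ℝ ∞ fun γ => (p (γ + √h • σ) - p γ) - (p γ - p (γ + -(√h • σ))) :=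
      ((hp.smooth.comp (contDiff_id.add contDiff_const)).sub hp.smooth).sub
        (hp.smooth.sub (hp.smooth.comp (contDiff_id.add contDiff_const)))
    rw [norm_mul]
    refine (mul_le_mul_of_nonneg_left (hC h hh h1 _ _ hs hk u v) (norm_nonneg _)).trans
      (le_of_eq ?_)
    ring
  rw [integral_mul_const, norm_neg, norm_mul, Complex.norm_ofNat] at hbound
  rw [hT]
  have hA0 : 0 ≤ A := Finset.sum_nonneg fun _ _ => abs_nonneg _
  have hX : 0 ≤ J * (C * A * h * ‖u.toLp 2 volume‖ * ‖v.toLp 2 volume‖) := by positivity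
  calc _ ≤ J * (C * A * h * ‖u.toLp 2 volume‖ * ‖v.toLp 2 volume‖) := by
        linarith [norm_nonneg (quantForm p h u v - ∫ σ, Φ σ)]
    _ = _ := by ring

end SecondDifference

/-! ### From forms to operators, and the theorem. -/

section MainTheorem

variable {n : ℕ}

theorem bergmanProj_apply {h : ℝ} (hh : 0 < h) (w : L2Phase n) :
    bergmanProj n h w = fbiTransform hh
      (ContinuousLinearMap.adjoint (fbiTransform hh).toContinuousLinearMap w) := by
  refine Submodule.eq_starProjection_of_mem_of_inner_eq_zero (fbiTransform_mem_fbiSpace hh _)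
    fun z hz => ?_
  rw [← fbiTransform_adjoint_of_mem hh hz, inner_sub_left, LinearIsometry.inner_map_map,
    ContinuousLinearMap.adjoint_inner_left]
  exact sub_self _

theorem norm_inner_sub_inner_mulOp_le {h : ℝ} (hh : 0 < h) {p : PhaseSpace n → ℂ}
    (hp : MemLp p ∞ (volume : Measure (PhaseSpace n))) (P : L2Config n →L[ℂ] L2Config n) {K : ℝ}
    (hK : ∀ u v : 𝓢(EuclideanSpace ℝ (Fin n), ℂ),
      ‖inner ℂ (v.toLp 2) (P (u.toLp 2)) - inner ℂ (fbiTransform hh (v.toLp 2))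
        (mulOp p hp (fbiTransform hh (u.toLp 2)))‖ ≤ K * ‖u.toLp 2 volume‖ * ‖v.toLp 2 volume‖)
    (u v : L2Config n) :
    ‖inner ℂ (fbiTransform hh v) (fbiTransform hh (P u)) -
      inner ℂ (fbiTransform hh v) (mulOp p hp (fbiTransform hh u))‖ ≤ K * ‖u‖ * ‖v‖ := by
  have hd := SchwartzMap.denseRange_toLpCLM (E := EuclideanSpace ℝ (Fin n)) (F := ℂ) (p := 2)
    (μ := volume) ENNReal.ofNat_ne_top
  rw [LinearIsometry.inner_map_map]
  refine hd.induction_on₂ (p := fun u v => ‖inner ℂ v (P u) -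
    inner ℂ (fbiTransform hh v) (mulOp p hp (fbiTransform hh u))‖ ≤ K * ‖u‖ * ‖v‖) ?_ hK u v
  have hT := (fbiTransform (n := n) hh).continuous
  exact isClosed_le (by fun_prop) (by fun_prop)

/-- Because Π₀ = TT* and T is isometric, the quantity is the norm of v = Pu - T*pTu. Testing the
form estimate on this v gives ‖v‖² ≤ K‖u‖‖v‖. -/
theorem norm_sub_toeplitz_le {h : ℝ} (hh : 0 < h) {p : PhaseSpace n → ℂ}
    (hp : MemLp p ∞ (volume : Measure (PhaseSpace n))) (P : L2Config n →L[ℂ] L2Config n) {K : ℝ}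
    (hK : ∀ u v : L2Config n, ‖inner ℂ (fbiTransform hh v) (fbiTransform hh (P u)) -
      inner ℂ (fbiTransform hh v) (mulOp p hp (fbiTransform hh u))‖ ≤ K * ‖u‖ * ‖v‖)
    (u : L2Config n) :
    ‖fbiTransform hh (P u) - bergmanProj n h (mulOp p hp (fbiTransform hh u))‖ ≤ K * ‖u‖ := by
  rw [bergmanProj_apply hh, ← map_sub, LinearIsometry.norm_map]
  set v := P u - ContinuousLinearMap.adjoint (fbiTransform hh).toContinuousLinearMap
    (mulOp p hp (fbiTransform hh u)) with hv
  have h1 := hK u v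
  have h2 : inner ℂ (fbiTransform hh v) (fbiTransform hh (P u)) -
      inner ℂ (fbiTransform hh v) (mulOp p hp (fbiTransform hh u)) = inner ℂ v v := by
    conv_rhs => rw [hv, inner_sub_right, ContinuousLinearMap.adjoint_inner_right]
    rw [LinearIsometry.inner_map_map]
    rfl
  rw [h2, inner_self_eq_norm_sq_to_K, norm_pow, RCLike.norm_ofReal, abs_norm] at h1
  rcases (norm_nonneg v).eq_or_lt with h0 | h0
  -- The sign of K is not given; when v = 0 the hypothesis at (u, u) still yields K‖u‖ ≥ 0.
  · have := (norm_nonneg _).trans (hK u u)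
    rw [← h0]
    rcases (norm_nonneg u).eq_or_lt with h3 | h3
    · rw [← h3, mul_zero]
    · exact le_of_mul_le_mul_right (by simpa using this) h3
  · rw [sq] at h1
    exact le_of_mul_le_mul_right h1 h0

end MainTheorem

theorem theorem1 (n : ℕ) (B : ℕ → ℝ) :
    ∃ C : ℝ, ∀ h : ℝ, 0 < h → h ≤ 1 →
      ∃ T : L2Config n →ₗᵢ[ℂ] L2Phase n,
        IsFBITransform h T ∧
        LinearMap.range T.toLinearMap = fbiSpace n h ∧
        ∀ (p : PhaseSpace n → ℂ) (hp : IsSymbolBoundedBy B p),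
          ∃ P : L2Config n →L[ℂ] L2Config n,
            IsQuantization p h P ∧
            (∀ w ∈ fbiSpace n h,
              ‖conjByFBI T P w - toeplitz h p hp.memLp_top w‖ ≤ C * h * ‖w‖) ∧
            (∀ u v : L2Config n,
              ‖inner ℂ (T v) (T (P u)) - inner ℂ (T v) (mulOp p hp.memLp_top (T u))‖
                ≤ C * h * ‖u‖ * ‖v‖) ∧
            (∀ u : L2Config n,
              ‖T (P u) - mulOp p hp.memLp_top (T u)‖ ≤ C * h ^ (1 / 2 : ℝ) * ‖u‖) := by
  obtain ⟨C₁, hC₁, hCV⟩ := exists_norm_quantForm_le n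
  obtain ⟨C₂, hC₂, hQT⟩ := exists_norm_quantForm_sub_inner_mulOp_le n
  set A := ∑ k ∈ Finset.range (2 * n + 2), |B (k + 2)| with hA
  have hA0 : 0 ≤ A := Finset.sum_nonneg fun _ _ => abs_nonneg _
  -- Absolute values make the constant nonnegative before any symbol is given, since B itself may be
  -- negative when no symbol satisfies the bounds.
  set C₃ := ((2 * Real.pi) ^ n)⁻¹ * |B 1| *
    (∫ γ : PhaseSpace n, ‖γ‖ * Real.exp (-(1 / 4) * distSq 0 γ)) with hC₃
  have hC₃0 : 0 ≤ C₃ := by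
    have := Real.pi_pos
    have : 0 ≤ ∫ γ : PhaseSpace n, ‖γ‖ * Real.exp (-(1 / 4) * distSq 0 γ) :=
      integral_nonneg fun γ => by positivity
    positivity
  refine ⟨C₂ * A + C₃, fun h hh h1 => ⟨fbiTransform hh, isFBITransform_fbiTransform hh,
    range_fbiTransform hh, fun p hp => ?_⟩⟩
  have hB0 : ∀ γ, ‖p γ‖ ≤ B 0 := fun γ => by simpa using hp.bound 0 γ
  have hpc := hp.smooth.continuous
  have hp1 : ∀ k ≤ 2 * n + 1, ∀ γ, ‖iteratedFDeriv ℝ k p γ‖ ≤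
      ∑ k ∈ Finset.range (2 * n + 2), |B k| := fun k hk γ =>
    ((hp.bound k γ).trans (le_abs_self _)).trans (Finset.single_le_sum (f := fun k => |B k|)
      (fun i _ => abs_nonneg _) (Finset.mem_range.2 (by omega)))
  obtain ⟨P, hP⟩ := exists_isQuantization hh hpc hB0
    (K := C₁ * ∑ k ∈ Finset.range (2 * n + 2), |B k|)
    (mul_nonneg hC₁ (Finset.sum_nonneg fun _ _ => abs_nonneg _))
    (hCV h hh h1 p _ hp.smooth hp1)
  have hform := norm_inner_sub_inner_mulOp_le hh hp.memLp_top P (K := C₂ * A * h) fun u v => by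
    rw [hP.inner_eq hh hpc hB0]
    exact hQT h hh h1 B p hp u v
  have htoep := norm_sub_toeplitz_le hh hp.memLp_top P hform
  have hle : C₂ * A * h ≤ (C₂ * A + C₃) * h :=
    mul_le_mul_of_nonneg_right (le_add_of_nonneg_right hC₃0) hh.le
  refine ⟨P, hP, fun w hw => ?_, fun u v => ?_, fun u => ?_⟩
  · set u := ContinuousLinearMap.adjoint (fbiTransform hh).toContinuousLinearMap w with hu
    have hw' : fbiTransform hh u = w := fbiTransform_adjoint_of_mem hh hw
    have hproj : bergmanProj n h w = w := by rw [bergmanProj_apply hh, ← hu, hw']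
    have h2 := htoep u
    rw [hw', ← (fbiTransform hh).norm_map u, hw'] at h2
    calc _ = ‖fbiTransform hh (P u) - bergmanProj n h (mulOp p hp.memLp_top w)‖ := by
          rw [toeplitz, ContinuousLinearMap.comp_apply, ContinuousLinearMap.comp_apply, hproj]
          rfl
      _ ≤ _ := h2.trans (mul_le_mul_of_nonneg_right hle (norm_nonneg _))
  · refine (hform u v).trans (mul_le_mul_of_nonneg_right
      (mul_le_mul_of_nonneg_right hle (norm_nonneg _)) (norm_nonneg _))
  -- Split TPu - pTu at Π₀pTu: the first part is the O(h) Toeplitz estimate, the second is (1 -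
  -- Π₀)pTu = O(√h). As h ≤ √h for h ≤ 1, the latter dominates.
  · have h2 := norm_mulOp_sub_proj_le hh hp (fbiTransform_mem_fbiSpace hh u)
    rw [← bergmanProj_apply hh, LinearIsometry.norm_map, norm_sub_rev] at h2
    have hs0 := Real.sqrt_nonneg h
    have hs : h ≤ √h := by
      nlinarith [Real.sq_sqrt hh.le, Real.sqrt_le_one.2 h1]
    have hB1 : B 1 = |B 1| := (abs_of_nonneg ((norm_nonneg _).trans (hp.bound 1 0))).symm
    rw [hB1, ← hC₃] at h2
    rw [← Real.sqrt_eq_rpow]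
    calc ‖fbiTransform hh (P u) - mulOp p hp.memLp_top (fbiTransform hh u)‖ ≤
          C₂ * A * h * ‖u‖ + C₃ * √h * ‖u‖ :=
          (norm_sub_le_norm_sub_add_norm_sub _ _ _).trans (add_le_add (htoep u) h2)
      _ ≤ C₂ * A * √h * ‖u‖ + C₃ * √h * ‖u‖ := by
          refine add_le_add (mul_le_mul_of_nonneg_right (mul_le_mul_of_nonneg_left hs
            (by positivity)) (norm_nonneg _)) le_rfl
      _ = _ := by ring
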